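/- Let $(x_1,x_2,\eta)$ be complex variables and $\partial_j=\partial/\partial x_j$. The Pearcey operators with large parameter $\eta$ are $$P_1=4\partial_1\partial_2+2\eta x_2\partial_1+\eta^2x_1,\quad P_2=4\partial_2^2+\eta x_1\partial_1+2\eta x_2\partial_2+\eta,\quad P_3=\eta\partial_2-\partial_1^2,\quad P_4=3x_1\partial_1+2x_2\partial_2-4\eta\partial_\eta-1.$$ Their formal Borel transforms $P_{k,B}$ are obtained by replacing $\eta$ by $\partial_y$ and $\partial_\eta$ by $-y$: $$P_{1,B}=4\partial_1\partial_2+2x_2\partial_y\partial_1+x_1\partial_y^2,\quad P_{2,B}=4\partial_2^2+x_1\partial_y\partial_1+2x_2\partial_y\partial_2+\partial_y,$$ $$P_{3,B}=\partial_y\partial_2-\partial_1^2,\quad P_{4,B}=3x_1\partial_1+2x_2\partial_2+4y\partial_y+3.$$ Let $\mathcal D_B$ be the Weyl algebra over $\mathbb C$ in the variables $(x_1,x_2,y)$ and let $\mathcal I_B$ be the left ideal generated by $P_{1,B},\dots,P_{4,B}$. WKB solutions. Let $U\subset\mathbb C^2$ be open, let $S_{-1}$ be a holomorphic function on $U$ with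 $4S_{-1}^3+2x_2S_{-1}+x_1=0$ (one of the three roots of this cubic), put $w=6S_{-1}^2+x_2$, and let a holomorphic branch of $w^{-1/2}$ on $U$ be given. Define $S_0=-\tfrac12\,\partial_1w/w$ and, for $k\ge1$, $$S_k=-\frac2w\Big(\sum_{\substack{k_1+k_2+k_3=k-2\\-1\le k_i<k}}S_{k_1}S_{k_2}S_{k_3}+3\sum_{\substack{k_1+k_2=k-2\\-1\le k_i<k}}S_{k_1}\partial_1S_{k_2}+\partial_1^2S_{k-2}\Big),$$ $T_{-1}=S_{-1}^2$, $T_k=\partial_1S_{k-1}+\sum_{j=-1}^{k}S_jS_{k-j-1}$ for $k\ge0$, and $\Omega_k=-\frac1{4k}(3x_1S_k+2x_2T_k)$ for $k\neq0$. The associated WKB solution is the formal expression $$\psi=(\eta w)^{-1/2}\exp\Big(\eta\,\Omega_{-1}+\sum_{k\ge1}\eta^{-k}\Omega_k\Big)=e^{\eta\Omega_{-1}}\sum_{n\ge0}f_n\,\eta^{-n-1/2},$$ and its Borel transform is $$\psi_B(x_1,x_2,y)=\sum_{n\ge0}\frac{f_n(x_1,x_2)}{\Gamma(n+\frac12)}\,\big(y+\Omega_{-1}(x_1,x_2)\big)^{n-1/2}.$$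 The three roots of the cubic give the three WKB solutions $\psi_1,\psi_2,\psi_3$. Theorem. (i) The left $\mathcal D_B$-module $\mathcal M_B=\mathcal D_B/\mathcal I_B$ is holonomic, that is, it is zero or its characteristic variety in $\mathbb C^6$ has dimension $3$. (ii) Its rank $\dim_{\mathbb C(x_1,x_2,y)}\mathbb C(x_1,x_2,y)\otimes_{\mathbb C[x_1,x_2,y]}\mathcal M_B$ is $3$. (iii) The Borel transforms of the WKB solutions are solutions of $\mathcal M_B$: for all $U$, $S_{-1}$ and $w^{-1/2}$ as above there is an open neighbourhood $N\subset U\times\mathbb C$ of the graph $\{y=-\Omega_{-1}(x_1,x_2)\}$ over $U$ such that, on every open $V\subset N$ off this graph with a holomorphic branch of $(y+\Omega_{-1})^{1/2}$ on $V$, the series $\psi_B$ converges to a holomorphic function that is annihilated by every $P\in\mathcal I_B$. -/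

import Mathlib

/-! ## The Weyl algebra -/

/-- The defining relations of the Weyl algebra in `n` variables:
`inl i` stands for the variable `x_i` and `inr i` for the derivation `∂_i`. -/
inductive WeylRel (n : ℕ) :
    FreeAlgebra ℂ (Fin n ⊕ Fin n) → FreeAlgebra ℂ (Fin n ⊕ Fin n) → Prop
  | xx (i j : Fin n) : WeylRel n
      (FreeAlgebra.ι ℂ (Sum.inl i) * FreeAlgebra.ι ℂ (Sum.inl j))
      (FreeAlgebra.ι ℂ (Sum.inl j) * FreeAlgebra.ι ℂ (Sum.inl i))
  | dd (i j : Fin n) : WeylRel n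
      (FreeAlgebra.ι ℂ (Sum.inr i) * FreeAlgebra.ι ℂ (Sum.inr j))
      (FreeAlgebra.ι ℂ (Sum.inr j) * FreeAlgebra.ι ℂ (Sum.inr i))
  | dx (i j : Fin n) : WeylRel n
      (FreeAlgebra.ι ℂ (Sum.inr i) * FreeAlgebra.ι ℂ (Sum.inl j))
      (FreeAlgebra.ι ℂ (Sum.inl j) * FreeAlgebra.ι ℂ (Sum.inr i) + if i = j then 1 else 0)

/-- The Weyl algebra over `ℂ` in `n` variables. -/
def WeylAlgebra (n : ℕ) : Type := RingQuot (WeylRel n)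

namespace WeylAlgebra

noncomputable instance (n : ℕ) : Ring (WeylAlgebra n) :=
  inferInstanceAs (Ring (RingQuot (WeylRel n)))

noncomputable instance (n : ℕ) : Algebra ℂ (WeylAlgebra n) :=
  inferInstanceAs (Algebra ℂ (RingQuot (WeylRel n)))

variable {n : ℕ}

/-- The `i`-th variable, as an element of the Weyl algebra. -/
noncomputable def x (i : Fin n) : WeylAlgebra n :=
  RingQuot.mkAlgHom ℂ (WeylRel n) (FreeAlgebra.ι ℂ (Sum.inl i))

/-- The `i`-th partial derivation, as an element of the Weyl algebra. -/
noncomputable def d (i : Fin n) : WeylAlgebra n :=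
  RingQuot.mkAlgHom ℂ (WeylRel n) (FreeAlgebra.ι ℂ (Sum.inr i))

theorem x_comm (i j : Fin n) : (x i : WeylAlgebra n) * x j = x j * x i := by
  have h := RingQuot.mkAlgHom_rel ℂ (WeylRel.xx i j)
  rw [map_mul, map_mul] at h
  exact h

theorem d_comm (i j : Fin n) : (d i : WeylAlgebra n) * d j = d j * d i := by
  have h := RingQuot.mkAlgHom_rel ℂ (WeylRel.dd i j)
  rw [map_mul, map_mul] at h
  exact h

theorem d_mul_x (i j : Fin n) :
    (d i : WeylAlgebra n) * x j = x j * d i + if i = j then 1 else 0 := by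
  have h := RingQuot.mkAlgHom_rel ℂ (WeylRel.dx i j)
  rw [map_mul, map_add, map_mul, apply_ite (RingQuot.mkAlgHom ℂ (WeylRel n)), map_one,
    map_zero] at h
  exact h

/-- The universal property of the Weyl algebra. -/
noncomputable def lift {A : Type*} [Ring A] [Algebra ℂ A] (X D : Fin n → A)
    (hX : ∀ i j, X i * X j = X j * X i) (hD : ∀ i j, D i * D j = D j * D i)
    (hDX : ∀ i j, D i * X j = X j * D i + if i = j then 1 else 0) :
    WeylAlgebra n →ₐ[ℂ] A :=
  RingQuot.liftAlgHom ℂ ⟨FreeAlgebra.lift ℂ (Sum.elim X D), by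
    intro a b hab
    cases hab with
    | xx i j => simpa using hX i j
    | dd i j => simpa using hD i j
    | dx i j =>
      have h := hDX i j
      split_ifs at h ⊢ <;> simpa using h⟩

section lift

variable {A : Type*} [Ring A] [Algebra ℂ A] (X D : Fin n → A)
    (hX : ∀ i j, X i * X j = X j * X i) (hD : ∀ i j, D i * D j = D j * D i)
    (hDX : ∀ i j, D i * X j = X j * D i + if i = j then 1 else 0)

theorem lift_x (i : Fin n) : lift X D hX hD hDX (x i) = X i := by
  have h : lift X D hX hD hDX (x i) = FreeAlgebra.lift ℂ (Sum.elim X D)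
      (FreeAlgebra.ι ℂ (Sum.inl i)) := RingQuot.liftAlgHom_mkAlgHom_apply ℂ _ _ _
  simpa using h

theorem lift_d (i : Fin n) : lift X D hX hD hDX (d i) = D i := by
  have h : lift X D hX hD hDX (d i) = FreeAlgebra.lift ℂ (Sum.elim X D)
      (FreeAlgebra.ι ℂ (Sum.inr i)) := RingQuot.liftAlgHom_mkAlgHom_apply ℂ _ _ _
  simpa using h

end lift

/-! ## Normal ordering, characteristic ideal, holonomicity -/

/-- Evaluation of commutative polynomials at a commuting family of elements of an algebra. -/
noncomputable def evalComm {A : Type*} [Ring A] [Algebra ℂ A] (a : Fin n → A)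
    (h : ∀ i j, a i * a j = a j * a i) : MvPolynomial (Fin n) ℂ →ₐ[ℂ] A :=
  have hc : ∀ u v : Algebra.adjoin ℂ (Set.range a), u * v = v * u :=
    (Algebra.isMulCommutative_adjoin ℂ
      (by rintro _ ⟨i, rfl⟩ _ ⟨j, rfl⟩; exact h i j)).is_comm.comm
  letI : CommRing (Algebra.adjoin ℂ (Set.range a)) :=
    { (inferInstance : Ring (Algebra.adjoin ℂ (Set.range a))) with mul_comm := hc }
  (Algebra.adjoin ℂ (Set.range a)).val.comp
    (MvPolynomial.aeval fun i => ⟨a i, Algebra.subset_adjoin ⟨i, rfl⟩⟩)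

theorem evalComm_X {A : Type*} [Ring A] [Algebra ℂ A] (a : Fin n → A)
    (h : ∀ i j, a i * a j = a j * a i) (i : Fin n) :
    evalComm a h (MvPolynomial.X i) = a i := by
  simp [evalComm]

/-- The embedding of `ℂ[x]` into the Weyl algebra. -/
noncomputable def polyX : MvPolynomial (Fin n) ℂ →ₐ[ℂ] WeylAlgebra n := evalComm x x_comm

/-- The embedding of `ℂ[∂]` into the Weyl algebra. -/
noncomputable def polyD : MvPolynomial (Fin n) ℂ →ₐ[ℂ] WeylAlgebra n := evalComm d d_comm

/-- The ring `ℂ[x][ξ]` of total symbols: polynomials in the covariables `ξ_i` with coefficients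
in `ℂ[x]`.  This is the graded ring of the Weyl algebra for the filtration by the order of
differential operators. -/
abbrev Symbol (n : ℕ) : Type := MvPolynomial (Fin n) (MvPolynomial (Fin n) ℂ)

/-- The differential operator `∑ a_β(x) ∂^β` with total symbol `∑ a_β(x) ξ^β`. -/
noncomputable def ofSymbol (f : Symbol n) : WeylAlgebra n :=
  ∑ β ∈ f.support, polyX (f.coeff β) * polyD (MvPolynomial.monomial β 1)

/-- The characteristic ideal of `D / I`: the ideal of `ℂ[x, ξ]` generated by the principal symbols
of the elements of `I`.  Here `f`, homogeneous of degree `k` in `ξ`, is the principal symbol of an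
operator of order `k` if the total symbol of the latter is `f + g` with `g` of degree less than `k`
in `ξ`.  The zero set of the characteristic ideal is the characteristic variety of `D / I`. -/
noncomputable def charIdeal (I : Submodule (WeylAlgebra n) (WeylAlgebra n)) : Ideal (Symbol n) :=
  Ideal.span {f | ∃ k : ℕ, f.IsHomogeneous k ∧
    ∃ g : Symbol n, (g = 0 ∨ g.totalDegree < k) ∧ ofSymbol (f + g) ∈ I}

/-- The left module `D / I` is holonomic: it is zero or its characteristic variety has
dimension `n`. -/
def IsHolonomic (I : Submodule (WeylAlgebra n) (WeylAlgebra n)) : Prop :=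
  I = ⊤ ∨ ringKrullDim (Symbol n ⧸ charIdeal I) = n

/-- The left module `D / I`. -/
abbrev CyclicModule (I : Submodule (WeylAlgebra n) (WeylAlgebra n)) : Type := WeylAlgebra n ⧸ I

/-- The module `D / I` over the subring `ℂ[x]` of the Weyl algebra. -/
noncomputable instance (I : Submodule (WeylAlgebra n) (WeylAlgebra n)) :
    Module (MvPolynomial (Fin n) ℂ) (CyclicModule I) :=
  Module.compHom (CyclicModule I) (polyX (n := n)).toRingHom

open scoped TensorProduct in
/-- The (holonomic) rank of `D / I`: the dimension of `ℂ(x) ⊗ D / I` over `ℂ(x)`. -/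
noncomputable def rank (I : Submodule (WeylAlgebra n) (WeylAlgebra n)) : Cardinal :=
  Module.rank (FractionRing (MvPolynomial (Fin n) ℂ))
    (FractionRing (MvPolynomial (Fin n) ℂ) ⊗[MvPolynomial (Fin n) ℂ] CyclicModule I)

end WeylAlgebra

/-! ## The action on holomorphic functions -/

/-- The holomorphic functions on an open set `V` of `ℂⁿ`, represented by their extensions by zero
to `ℂⁿ`. -/
def Holo {n : ℕ} (V : TopologicalSpace.Opens (Fin n → ℂ)) : Submodule ℂ ((Fin n → ℂ) → ℂ) where
  carrier := {f | AnalyticOnNhd ℂ f V ∧ ∀ p ∉ V, f p = 0}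
  add_mem' {f g} hf hg := ⟨hf.1.add hg.1, fun p hp => by simp [hf.2 p hp, hg.2 p hp]⟩
  zero_mem' := ⟨fun _ _ => analyticAt_const, fun _ _ => rfl⟩
  smul_mem' c f hf := ⟨fun p hp => analyticAt_const.mul (hf.1 p hp),
    fun p hp => by simp [hf.2 p hp]⟩

namespace Holo

variable {n : ℕ} (V : TopologicalSpace.Opens (Fin n → ℂ))

/-- Multiplication by the `i`-th coordinate. -/
noncomputable def mulCoord (i : Fin n) : Module.End ℂ (Holo V) where
  toFun f := ⟨fun p => p i * f.1 p,
    fun p hp => ((ContinuousLinearMap.proj (R := ℂ) (φ := fun _ : Fin n => ℂ) i).analyticAt p).mul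
      (f.2.1 p hp), fun p hp => by simp [f.2.2 p hp]⟩
  map_add' f g := by ext p; simp [mul_add]
  map_smul' c f := by ext p; simp; ring

open Classical in
/-- The partial derivative with respect to the `i`-th coordinate. -/
noncomputable def partialDeriv (i : Fin n) : Module.End ℂ (Holo V) where
  toFun f := ⟨fun p => if p ∈ V then fderiv ℂ f.1 p (Pi.single i 1) else 0,
    by
      intro p hp
      have h1 : AnalyticAt ℂ (fun q => fderiv ℂ f.1 q (Pi.single i 1)) p :=
        ((ContinuousLinearMap.apply ℂ ℂ (Pi.single i (1 : ℂ) : Fin n → ℂ)).analyticAt _).comp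
          (f.2.1.fderiv p hp)
      refine h1.congr ?_
      filter_upwards [V.isOpen.mem_nhds hp] with q hq
      have hq' : q ∈ V := hq
      simp [hq'],
    fun p hp => by simp [hp]⟩
  map_add' f g := by
    ext p
    by_cases hp : p ∈ V
    · simp only [Submodule.coe_add, Pi.add_apply, hp, if_true]
      rw [fderiv_add (f.2.1 p hp).differentiableAt (g.2.1 p hp).differentiableAt]
      rfl
    · simp [hp]
  map_smul' c f := by
    ext p
    by_cases hp : p ∈ V
    · simp only [Submodule.coe_smul, Pi.smul_apply, hp, if_true, RingHom.id_apply]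
      rw [fderiv_const_smul (f.2.1 p hp).differentiableAt]
      rfl
    · simp [hp]

theorem mulCoord_comm (i j : Fin n) : mulCoord V i * mulCoord V j = mulCoord V j * mulCoord V i := by
  ext f p
  simp only [mulCoord, Module.End.mul_apply, LinearMap.coe_mk, AddHom.coe_mk]
  ring

theorem partialDeriv_apply (i : Fin n) (f : Holo V) {p : Fin n → ℂ} (hp : p ∈ V) :
    (partialDeriv V i f).1 p = fderiv ℂ f.1 p (Pi.single i 1) := by
  simp [partialDeriv, hp]

theorem partialDeriv_apply_apply (i j : Fin n) (f : Holo V) {p : Fin n → ℂ} (hp : p ∈ V) :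
    (partialDeriv V i (partialDeriv V j f)).1 p =
      fderiv ℂ (fderiv ℂ f.1) p (Pi.single i 1) (Pi.single j 1) := by
  rw [partialDeriv_apply V i _ hp]
  have h : (partialDeriv V j f).1 =ᶠ[nhds p] fun q => fderiv ℂ f.1 q (Pi.single j 1) := by
    filter_upwards [V.isOpen.mem_nhds hp] with q hq
    exact partialDeriv_apply V j f hq
  rw [h.fderiv_eq, fderiv_clm_apply (f.2.1.fderiv p hp).differentiableAt
    (differentiableAt_const _)]
  simp

theorem partialDeriv_comm (i j : Fin n) :
    partialDeriv V i * partialDeriv V j = partialDeriv V j * partialDeriv V i := by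
  ext f p
  simp only [Module.End.mul_apply]
  by_cases hp : p ∈ V
  · rw [partialDeriv_apply_apply V i j f hp, partialDeriv_apply_apply V j i f hp]
    exact (f.2.1 p hp).contDiffAt.isSymmSndFDerivAt_of_omega _ _
  · rw [(partialDeriv V i _).2.2 p hp, (partialDeriv V j _).2.2 p hp]

theorem partialDeriv_mul_mulCoord (i j : Fin n) :
    partialDeriv V i * mulCoord V j =
      mulCoord V j * partialDeriv V i + if i = j then 1 else 0 := by
  ext f p
  by_cases hp : p ∈ V
  · have h1 : (partialDeriv V i (mulCoord V j f)).1 p =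
        p j * fderiv ℂ f.1 p (Pi.single i 1) + if i = j then f.1 p else 0 := by
      rw [partialDeriv_apply V i _ hp]
      change fderiv ℂ (fun q : Fin n → ℂ => q j * f.1 q) p (Pi.single i 1) = _
      have hj : HasFDerivAt (fun q : Fin n → ℂ => q j)
          (ContinuousLinearMap.proj (R := ℂ) (φ := fun _ : Fin n => ℂ) j) p :=
        (ContinuousLinearMap.proj (R := ℂ) (φ := fun _ : Fin n => ℂ) j).hasFDerivAt
      have hm : HasFDerivAt (fun q : Fin n → ℂ => q j * f.1 q) _ p :=
        hj.mul (f.2.1 p hp).differentiableAt.hasFDerivAt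
      rw [hm.fderiv]
      by_cases hij : i = j
      · subst hij; simp
      · simp [hij, Ne.symm hij]
    have h2 : (mulCoord V j (partialDeriv V i f)).1 p =
        p j * fderiv ℂ f.1 p (Pi.single i 1) := by
      change p j * (partialDeriv V i f).1 p = _
      rw [partialDeriv_apply V i f hp]
    simp only [Module.End.mul_apply, LinearMap.add_apply, Submodule.coe_add, Pi.add_apply]
    rw [h1, h2]
    by_cases hij : i = j <;> simp [hij]
  · rw [((partialDeriv V i * mulCoord V j) f).2.2 p hp,
      ((mulCoord V j * partialDeriv V i + if i = j then 1 else 0 : Module.End ℂ (Holo V)) f).2.2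
        p hp]

/-- The action of the Weyl algebra on the holomorphic functions on `V`. -/
noncomputable def act : WeylAlgebra n →ₐ[ℂ] Module.End ℂ (Holo V) :=
  WeylAlgebra.lift (mulCoord V) (partialDeriv V) (mulCoord_comm V) (partialDeriv_comm V)
    (partialDeriv_mul_mulCoord V)

end Holo

/-- `u` is a holomorphic solution on `V` of the left module `D / I`. -/
def IsHoloSolution {n : ℕ} (I : Submodule (WeylAlgebra n) (WeylAlgebra n))
    {V : TopologicalSpace.Opens (Fin n → ℂ)} (u : Holo V) : Prop :=
  ∀ P ∈ I, Holo.act V P u = 0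

/-! ## The Pearcey operators and their formal Borel transforms -/

namespace Pearcey

open WeylAlgebra

/-- The operators `P₁, …, P₄`, in the Weyl algebra of the variables `(x₁, x₂, η)`. -/
noncomputable def op : Fin 4 → WeylAlgebra 3 :=
  let x₁ : WeylAlgebra 3 := x 0
  let x₂ : WeylAlgebra 3 := x 1
  let η : WeylAlgebra 3 := x 2
  let d₁ : WeylAlgebra 3 := d 0
  let d₂ : WeylAlgebra 3 := d 1
  let dη : WeylAlgebra 3 := d 2
  ![4 * d₁ * d₂ + 2 * η * x₂ * d₁ + η ^ 2 * x₁,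
    4 * d₂ ^ 2 + η * x₁ * d₁ + 2 * η * x₂ * d₂ + η,
    η * d₂ - d₁ ^ 2,
    3 * x₁ * d₁ + 2 * x₂ * d₂ - 4 * η * dη - 1]

/-- The formal Borel transform of operators, from the Weyl algebra of `(x₁, x₂, η)` to that of
`(x₁, x₂, y)`: it replaces `η` by `∂_y` and `∂_η` by `-y`. -/
noncomputable def borelHom : WeylAlgebra 3 →ₐ[ℂ] WeylAlgebra 3 :=
  WeylAlgebra.lift ![x 0, x 1, d 2] ![d 0, d 1, -x 2]
    (by
      intro i j
      fin_cases i <;> fin_cases j <;> simp [x_comm, d_mul_x])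
    (by
      intro i j
      fin_cases i <;> fin_cases j <;> simp [d_comm, d_mul_x])
    (by
      intro i j
      fin_cases i <;> fin_cases j <;> simp [x_comm, d_comm, d_mul_x])

/-- The operators `P_{k,B}`. -/
noncomputable def opB (k : Fin 4) : WeylAlgebra 3 := borelHom (op k)

/-- The explicit form of the `P_{k,B}`, in the variables `x 0 = x₁`, `x 1 = x₂`, `x 2 = y`. -/
theorem opB_eq : opB =
    ![4 * d 0 * d 1 + 2 * x 1 * d 2 * d 0 + x 0 * d 2 ^ 2,
      4 * d 1 ^ 2 + x 0 * d 2 * d 0 + 2 * x 1 * d 2 * d 1 + d 2,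
      d 2 * d 1 - d 0 ^ 2,
      3 * x 0 * d 0 + 2 * x 1 * d 1 + 4 * x 2 * d 2 + 3] := by
  have c0 : (d 2 : WeylAlgebra 3) * x 0 = x 0 * d 2 := by simp [d_mul_x]
  have c1 : (d 2 : WeylAlgebra 3) * x 1 = x 1 * d 2 := by simp [d_mul_x]
  have c2 : (d 2 : WeylAlgebra 3) * x 2 = x 2 * d 2 + 1 := by simp [d_mul_x]
  funext k
  fin_cases k
  · simp only [opB, op, borelHom, map_add, map_mul, map_pow, map_ofNat, lift_x, lift_d,
      Fin.zero_eta, Matrix.cons_val]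
    rw [pow_two, mul_assoc (d 2) (d 2) (x 0), c0, ← mul_assoc (d 2), c0, mul_assoc 2, c1]
    noncomm_ring
  · simp only [opB, op, borelHom, map_add, map_mul, map_pow, map_ofNat, lift_x, lift_d,
      Fin.mk_one, Matrix.cons_val]
    rw [c0, mul_assoc 2, c1]
    noncomm_ring
  · simp only [opB, op, borelHom, map_sub, map_mul, map_pow, lift_x, lift_d, Fin.reduceFinMk,
      Matrix.cons_val]
  · simp only [opB, op, borelHom, map_add, map_sub, map_mul, map_ofNat, map_one, lift_x, lift_d,
      Fin.reduceFinMk, Matrix.cons_val]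
    rw [mul_neg, mul_assoc 4, c2]
    noncomm_ring
    simp

/-- The left ideal generated by the `P_{k,B}`. -/
noncomputable def idealB : Submodule (WeylAlgebra 3) (WeylAlgebra 3) :=
  Submodule.span (WeylAlgebra 3) (Set.range opB)

/-! ## The WKB solutions and their Borel transforms -/

/-- The derivation `∂/∂x₁` of functions of `(x₁, x₂)`. -/
noncomputable def d₁ (f : (Fin 2 → ℂ) → ℂ) (p : Fin 2 → ℂ) : ℂ := fderiv ℂ f p (Pi.single 0 1)

/-- The function `6 S₋₁² + x₂`, where `s = S₋₁`. -/
def w (s : (Fin 2 → ℂ) → ℂ) (p : Fin 2 → ℂ) : ℂ := 6 * s p ^ 2 + p 1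

/-- `coefS s n` is the coefficient `S_{n-1}` of `S = ∑_{k ≥ -1} S_k η^{-k}`, for `S₋₁ = s`. -/
noncomputable def coefS (s : (Fin 2 → ℂ) → ℂ) : ℕ → (Fin 2 → ℂ) → ℂ
  | 0 => s
  | 1 => fun p => -(1 / 2) * (d₁ (w s) p / w s p)
  | m + 2 => fun p => -(2 / w s p) *
      ((∑ a : Fin (m + 2), ∑ b : Fin (m + 2), ∑ c : Fin (m + 2),
          if (a : ℕ) + b + c = m + 2 then coefS s a p * coefS s b p * coefS s c p else 0)
        + 3 * (∑ a : Fin (m + 2), ∑ b : Fin (m + 2),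
          if (a : ℕ) + b = m + 1 then coefS s a p * d₁ (coefS s b) p else 0)
        + d₁ (d₁ (coefS s m)) p)
  termination_by n => n

/-- `coefT s n` is the coefficient `T_{n-1}` of `T = ∑_{k ≥ -1} T_k η^{-k}`. -/
noncomputable def coefT (s : (Fin 2 → ℂ) → ℂ) : ℕ → (Fin 2 → ℂ) → ℂ
  | 0 => fun p => s p ^ 2
  | m + 1 => fun p => d₁ (coefS s m) p +
      ∑ ab ∈ Finset.HasAntidiagonal.antidiagonal (m + 1), coefS s ab.1 p * coefS s ab.2 p

/-- The primitive of `ω₋₁`, normalized by homogeneity. -/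
noncomputable def phase (s : (Fin 2 → ℂ) → ℂ) (p : Fin 2 → ℂ) : ℂ :=
  1 / 4 * (3 * p 0 * coefS s 0 p + 2 * p 1 * coefT s 0 p)

/-- The primitive of `ω_k` for `k ≥ 1`, normalized by homogeneity. -/
noncomputable def primitive (s : (Fin 2 → ℂ) → ℂ) (k : ℕ) (p : Fin 2 → ℂ) : ℂ :=
  -(1 / (4 * (k : ℂ))) * (3 * p 0 * coefS s (k + 1) p + 2 * p 1 * coefT s (k + 1) p)

/-- The power series `∑_{k ≥ 1} (∫ ω_k) X^k` in `X = η⁻¹` at the point `p`. -/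
noncomputable def exponent (s : (Fin 2 → ℂ) → ℂ) (p : Fin 2 → ℂ) : PowerSeries ℂ :=
  PowerSeries.mk fun k => if k = 0 then 0 else primitive s k p

/-- The coefficients `f_n` of the WKB solution
`(η w)^{-1/2} exp (η ∫ ω₋₁ + ∑_{k ≥ 1} η^{-k} ∫ ω_k) = exp (η ∫ ω₋₁) ∑_n f_n η^{-n-1/2}`;
here `h` is the chosen branch of `w^{-1/2}`. The factor after `h` is the `n`-th coefficient of
the exponential of the series `exponent s p`. -/
noncomputable def wkbCoeff (s h : (Fin 2 → ℂ) → ℂ) (n : ℕ) (p : Fin 2 → ℂ) : ℂ :=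
  h p * ∑ m ∈ Finset.range (n + 1),
    (m.factorial : ℂ)⁻¹ * PowerSeries.coeff n (exponent s p ^ m)

/-- The projection `(x₁, x₂, y) ↦ (x₁, x₂)`. -/
def base (q : Fin 3 → ℂ) : Fin 2 → ℂ := ![q 0, q 1]

/-- The `n`-th term `f_n (y + ∫ ω₋₁)^{n-1/2} / Γ(n + 1/2)` of the Borel transform of the WKB
solution `exp (η ∫ ω₋₁) ∑_n f_n η^{-n-1/2}`, where `r` is the chosen branch of
`(y + ∫ ω₋₁)^{1/2}`. -/
noncomputable def borelTerm (s h : (Fin 2 → ℂ) → ℂ) (r : (Fin 3 → ℂ) → ℂ) (n : ℕ)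
    (q : Fin 3 → ℂ) : ℂ :=
  wkbCoeff s h n (base q) / Complex.Gamma ((n : ℂ) + 1 / 2) * r q ^ (2 * (n : ℤ) - 1)

end Pearcey

/-! ## The differential ring of holomorphic functions on an open set -/

/-! Everything comes from the Pearcey integral ∫ exp(η F(t)) dt with F = t⁴ + x₂ t² + x₁ t. Under
the integral sign η⁻¹∂₁ and η⁻¹∂₂ insert t and t². Hence P₃ gives zero at once, P₁ and P₂ insert the
total t-derivatives of exp(ηF) and t exp(ηF), and P₄ is the quasi-homogeneity of F, 3x₁t + 2x₂t² =
4F - tF'.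

For (iii), expand at a critical point: with t = s + τ one has F = φ + wτ² + 4sτ³ + τ⁴, where φ =
Ω₋₁. No actual integral is used. The series `moment` is defined by Gaussian moments term by term,
and differentiation under the integral, integration by parts and homogeneity are proved as
identities between coefficients, over the differential ring `HoloAlg U`. The logarithmic derivative
of `moment s v h 0` satisfies a Riccati equation whose coefficients are the recursion for S_k.
Homogeneity then gives the recursion that characterises exp(∑ Ω_k η^{-k}), so this series is the WKB
solution (`wkbCoeff_eq_extn`). Its n-th coefficient is w^{-1/2} times a form of degree n in s²/w³
and 1/w² whose coefficients are at most 1024ⁿ n!. After division by Γ(n + 1/2) the Borel transform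
becomes a convergent power series in two variables, divided by (y + φ)^{1/2}. Differentiating it
term by term turns each formal equation into P_{k,B} ψ_B = 0 (`act_opB_eq_zero`).

The lower bounds in (i) and (ii) come from one explicit solution. Substituting y = -F(t) in the
integral leaves, up to sign, the density 1/F'(t), which is rational in (x₁, x₂, t) and is killed by
the ideal. Its images under 1, ∂_y, ∂₁ are independent over ℂ[x₁, x₂, y], by counting degrees in t
modulo 4 (`eq_zero_of_mem_idealB`). So the rank is at least 3, the ideal contains no nonzero
polynomial, and the characteristic variety contains the zero section.

For the upper bounds, the operators and the derivatives of P_{4,B} form a linear system for the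
second derivatives whose determinant is twice the discriminant of F + y in t; so 1, ∂_y, ∂₁ span up
to torsion. On a component of the characteristic variety with ξ_y ≠ 0 the principal symbols express
ξ₂, x₁ and y rationally through ξ_y, ξ₁, x₂; if ξ_y = 0 they force ξ₁ = ξ₂ = 0. Either way the
dimension is at most 3. -/

/-- The holomorphic functions on the open set `U`, as a subalgebra of all functions. -/
def holoSubalgebra {n : ℕ} (U : TopologicalSpace.Opens (Fin n → ℂ)) : Subalgebra ℂ (U → ℂ) where
  carrier := {f | ∃ F : (Fin n → ℂ) → ℂ, AnalyticOnNhd ℂ F U ∧ f = fun p : U => F p}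
  mul_mem' := by
    rintro _ _ ⟨F, hF, rfl⟩ ⟨G, hG, rfl⟩
    exact ⟨F * G, hF.mul hG, rfl⟩
  add_mem' := by
    rintro _ _ ⟨F, hF, rfl⟩ ⟨G, hG, rfl⟩
    exact ⟨F + G, hF.add hG, rfl⟩
  algebraMap_mem' c := ⟨fun _ => c, analyticOnNhd_const, rfl⟩

/-- The algebra of holomorphic functions on the open set `U`. -/
def HoloAlg {n : ℕ} (U : TopologicalSpace.Opens (Fin n → ℂ)) : Type := holoSubalgebra U

namespace HoloAlg

noncomputable instance {n : ℕ} (U : TopologicalSpace.Opens (Fin n → ℂ)) : CommRing (HoloAlg U) :=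
  inferInstanceAs (CommRing (holoSubalgebra U))

noncomputable instance {n : ℕ} (U : TopologicalSpace.Opens (Fin n → ℂ)) : Algebra ℂ (HoloAlg U) :=
  inferInstanceAs (Algebra ℂ (holoSubalgebra U))

variable {n : ℕ} {U : TopologicalSpace.Opens (Fin n → ℂ)}

/-- The element of `HoloAlg U` given by a function that is analytic on `U`. -/
def of (F : (Fin n → ℂ) → ℂ) (hF : AnalyticOnNhd ℂ F U) : HoloAlg U :=
  ⟨fun p => F p, F, hF, rfl⟩

/-- A function on the whole space that represents an element of `HoloAlg U`. -/
noncomputable def extn (f : HoloAlg U) : (Fin n → ℂ) → ℂ := Function.extend Subtype.val f.1 0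

theorem ext_apply (f : HoloAlg U) {p : Fin n → ℂ} (hp : p ∈ U) : extn f p = f.1 ⟨p, hp⟩ :=
  Subtype.val_injective.extend_apply f.1 0 ⟨p, hp⟩

theorem ext_of (F : (Fin n → ℂ) → ℂ) (hF : AnalyticOnNhd ℂ F U) {p : Fin n → ℂ} (hp : p ∈ U) :
    extn (of F hF) p = F p := ext_apply _ hp

theorem analyticOnNhd_extn (f : HoloAlg U) : AnalyticOnNhd ℂ (extn f) U := by
  obtain ⟨F, hF, hf⟩ := f.2
  refine hF.congr U.isOpen fun p hp => ?_
  rw [ext_apply f hp, hf]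

theorem eq_of_ext {f g : HoloAlg U} (h : ∀ p ∈ U, extn f p = extn g p) : f = g := by
  apply Subtype.ext
  funext p
  have := h p p.2
  rwa [ext_apply f p.2, ext_apply g p.2] at this

/-- Evaluation at a point of `U`. -/
noncomputable def eval (p : U) : HoloAlg U →ₐ[ℂ] ℂ := (Pi.evalAlgHom ℂ (fun _ : U => ℂ) p).comp (holoSubalgebra U).val

theorem eval_eq_ext (f : HoloAlg U) {p : Fin n → ℂ} (hp : p ∈ U) : eval ⟨p, hp⟩ f = extn f p :=
  (ext_apply f hp).symm

theorem eval_of (F : (Fin n → ℂ) → ℂ) (hF : AnalyticOnNhd ℂ F U) (p : U) :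
    eval p (of F hF) = F p := rfl

theorem eq_of_eval {f g : HoloAlg U} (h : ∀ p, eval p f = eval p g) : f = g :=
  Subtype.ext (funext h)

theorem fderiv_congr {F G : (Fin n → ℂ) → ℂ} (h : ∀ p ∈ U, F p = G p) {p : Fin n → ℂ}
    (hp : p ∈ U) : fderiv ℂ F p = fderiv ℂ G p := by
  have : F =ᶠ[nhds p] G := by
    filter_upwards [U.isOpen.mem_nhds hp] with q hq using h q hq
  exact this.fderiv_eq

theorem ext_add (f g : HoloAlg U) {p : Fin n → ℂ} (hp : p ∈ U) :
    extn (f + g) p = (extn f + extn g) p := by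
  rw [Pi.add_apply, ← eval_eq_ext _ hp, ← eval_eq_ext _ hp, ← eval_eq_ext _ hp, map_add]

theorem ext_mul (f g : HoloAlg U) {p : Fin n → ℂ} (hp : p ∈ U) :
    extn (f * g) p = (extn f * extn g) p := by
  rw [Pi.mul_apply, ← eval_eq_ext _ hp, ← eval_eq_ext _ hp, ← eval_eq_ext _ hp, map_mul]

theorem ext_smul (c : ℂ) (f : HoloAlg U) {p : Fin n → ℂ} (hp : p ∈ U) :
    extn (c • f) p = (c • extn f) p := by
  rw [Pi.smul_apply, ← eval_eq_ext _ hp, ← eval_eq_ext _ hp, map_smul]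

theorem analyticOnNhd_fderiv_apply {F : (Fin n → ℂ) → ℂ} (hF : AnalyticOnNhd ℂ F U)
    (e : Fin n → ℂ) : AnalyticOnNhd ℂ (fun p => fderiv ℂ F p e) U := fun p hp =>
  ((ContinuousLinearMap.apply ℂ ℂ e).analyticAt _).comp (hF.fderiv p hp)

/-- The partial derivation with respect to the `i`-th coordinate. -/
noncomputable def pd (i : Fin n) : Derivation ℂ (HoloAlg U) (HoloAlg U) :=
  Derivation.mk'
    { toFun := fun f => of _ (analyticOnNhd_fderiv_apply (analyticOnNhd_extn f) (Pi.single i 1))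
      map_add' := fun f g => by
        apply eq_of_eval
        rintro ⟨p, hp⟩
        simp only [map_add, eval_of]
        rw [fderiv_congr (fun q hq => ext_add f g hq) hp,
          fderiv_add ((analyticOnNhd_extn f) p hp).differentiableAt
            ((analyticOnNhd_extn g) p hp).differentiableAt]
        rfl
      map_smul' := fun c f => by
        apply eq_of_eval
        rintro ⟨p, hp⟩
        simp only [map_smul, eval_of, RingHom.id_apply]
        rw [fderiv_congr (fun q hq => ext_smul c f hq) hp,
          fderiv_const_smul ((analyticOnNhd_extn f) p hp).differentiableAt]
        rfl }
    (fun f g => by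
      apply eq_of_eval
      rintro ⟨p, hp⟩
      simp only [LinearMap.coe_mk, AddHom.coe_mk, map_add, map_mul, eval_of, smul_eq_mul,
        eval_eq_ext f hp, eval_eq_ext g hp]
      rw [fderiv_congr (fun q hq => ext_mul f g hq) hp,
        fderiv_mul ((analyticOnNhd_extn f) p hp).differentiableAt
          ((analyticOnNhd_extn g) p hp).differentiableAt]
      simp)

theorem ext_pd (i : Fin n) (f : HoloAlg U) {p : Fin n → ℂ} (hp : p ∈ U) :
    extn (pd i f) p = fderiv ℂ (extn f) p (Pi.single i 1) :=
  ext_of _ (analyticOnNhd_fderiv_apply (analyticOnNhd_extn f) (Pi.single i 1)) hp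

theorem ext_pd_of (i : Fin n) (F : (Fin n → ℂ) → ℂ) (hF : AnalyticOnNhd ℂ F U) {p : Fin n → ℂ}
    (hp : p ∈ U) : extn (pd i (of F hF)) p = fderiv ℂ F p (Pi.single i 1) := by
  rw [ext_pd i _ hp, fderiv_congr (fun q hq => ext_of F hF hq) hp]

theorem pd_comm (i j : Fin n) (f : HoloAlg U) : pd i (pd j f) = pd j (pd i f) := by
  apply eq_of_ext
  intro p hp
  have key : ∀ i j : Fin n, extn (pd i (pd j f)) p =
      fderiv ℂ (fderiv ℂ (extn f)) p (Pi.single i 1) (Pi.single j 1) := by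
    intro i j
    rw [ext_pd i _ hp, fderiv_congr (fun q hq => ext_pd j f hq) hp,
      fderiv_clm_apply ((analyticOnNhd_extn f).fderiv p hp).differentiableAt
        (differentiableAt_const _)]
    simp
  rw [key, key]
  exact ((analyticOnNhd_extn f) p hp).contDiffAt.isSymmSndFDerivAt_of_omega _ _

theorem analyticOnNhd_apply (i : Fin n) (S : Set (Fin n → ℂ)) :
    AnalyticOnNhd ℂ (fun p : Fin n → ℂ => p i) S := fun p _ =>
  (ContinuousLinearMap.proj (R := ℂ) (φ := fun _ : Fin n => ℂ) i).analyticAt p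

/-- The `i`-th coordinate function. -/
def coord (U : TopologicalSpace.Opens (Fin n → ℂ)) (i : Fin n) : HoloAlg U :=
  of (fun p => p i) (analyticOnNhd_apply i U)

theorem pd_coord (i j : Fin n) : pd i (coord U j) = if i = j then 1 else 0 := by
  apply eq_of_ext
  intro p hp
  have hj : HasFDerivAt (fun q : Fin n → ℂ => q j)
      (ContinuousLinearMap.proj (R := ℂ) (φ := fun _ : Fin n => ℂ) j) p :=
    (ContinuousLinearMap.proj (R := ℂ) (φ := fun _ : Fin n => ℂ) j).hasFDerivAt
  rw [coord, ext_pd_of _ _ _ hp, hj.fderiv]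
  by_cases hij : i = j
  · subst hij
    rw [if_pos rfl, ← eval_eq_ext _ hp, map_one]
    simp
  · rw [if_neg hij, ← eval_eq_ext _ hp, map_zero]
    simp [Ne.symm hij]

theorem isUnit_of_ne_zero {f : HoloAlg U} (h : ∀ p ∈ U, extn f p ≠ 0) : ∃ g, f * g = 1 := by
  refine ⟨of (fun p => (extn f p)⁻¹) ((analyticOnNhd_extn f).inv h), eq_of_ext fun p hp => ?_⟩
  rw [ext_mul _ _ hp, Pi.mul_apply, ext_of _ _ hp, mul_inv_cancel₀ (h p hp), ← eval_eq_ext _ hp, map_one]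

end HoloAlg

/-! ## Coefficientwise derivations of power series -/

namespace PowerSeries

variable {R : Type*} [CommRing R] [Algebra ℂ R]

/-- The derivation of `R⟦X⟧` that applies a derivation of `R` to the coefficients. -/
noncomputable def mapDerivation (δ : Derivation ℂ R R) : Derivation ℂ (PowerSeries R) (PowerSeries R) :=
  Derivation.mk'
    { toFun := fun f => PowerSeries.mk fun n => δ (PowerSeries.coeff n f)
      map_add' := fun f g => by ext n; simp
      map_smul' := fun c f => by ext n; simp }
    (fun f g => by
      ext n
      simp only [LinearMap.coe_mk, AddHom.coe_mk, coeff_mk, coeff_mul, map_sum, map_add,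
        Derivation.leibniz, smul_eq_mul, Finset.sum_add_distrib]
      congr 1
      rw [← Finset.Nat.sum_antidiagonal_swap]
      rfl)

@[simp]
theorem coeff_mapDerivation (δ : Derivation ℂ R R) (f : PowerSeries R) (n : ℕ) :
    coeff n (mapDerivation δ f) = δ (coeff n f) := coeff_mk n fun n => δ (coeff n f)

theorem mapDerivation_C (δ : Derivation ℂ R R) (r : R) :
    mapDerivation δ (C r) = C (δ r) := by
  ext n
  rw [coeff_mapDerivation, coeff_C, coeff_C]
  split_ifs <;> simp

theorem mapDerivation_X (δ : Derivation ℂ R R) : mapDerivation δ X = 0 := by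
  ext n
  rw [coeff_mapDerivation, coeff_X]
  split_ifs <;> simp

/-- The operator `η⁻¹ ∂` on formal expressions `exp (η φ) f`, where `X = η⁻¹` and `σ = ∂ φ`. -/
noncomputable def twist (δ : Derivation ℂ R R) (σ : R) (f : PowerSeries R) : PowerSeries R :=
  C σ * f + X * mapDerivation δ f

theorem twist_mul (δ : Derivation ℂ R R) (σ : R) (f g : PowerSeries R) :
    twist δ σ (f * g) = f * twist δ σ g + X * mapDerivation δ f * g := by
  simp only [twist, Derivation.leibniz, smul_eq_mul]
  ring

theorem twist_C_mul (δ : Derivation ℂ R R) (σ r : R) (f : PowerSeries R) :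
    twist δ σ (C r * f) = C r * twist δ σ f + X * C (δ r) * f := by
  rw [twist_mul, mapDerivation_C]

theorem twist_add (δ : Derivation ℂ R R) (σ : R) (f g : PowerSeries R) :
    twist δ σ (f + g) = twist δ σ f + twist δ σ g := by
  simp only [twist, map_add]
  ring

end PowerSeries

/-! ## Formal Gaussian integrals -/

namespace Pearcey

/-- The normalized moments `∫ τ^{2m} exp (τ²) dτ` of the formal Gaussian measure. -/
noncomputable def gaussMoment : ℕ → ℂ
  | 0 => 1
  | m + 1 => -((m : ℂ) + 1 / 2) * gaussMoment m

/-- The pairs `(j, k)` with `j + 2 k + i = 2 n`. -/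
def momentIndex (i n : ℕ) : Finset (ℕ × ℕ) :=
  ((Finset.range (2 * n + 1)) ×ˢ (Finset.range (2 * n + 1))).filter
    fun a => a.1 + 2 * a.2 + i = 2 * n

theorem mem_momentIndex {i n : ℕ} {a : ℕ × ℕ} :
    a ∈ momentIndex i n ↔ a.1 + 2 * a.2 + i = 2 * n := by
  simp only [momentIndex, Finset.mem_filter, Finset.mem_product, Finset.mem_range]
  omega

theorem momentIndex_add_two (i n : ℕ) : momentIndex (i + 2) (n + 1) = momentIndex i n := by
  ext a
  simp only [mem_momentIndex]
  omega

theorem momentIndex_succ_zero (i : ℕ) : momentIndex (i + 1) 0 = ∅ := by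
  ext a
  simp [mem_momentIndex]

/-- Shifts j by one. It is applied to summands carrying a factor j, which vanish at j = 0 and in
which j cancels against 1/j!. -/
theorem sum_momentIndex_fst {M : Type*} [AddCommMonoid M] (i n : ℕ) (f : ℕ × ℕ → M)
    (hf : ∀ k, f (0, k) = 0) :
    ∑ a ∈ momentIndex (i + 1) n, f (a.1 + 1, a.2) = ∑ a ∈ momentIndex i n, f a := by
  refine Finset.sum_of_injOn (fun a => (a.1 + 1, a.2)) ?_ ?_ ?_ fun _ _ => rfl
  · rintro ⟨a, b⟩ - ⟨c, d⟩ - h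
    simpa using h
  · rintro ⟨a, b⟩ h
    simp only [Finset.mem_coe, mem_momentIndex] at h ⊢
    omega
  · rintro ⟨a, b⟩ h h'
    rcases a with _ | a
    · exact hf b
    · refine absurd ⟨(a, b), ?_, rfl⟩ h'
      simp only [Finset.mem_coe, mem_momentIndex] at h ⊢
      omega

theorem sum_momentIndex_snd {M : Type*} [AddCommMonoid M] (i n : ℕ) (f : ℕ × ℕ → M)
    (hf : ∀ j, f (j, 0) = 0) :
    ∑ a ∈ momentIndex (i + 2) n, f (a.1, a.2 + 1) = ∑ a ∈ momentIndex i n, f a := by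
  refine Finset.sum_of_injOn (fun a => (a.1, a.2 + 1)) ?_ ?_ ?_ fun _ _ => rfl
  · rintro ⟨a, b⟩ - ⟨c, d⟩ - h
    simpa using h
  · rintro ⟨a, b⟩ h
    simp only [Finset.mem_coe, mem_momentIndex] at h ⊢
    omega
  · rintro ⟨a, b⟩ h h'
    rcases b with _ | b
    · exact hf a
    · refine absurd ⟨(a, b), ?_, rfl⟩ h'
      simp only [Finset.mem_coe, mem_momentIndex] at h ⊢
      omega

section Moments

variable {R : Type*} [CommRing R] [Algebra ℂ R] (s w v h : R)

/-- The contribution of `(j, k)` to the coefficient of `X ^ n` in the formal Gaussian integrals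
of `exp (η (w τ² + 4 s τ³ + τ⁴))`, where `v = w⁻¹` and `X = η⁻¹`. -/
noncomputable def momentTerm (n : ℕ) (a : ℕ × ℕ) : R :=
  algebraMap ℂ R (gaussMoment (n + a.1 + a.2)) * algebraMap ℂ R (a.1.factorial : ℂ)⁻¹ *
    algebraMap ℂ R (a.2.factorial : ℂ)⁻¹ * (4 * s) ^ a.1 * v ^ (n + a.1 + a.2)

/-- The formal Gaussian integral of `τ^i exp (η (w τ² + 4 s τ³ + τ⁴))`, as a power series in
`X = η⁻¹`, up to a factor `(π / -η)^{1/2}`; here `v = w⁻¹` and `h = w^{-1/2}`. -/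
noncomputable def moment (i : ℕ) : PowerSeries R :=
  PowerSeries.mk fun n => h * ∑ a ∈ momentIndex i n, momentTerm s v n a

theorem coeff_moment (i n : ℕ) : PowerSeries.coeff n (moment s v h i) =
    h * ∑ a ∈ momentIndex i n, momentTerm s v n a := PowerSeries.coeff_mk _ _

theorem coeff_zero_moment_succ (i : ℕ) : PowerSeries.coeff 0 (moment s v h (i + 1)) = 0 := by
  rw [coeff_moment, momentIndex_succ_zero]
  simp

theorem coeff_zero_moment_zero : PowerSeries.coeff 0 (moment s v h 0) = h := by
  have : momentIndex 0 0 = {(0, 0)} := by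
    ext ⟨a, b⟩
    simp [mem_momentIndex]
  rw [coeff_moment, this]
  simp [momentTerm, gaussMoment]

theorem algebraMap_inv_factorial (j : ℕ) : ((j : R) + 1) *
    algebraMap ℂ R ((j + 1).factorial : ℂ)⁻¹ = algebraMap ℂ R (j.factorial : ℂ)⁻¹ := by
  have h1 : ((j : R) + 1) = algebraMap ℂ R ((j : ℂ) + 1) := by simp
  rw [h1, ← map_mul, Nat.factorial_succ]
  congr 1
  have : (j : ℂ) + 1 ≠ 0 := Nat.cast_add_one_ne_zero j
  push_cast
  field_simp

theorem algebraMap_gaussMoment_succ (m : ℕ) : algebraMap ℂ R (gaussMoment (m + 1)) =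
    -((m : R) + algebraMap ℂ R (1 / 2)) * algebraMap ℂ R (gaussMoment m) := by
  rw [gaussMoment]
  simp

/-- This identity and the next two are the ladder relations behind every moment identity. The
factors j and k count the cubic and quartic terms taken from the exponential, and removing one of
them raises n. In the third, one Gaussian integration by parts raises n at the price of -(n + j + k
+ 1/2) v. -/
theorem momentTerm_fst (n j k : ℕ) :
    ((j : R) + 1) * momentTerm s v n (j + 1, k) = 4 * s * momentTerm s v (n + 1) (j, k) := by
  simp only [momentTerm]
  rw [← algebraMap_inv_factorial j, show n + (j + 1) + k = n + 1 + j + k by ring]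
  ring

theorem momentTerm_snd (n j k : ℕ) :
    ((k : R) + 1) * momentTerm s v n (j, k + 1) = momentTerm s v (n + 1) (j, k) := by
  simp only [momentTerm]
  rw [← algebraMap_inv_factorial k, show n + j + (k + 1) = n + 1 + j + k by ring]
  ring

theorem momentTerm_succ (n j k : ℕ) : momentTerm s v (n + 1) (j, k) =
    -(((n + j + k : ℕ) : R) + algebraMap ℂ R (1 / 2)) * (v * momentTerm s v n (j, k)) := by
  simp only [momentTerm]
  rw [show n + 1 + j + k = n + j + k + 1 by ring, algebraMap_gaussMoment_succ]
  ring

/-- The logarithmic derivative of h v^m is -(m + 1/2) b v, which is exactly the factor of the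
Gaussian recursion. Differentiating in w therefore raises n by one. -/
theorem derivation_momentTerm (δ : Derivation ℂ R R) {a b : R} (hs : δ s = a)
    (hv : δ v = -b * v ^ 2) (hh : δ h = -algebraMap ℂ R (1 / 2) * b * v * h) (n j k : ℕ) :
    δ (h * momentTerm s v n (j, k)) = 4 * a * (h * ((j : R) *
      (algebraMap ℂ R (gaussMoment (n + j + k)) * algebraMap ℂ R (j.factorial : ℂ)⁻¹ *
        algebraMap ℂ R (k.factorial : ℂ)⁻¹ * (4 * s) ^ (j - 1) * v ^ (n + j + k)))) +
      b * (h * momentTerm s v (n + 1) (j, k)) := by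
  rw [momentTerm_succ]
  have h4 : δ (4 * s) = 4 * a := by
    have : δ (4 : R) = 0 := δ.map_natCast 4
    rw [Derivation.leibniz, this, hs]
    simp
  have hv' : ∀ m : ℕ, δ (v ^ m) = -(m : R) * b * v * v ^ m := by
    intro m
    rw [Derivation.leibniz_pow, hv]
    rcases m with _ | m
    · simp
    · simp only [Nat.add_sub_cancel, smul_eq_mul, nsmul_eq_mul]
      ring
  simp only [momentTerm, Derivation.leibniz, Derivation.leibniz_pow δ (4 * s), smul_eq_mul,
    nsmul_eq_mul, hv', hh, h4, Derivation.map_algebraMap]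
  ring

/-- Differentiation under the integral sign: the exponent wτ² + 4sτ³ + τ⁴ has derivative bτ² + 4aτ³.
-/
theorem X_mul_mapDerivation_moment (δ : Derivation ℂ R R) {a b : R} (hs : δ s = a)
    (hv : δ v = -b * v ^ 2) (hh : δ h = -algebraMap ℂ R (1 / 2) * b * v * h) (i : ℕ) :
    PowerSeries.X * PowerSeries.mapDerivation δ (moment s v h i) =
      PowerSeries.C (4 * a) * moment s v h (i + 3) + PowerSeries.C b * moment s v h (i + 2) := by
  ext n
  rcases n with _ | n
  · rw [map_add, PowerSeries.coeff_C_mul, PowerSeries.coeff_C_mul, coeff_zero_moment_succ,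
      coeff_zero_moment_succ, PowerSeries.coeff_zero_X_mul]
    simp
  · rw [map_add, PowerSeries.coeff_C_mul, PowerSeries.coeff_C_mul, PowerSeries.coeff_succ_X_mul,
      PowerSeries.coeff_mapDerivation, coeff_moment, coeff_moment, coeff_moment,
      Finset.mul_sum, map_sum, Finset.sum_congr rfl fun x _ =>
        derivation_momentTerm s v h δ hs hv hh n x.1 x.2,
      Finset.sum_add_distrib, momentIndex_add_two, ← Finset.mul_sum, ← Finset.mul_sum,
      ← Finset.mul_sum, ← Finset.mul_sum, ← sum_momentIndex_fst, momentIndex_add_two]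
    · congr 3
      refine Finset.sum_congr rfl fun x _ => ?_
      rw [momentTerm, ← algebraMap_inv_factorial x.1,
        show n + (x.1 + 1) + x.2 = n + 1 + x.1 + x.2 by ring]
      simp only [Nat.add_sub_cancel, Nat.cast_add, Nat.cast_one]
      ring
    · simp

variable {w v}

/-- The integral of d(τ^i exp(η(wτ² + 4sτ³ + τ⁴))) vanishes. By the ladder relations the three terms
on the left carry the weights -2(n + j + k) - 1, 3j and 4k, and the constraint j + 2k + i + 1 = 2(n
+ 1) reduces their sum to -i. -/
theorem coeff_moment_byParts (hwv : w * v = 1) (i n : ℕ) :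
    2 * w * PowerSeries.coeff (n + 1) (moment s v h (i + 1)) +
      12 * s * PowerSeries.coeff (n + 1) (moment s v h (i + 2)) +
      4 * PowerSeries.coeff (n + 1) (moment s v h (i + 3)) =
    -(i : R) * (h * ∑ a ∈ momentIndex (i + 1) (n + 1), momentTerm s v n a) := by
  have e2 := sum_momentIndex_fst (i + 1) (n + 1) (fun a => (a.1 : R) * momentTerm s v n a)
    (by simp)
  have e3 := sum_momentIndex_snd (i + 1) (n + 1) (fun a => (a.2 : R) * momentTerm s v n a)
    (by simp)
  simp only [Nat.cast_add, Nat.cast_one, momentTerm_fst, momentTerm_snd, Prod.mk.eta] at e2 e3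
  rw [← Finset.mul_sum] at e2
  have e1 : w * ∑ a ∈ momentIndex (i + 1) (n + 1), momentTerm s v (n + 1) a =
      ∑ a ∈ momentIndex (i + 1) (n + 1),
        -(((n + a.1 + a.2 : ℕ) : R) + algebraMap ℂ R (1 / 2)) * momentTerm s v n a := by
    rw [Finset.mul_sum]
    refine Finset.sum_congr rfl fun a _ => ?_
    rw [momentTerm_succ]
    linear_combination (-(((n + a.1 + a.2 : ℕ) : R) + algebraMap ℂ R (1 / 2)) *
      momentTerm s v n a) * hwv
  have hc : 2 * algebraMap ℂ R (1 / 2) = 1 := by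
    rw [← map_ofNat (algebraMap ℂ R) 2, ← map_mul]
    norm_num
  rw [coeff_moment, coeff_moment, coeff_moment]
  have e4 : 2 * (∑ a ∈ momentIndex (i + 1) (n + 1),
        -(((n + a.1 + a.2 : ℕ) : R) + algebraMap ℂ R (1 / 2)) * momentTerm s v n a) +
      3 * (∑ a ∈ momentIndex (i + 1) (n + 1), (a.1 : R) * momentTerm s v n a) +
      4 * (∑ a ∈ momentIndex (i + 1) (n + 1), (a.2 : R) * momentTerm s v n a) =
      -(i : R) * ∑ a ∈ momentIndex (i + 1) (n + 1), momentTerm s v n a := by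
    rw [Finset.mul_sum, Finset.mul_sum, Finset.mul_sum, Finset.mul_sum, ← Finset.sum_add_distrib,
      ← Finset.sum_add_distrib]
    refine Finset.sum_congr rfl fun a ha => ?_
    have ha' := congrArg (Nat.cast (R := R)) (mem_momentIndex.1 ha)
    push_cast at ha' ⊢
    linear_combination (momentTerm s v n a) * ha' - (momentTerm s v n a) * hc
  linear_combination h * e4 + 2 * h * e1 + 3 * h * e2 + 4 * h * e3

theorem moment_byParts_zero (hwv : w * v = 1) :
    2 * PowerSeries.C w * moment s v h 1 + 12 * PowerSeries.C s * moment s v h 2 +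
      4 * moment s v h 3 = 0 := by
  ext n
  have e : 2 * PowerSeries.C w * moment s v h 1 + 12 * PowerSeries.C s * moment s v h 2 +
      4 * moment s v h 3 = PowerSeries.C (2 * w) * moment s v h 1 +
      PowerSeries.C (12 * s) * moment s v h 2 + PowerSeries.C 4 * moment s v h 3 := by
    rw [map_mul, map_mul, map_ofNat, map_ofNat, map_ofNat]
  rw [e, map_add, map_add, PowerSeries.coeff_C_mul, PowerSeries.coeff_C_mul,
    PowerSeries.coeff_C_mul]
  rcases n with _ | n
  · simp only [coeff_zero_moment_succ]
    simp
  · rw [coeff_moment_byParts s h hwv 0 n]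
    simp

theorem moment_byParts_succ (hwv : w * v = 1) (i : ℕ) :
    ((i : PowerSeries R) + 1) * PowerSeries.X * moment s v h i +
      2 * PowerSeries.C w * moment s v h (i + 2) +
      12 * PowerSeries.C s * moment s v h (i + 3) + 4 * moment s v h (i + 4) = 0 := by
  ext n
  have e : ((i : PowerSeries R) + 1) * PowerSeries.X * moment s v h i +
      2 * PowerSeries.C w * moment s v h (i + 2) +
      12 * PowerSeries.C s * moment s v h (i + 3) + 4 * moment s v h (i + 4) =
      PowerSeries.C ((i + 1 : ℕ) : R) * (PowerSeries.X * moment s v h i) +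
        (PowerSeries.C (2 * w) * moment s v h (i + 2) +
          PowerSeries.C (12 * s) * moment s v h (i + 3) +
          PowerSeries.C 4 * moment s v h (i + 4)) := by
    rw [map_natCast, map_mul, map_mul, map_ofNat, map_ofNat, map_ofNat]
    push_cast
    ring
  rw [e, map_add, map_add, map_add, PowerSeries.coeff_C_mul, PowerSeries.coeff_C_mul,
    PowerSeries.coeff_C_mul, PowerSeries.coeff_C_mul]
  rcases n with _ | n
  · simp only [coeff_zero_moment_succ, PowerSeries.coeff_zero_X_mul]
    simp
  · rw [coeff_moment_byParts s h hwv (i + 1) n, PowerSeries.coeff_succ_X_mul, coeff_moment,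
      momentIndex_add_two]
    push_cast
    rw [map_zero]
    ring

/-- Euler's identity for the formal Gaussian integral. -/
theorem coeff_moment_euler (hwv : w * v = 1) (n : ℕ) :
    ((n : R) + algebraMap ℂ R (1 / 2)) * PowerSeries.coeff n (moment s v h 0) =
      -(w * PowerSeries.coeff (n + 1) (moment s v h 2) +
        4 * s * PowerSeries.coeff (n + 1) (moment s v h 3) +
        PowerSeries.coeff (n + 1) (moment s v h 4)) := by
  have e2 := sum_momentIndex_fst 2 (n + 1) (fun a => (a.1 : R) * momentTerm s v n a)
    (by simp)
  have e3 := sum_momentIndex_snd 2 (n + 1) (fun a => (a.2 : R) * momentTerm s v n a)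
    (by simp)
  simp only [Nat.cast_add, Nat.cast_one, momentTerm_fst, momentTerm_snd, Prod.mk.eta] at e2 e3
  rw [← Finset.mul_sum] at e2
  have e1 : w * ∑ a ∈ momentIndex 2 (n + 1), momentTerm s v (n + 1) a =
      ∑ a ∈ momentIndex 2 (n + 1),
        -(((n + a.1 + a.2 : ℕ) : R) + algebraMap ℂ R (1 / 2)) * momentTerm s v n a := by
    rw [Finset.mul_sum]
    refine Finset.sum_congr rfl fun a _ => ?_
    rw [momentTerm_succ]
    linear_combination (-(((n + a.1 + a.2 : ℕ) : R) + algebraMap ℂ R (1 / 2)) *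
      momentTerm s v n a) * hwv
  rw [coeff_moment, coeff_moment, coeff_moment, coeff_moment,
    show momentIndex 0 n = momentIndex 2 (n + 1) from (momentIndex_add_two 0 n).symm]
  have e4 : (∑ a ∈ momentIndex 2 (n + 1),
        -(((n + a.1 + a.2 : ℕ) : R) + algebraMap ℂ R (1 / 2)) * momentTerm s v n a) +
      (∑ a ∈ momentIndex 2 (n + 1), (a.1 : R) * momentTerm s v n a) +
      (∑ a ∈ momentIndex 2 (n + 1), (a.2 : R) * momentTerm s v n a) =
      -((n : R) + algebraMap ℂ R (1 / 2)) *
        ∑ a ∈ momentIndex 2 (n + 1), momentTerm s v n a := by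
    rw [Finset.mul_sum, ← Finset.sum_add_distrib, ← Finset.sum_add_distrib]
    refine Finset.sum_congr rfl fun a ha => ?_
    push_cast
    ring
  linear_combination h * e4 + h * e1 + h * e2 + h * e3

end Moments

end Pearcey

/-! ### The formal Gaussian integral satisfies the Pearcey equations -/

namespace Pearcey

section Equations

variable {R : Type*} [CommRing R] [Algebra ℂ R]

/-- The data of a root `s` of the cubic `4 s³ + 2 x₂ s + x₁ = 0` with `w = 6 s² + x₂` invertible
and a square root `h` of `v = w⁻¹`, in a ring with derivations `∂/∂x₁` and `∂/∂x₂`. -/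
structure CubicRoot (δ₁ δ₂ : Derivation ℂ R R) (x₁ x₂ s w v h : R) : Prop where
  d₁x₁ : δ₁ x₁ = 1
  d₁x₂ : δ₁ x₂ = 0
  d₂x₁ : δ₂ x₁ = 0
  d₂x₂ : δ₂ x₂ = 1
  cubic : 4 * s ^ 3 + 2 * x₂ * s + x₁ = 0
  hw : w = 6 * s ^ 2 + x₂
  hwv : w * v = 1
  hh : h ^ 2 * w = 1

theorem two_mul_algebraMap_half : 2 * algebraMap ℂ R (1 / 2) = 1 := by
  rw [← map_ofNat (algebraMap ℂ R) 2, ← map_mul]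
  norm_num

theorem two_mul_C_half : 2 * (PowerSeries.C (algebraMap ℂ R (1 / 2))) = 1 := by
  rw [← map_ofNat PowerSeries.C 2, ← map_mul, two_mul_algebraMap_half, map_one]

namespace CubicRoot

theorem derivation_ofNat (δ : Derivation ℂ R R) (k : ℕ) [k.AtLeastTwo] :
    δ (ofNat(k) : R) = 0 := δ.map_natCast k

variable {δ₁ δ₂ : Derivation ℂ R R} {x₁ x₂ s w v h : R} (H : CubicRoot δ₁ δ₂ x₁ x₂ s w v h)

include H

/-- Implicit differentiation of the cubic, whose derivative in s is 12s² + 2x₂ = 2w. -/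
theorem derivation_s (δ : Derivation ℂ R R) :
    δ s = -algebraMap ℂ R (1 / 2) * v * (δ x₁ + 2 * s * δ x₂) := by
  have h1 := congrArg δ H.cubic
  simp only [map_add, Derivation.leibniz, Derivation.leibniz_pow, derivation_ofNat, map_zero,
    smul_eq_mul, nsmul_eq_mul, mul_zero, Nat.reduceSub, Nat.cast_ofNat] at h1
  have hc := two_mul_algebraMap_half (R := R)
  have hwv := H.hwv
  have hw := H.hw
  subst hw
  linear_combination (algebraMap ℂ R (1 / 2) * v) * h1 - δ s * (6 * s ^ 2 + x₂) * v * hc -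
    (δ s) * hwv

theorem derivation_w (δ : Derivation ℂ R R) : δ w = 12 * s * δ s + δ x₂ := by
  rw [H.hw]
  simp only [map_add, Derivation.leibniz, Derivation.leibniz_pow, derivation_ofNat,
    smul_eq_mul, nsmul_eq_mul, mul_zero, Nat.reduceSub, Nat.cast_ofNat]
  ring

theorem derivation_v (δ : Derivation ℂ R R) : δ v = -δ w * v ^ 2 := by
  have h1 := congrArg δ H.hwv
  simp only [Derivation.leibniz, smul_eq_mul, Derivation.map_one_eq_zero] at h1
  linear_combination v * h1 - δ v * H.hwv

theorem derivation_h (δ : Derivation ℂ R R) :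
    δ h = -algebraMap ℂ R (1 / 2) * δ w * v * h := by
  have h1 := congrArg δ H.hh
  simp only [Derivation.leibniz, Derivation.leibniz_pow, smul_eq_mul, nsmul_eq_mul,
    Derivation.map_one_eq_zero, Nat.cast_ofNat, Nat.reduceSub, pow_one] at h1
  have hv : h ^ 2 = v := by linear_combination (-h ^ 2) * H.hwv + v * H.hh
  have hc := two_mul_algebraMap_half (R := R)
  rw [← hv]
  linear_combination algebraMap ℂ R (1 / 2) * h * h1 - δ h * h ^ 2 * w * hc - δ h * H.hh

theorem X_mul_mapDerivation_moment (δ : Derivation ℂ R R) (i : ℕ) :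
    PowerSeries.X * PowerSeries.mapDerivation δ (moment s v h i) =
      PowerSeries.C (4 * δ s) * moment s v h (i + 3) +
        PowerSeries.C (δ w) * moment s v h (i + 2) :=
  Pearcey.X_mul_mapDerivation_moment s v h δ rfl (H.derivation_v δ) (H.derivation_h δ) i

theorem d₁s : δ₁ s = -algebraMap ℂ R (1 / 2) * v := by
  rw [H.derivation_s, H.d₁x₁, H.d₁x₂]; ring

theorem d₂s : δ₂ s = -(s * v) := by
  rw [H.derivation_s, H.d₂x₁, H.d₂x₂]
  linear_combination (-s * v) * two_mul_algebraMap_half (R := R)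

theorem d₁w : δ₁ w = -(6 * s * v) := by
  rw [H.derivation_w, H.d₁s, H.d₁x₂]
  linear_combination (-6 * s * v) * two_mul_algebraMap_half (R := R)

theorem d₂w : δ₂ w = 1 - 12 * s ^ 2 * v := by
  rw [H.derivation_w, H.d₂s, H.d₂x₂]
  ring

theorem C_hwv : PowerSeries.C w * PowerSeries.C v = 1 := by
  rw [← map_mul, H.hwv, map_one]

/-- Replacing x₂ and x₁ by polynomials in s and w makes the Pearcey equations direct consequences of
the integration-by-parts relations, which involve only s and w. -/
theorem C_x₂ : PowerSeries.C x₂ = PowerSeries.C w - 6 * PowerSeries.C s ^ 2 := by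
  rw [← map_pow, ← map_ofNat PowerSeries.C 6, ← map_mul, ← map_sub, H.hw]
  congr 1
  ring

theorem C_x₁ : PowerSeries.C x₁ =
    8 * PowerSeries.C s ^ 3 - 2 * PowerSeries.C w * PowerSeries.C s := by
  rw [← map_pow, ← map_ofNat PowerSeries.C 8, ← map_ofNat PowerSeries.C 2, ← map_mul,
    ← map_mul, ← map_mul, ← map_sub]
  congr 1
  linear_combination H.cubic + 2 * s * H.hw

/-- ∂F/∂x₁ = t = s + τ, so η⁻¹∂₁ inserts s + τ. In terms of the exponent centred at s this takes one
integration by parts. -/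
theorem twist₁_zero : PowerSeries.twist δ₁ s (moment s v h 0) =
    PowerSeries.C s * moment s v h 0 + moment s v h 1 := by
  rw [PowerSeries.twist, H.X_mul_mapDerivation_moment, H.d₁s, H.d₁w]
  have e := moment_byParts_zero s h H.hwv
  have e1 := H.C_hwv
  have e2 := two_mul_C_half (R := R)
  simp only [map_mul, map_neg, map_ofNat]
  linear_combination (-PowerSeries.C (algebraMap ℂ R (1 / 2)) * PowerSeries.C v) * e +
    (PowerSeries.C v * PowerSeries.C w * moment s v h 1 +
      6 * PowerSeries.C s * PowerSeries.C v * moment s v h 2) * e2 + moment s v h 1 * e1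

/-- Besides the insertion of s + τ there is a term from the factor τ^{i+1} = (t - s)^{i+1}, because
s depends on x₁ with ∂₁s = -v/2. -/
theorem twist₁_succ (i : ℕ) : PowerSeries.twist δ₁ s (moment s v h (i + 1)) =
    PowerSeries.C s * moment s v h (i + 1) + moment s v h (i + 2) +
      PowerSeries.C (algebraMap ℂ R (1 / 2)) * PowerSeries.C v * ((i : PowerSeries R) + 1) *
        PowerSeries.X * moment s v h i := by
  rw [PowerSeries.twist, H.X_mul_mapDerivation_moment, H.d₁s, H.d₁w]
  have e := moment_byParts_succ s h H.hwv i
  have e1 := H.C_hwv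
  have e2 := two_mul_C_half (R := R)
  simp only [map_mul, map_neg, map_ofNat]
  linear_combination (-PowerSeries.C (algebraMap ℂ R (1 / 2)) * PowerSeries.C v) * e +
    (PowerSeries.C v * PowerSeries.C w * moment s v h (i + 2) +
      6 * PowerSeries.C s * PowerSeries.C v * moment s v h (i + 3)) * e2 +
    moment s v h (i + 2) * e1

/-- Here ∂F/∂x₂ = t² = s² + 2sτ + τ². In the next lemma the extra term comes from ∂₂s = -sv. -/
theorem twist₂_zero : PowerSeries.twist δ₂ (s ^ 2) (moment s v h 0) =
    PowerSeries.C s ^ 2 * moment s v h 0 + 2 * PowerSeries.C s * moment s v h 1 +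
      moment s v h 2 := by
  rw [PowerSeries.twist, H.X_mul_mapDerivation_moment, H.d₂s, H.d₂w]
  have e := moment_byParts_zero s h H.hwv
  have e1 := H.C_hwv
  simp only [map_mul, map_neg, map_ofNat, map_sub, map_one, map_pow]
  linear_combination (-PowerSeries.C s * PowerSeries.C v) * e +
    (2 * PowerSeries.C s * moment s v h 1) * e1

theorem twist₂_succ (i : ℕ) : PowerSeries.twist δ₂ (s ^ 2) (moment s v h (i + 1)) =
    PowerSeries.C s ^ 2 * moment s v h (i + 1) + 2 * PowerSeries.C s * moment s v h (i + 2) +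
      moment s v h (i + 3) + PowerSeries.C s * PowerSeries.C v * ((i : PowerSeries R) + 1) *
        PowerSeries.X * moment s v h i := by
  rw [PowerSeries.twist, H.X_mul_mapDerivation_moment, H.d₂s, H.d₂w]
  have e := moment_byParts_succ s h H.hwv i
  have e1 := H.C_hwv
  simp only [map_mul, map_neg, map_ofNat, map_sub, map_one, map_pow]
  linear_combination (-PowerSeries.C s * PowerSeries.C v) * e +
    (2 * PowerSeries.C s * moment s v h (i + 2)) * e1

/-- The formal WKB solution satisfies the third Pearcey equation. -/
theorem twist₁_twist₁ :
    PowerSeries.twist δ₁ s (PowerSeries.twist δ₁ s (moment s v h 0)) =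
      PowerSeries.twist δ₂ (s ^ 2) (moment s v h 0) := by
  rw [H.twist₂_zero, H.twist₁_zero, PowerSeries.twist_add, PowerSeries.twist_C_mul, H.twist₁_zero,
    H.twist₁_succ, H.d₁s]
  simp only [map_mul, map_neg]
  push_cast
  ring

/-- The formal WKB solution satisfies the first Pearcey equation. -/
theorem equation_d₁_d₂ :
    4 * PowerSeries.twist δ₁ s (PowerSeries.twist δ₂ (s ^ 2) (moment s v h 0)) +
      2 * PowerSeries.C x₂ * PowerSeries.twist δ₁ s (moment s v h 0) +
      PowerSeries.C x₁ * moment s v h 0 = 0 := by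
  have e := moment_byParts_zero s h H.hwv
  have e2 := two_mul_C_half (R := R)
  rw [H.twist₂_zero, PowerSeries.twist_add, PowerSeries.twist_add,
    ← map_ofNat PowerSeries.C 2, ← map_mul, ← map_pow, PowerSeries.twist_C_mul, PowerSeries.twist_C_mul, H.twist₁_zero,
    H.twist₁_succ, H.twist₁_succ, H.C_x₁, H.C_x₂, Derivation.leibniz, Derivation.leibniz_pow,
    derivation_ofNat, H.d₁s]
  simp only [map_mul, map_neg, map_ofNat, map_pow, nsmul_eq_mul, smul_eq_mul, mul_zero,
    Nat.cast_ofNat, add_zero, Nat.reduceSub, pow_one, Nat.cast_zero, zero_add, Nat.cast_one]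
  -- P₁ inserts F'(s + τ) = 2wτ + 12sτ² + 4τ³; the terms with a factor X cancel.
  linear_combination e

/-- The formal WKB solution satisfies the second Pearcey equation. -/
theorem equation_d₂_d₂ :
    4 * PowerSeries.twist δ₂ (s ^ 2) (PowerSeries.twist δ₂ (s ^ 2) (moment s v h 0)) +
      PowerSeries.C x₁ * PowerSeries.twist δ₁ s (moment s v h 0) +
      2 * PowerSeries.C x₂ * PowerSeries.twist δ₂ (s ^ 2) (moment s v h 0) +
      PowerSeries.X * moment s v h 0 = 0 := by
  have e := moment_byParts_zero s h H.hwv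
  have e' := moment_byParts_succ s h H.hwv 0
  rw [H.twist₁_zero, H.twist₂_zero, PowerSeries.twist_add, PowerSeries.twist_add,
    ← map_ofNat PowerSeries.C 2, ← map_mul, ← map_pow, PowerSeries.twist_C_mul, PowerSeries.twist_C_mul,
    H.twist₂_zero, H.twist₂_succ, H.twist₂_succ, H.C_x₁, H.C_x₂, Derivation.leibniz,
    Derivation.leibniz_pow, derivation_ofNat, H.d₂s]
  simp only [map_mul, map_neg, map_ofNat, map_pow, nsmul_eq_mul, smul_eq_mul, mul_zero,
    Nat.cast_ofNat, add_zero, Nat.reduceSub, pow_one, Nat.cast_zero, zero_add,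
    Nat.cast_one] at e' ⊢
  -- P₂ inserts tF' + η⁻¹ with t = s + τ: `e` accounts for sF', and `e'` for τF' together with the
  -- term X.
  linear_combination PowerSeries.C s * e + e'

/-- The formal WKB solution satisfies the fourth Pearcey equation. -/
theorem equation_euler (n : ℕ) :
    3 * x₁ * PowerSeries.coeff (n + 1) (PowerSeries.twist δ₁ s (moment s v h 0)) +
      2 * x₂ * PowerSeries.coeff (n + 1) (PowerSeries.twist δ₂ (s ^ 2) (moment s v h 0)) -
      (3 * x₁ * s + 2 * x₂ * s ^ 2) * PowerSeries.coeff (n + 1) (moment s v h 0) +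
      (4 * (n : R) + 1) * PowerSeries.coeff n (moment s v h 0) = 0 := by
  have e := congrArg (PowerSeries.coeff (n + 1)) (moment_byParts_zero s h H.hwv)
  have e' := congrArg (PowerSeries.coeff (n + 1)) (moment_byParts_succ s h H.hwv 0)
  have e0 := coeff_moment_euler s h H.hwv n
  have hc := two_mul_algebraMap_half (R := R)
  have hx₂ : x₂ = w - 6 * s ^ 2 := by linear_combination -H.hw
  have hx₁ : x₁ = 8 * s ^ 3 - 2 * w * s := by linear_combination H.cubic + 2 * s * H.hw
  rw [H.twist₁_zero, H.twist₂_zero, hx₁, hx₂]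
  rw [← map_ofNat PowerSeries.C 2, ← map_ofNat PowerSeries.C 12, ← map_ofNat PowerSeries.C 4] at *
  simp only [Nat.cast_zero, zero_add, one_mul, map_add, ← map_mul, ← map_pow, map_zero,
    PowerSeries.coeff_C_mul, PowerSeries.coeff_succ_X_mul] at e e' ⊢
  -- This is 3x₁t + 2x₂t² = 4F - tF': `e0` is the scaling in η that treats 4F, while `e'` and `s *
  -- e` treat tF'.
  linear_combination 4 * e0 - e' - s * e - PowerSeries.coeff n (moment s v h 0) * 2 * hc

end CubicRoot

end Equations

end Pearcey

/-! ### Coefficients of products, and exponentials, of power series -/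

namespace PowerSeries

section Truncation

variable {R : Type*} [CommRing R]

/-- A power series is the sum of its first `N` terms and of a multiple of `X ^ N`. -/
theorem eq_sum_add_X_pow_mul (f : PowerSeries R) (N : ℕ) :
    f = (∑ a : Fin N, C (coeff a f) * X ^ (a : ℕ)) + X ^ N * mk fun i => coeff (N + i) f := by
  ext n
  rw [map_add, map_sum, coeff_X_pow_mul']
  simp only [coeff_C_mul_X_pow]
  rw [Fin.sum_univ_eq_sum_range (fun a => if n = a then coeff a f else 0)]
  rw [Finset.sum_ite_eq]
  by_cases h : n < N
  · simp [h]
  · simp only [Finset.mem_range, h, if_false, not_lt.1 h, if_true, coeff_mk, zero_add]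
    rw [Nat.add_sub_cancel' (not_lt.1 h)]

/-- Separates the terms containing the top coefficient, so that a cubic equation for f becomes a
recursion with all remaining indices at most m + 1. -/
theorem coeff_pow_three (f : PowerSeries R) (m : ℕ) :
    coeff (m + 2) (f ^ 3) = 3 * coeff 0 f ^ 2 * coeff (m + 2) f +
      ∑ a : Fin (m + 2), ∑ b : Fin (m + 2), ∑ c : Fin (m + 2),
        if (a : ℕ) + b + c = m + 2 then coeff a f * coeff b f * coeff c f else 0 := by
  set P : PowerSeries R := ∑ a : Fin (m + 2), C (coeff a f) * X ^ (a : ℕ) with hP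
  set Q : PowerSeries R := mk fun i => coeff (m + 2 + i) f with hQ
  have hf : f = P + X ^ (m + 2) * Q := eq_sum_add_X_pow_mul f (m + 2)
  -- Terms with at least two factors X^(m+2) Q have order at least 2m + 4, hence do not reach degree
  -- m + 2.
  have h1 : f ^ 3 = P ^ 3 + X ^ (m + 2) * (3 * P ^ 2 * Q) +
      X ^ (m + 3) * (X ^ (m + 1) * (3 * P * Q ^ 2 + X ^ (m + 2) * Q ^ 3)) := by
    rw [hf]; ring
  have h2 : P ^ 3 = ∑ a : Fin (m + 2), ∑ b : Fin (m + 2), ∑ c : Fin (m + 2),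
      C (coeff a f * coeff b f * coeff c f) * X ^ ((a : ℕ) + b + c) := by
    rw [pow_three, hP, Finset.sum_mul_sum, Finset.sum_mul_sum]
    refine Finset.sum_congr rfl fun a _ => ?_
    rw [Finset.sum_congr rfl fun b _ => Finset.mul_sum _ _ _]
    refine Finset.sum_congr rfl fun b _ => Finset.sum_congr rfl fun c _ => ?_
    rw [map_mul, map_mul]
    ring
  have h3 : coeff (m + 2) (X ^ (m + 3) * (X ^ (m + 1) * (3 * P * Q ^ 2 + X ^ (m + 2) * Q ^ 3))) =
      0 := by
    rw [coeff_X_pow_mul', if_neg (by omega)]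
  have h4 : coeff (m + 2) (X ^ (m + 2) * (3 * P ^ 2 * Q)) =
      3 * coeff 0 f ^ 2 * coeff (m + 2) f := by
    have hP0 : constantCoeff P = coeff 0 f := by
      have := congrArg (coeff 0) hf
      rw [this, map_add, coeff_X_pow_mul', if_neg (by omega)]
      simp
    have hQ0 : constantCoeff Q = coeff (m + 2) f := by
      rw [hQ, ← coeff_zero_eq_constantCoeff_apply, coeff_mk, add_zero]
    rw [coeff_X_pow_mul', if_pos le_rfl, Nat.sub_self, coeff_zero_eq_constantCoeff_apply,
      map_mul, map_mul, map_pow, hP0, hQ0, map_ofNat]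
  rw [h1, map_add, map_add, h3, h4, h2]
  simp only [map_sum, coeff_C_mul_X_pow, @eq_comm ℕ (m + 2)]
  ring

theorem coeff_mul_eq_sum_fin (f g : PowerSeries R) (m : ℕ) :
    coeff (m + 1) (f * g) = ∑ a : Fin (m + 2), ∑ b : Fin (m + 2),
      if (a : ℕ) + b = m + 1 then coeff a f * coeff b g else 0 := by
  conv_lhs => rw [eq_sum_add_X_pow_mul f (m + 2), eq_sum_add_X_pow_mul g (m + 2)]
  rw [add_mul, mul_add, map_add, map_add, mul_left_comm, mul_assoc (X ^ (m + 2)),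
    coeff_X_pow_mul', coeff_X_pow_mul', if_neg (by omega), if_neg (by omega), add_zero, add_zero,
    Finset.sum_mul_sum, map_sum]
  refine Finset.sum_congr rfl fun a _ => ?_
  rw [map_sum]
  refine Finset.sum_congr rfl fun b _ => ?_
  rw [show ∀ r s : R, C r * X ^ (a : ℕ) * (C s * X ^ (b : ℕ)) = C (r * s) * X ^ ((a : ℕ) + b) by
    intro r s; rw [map_mul]; ring, coeff_C_mul_X_pow]
  simp only [@eq_comm ℕ (m + 1)]

end Truncation

section Exponential

variable {E : PowerSeries ℂ} (hE : coeff 0 E = 0)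

include hE

theorem coeff_pow_eq_zero {m n : ℕ} (h : n < m) : coeff n (E ^ m) = 0 := by
  have : X ∣ E := X_dvd_iff.2 (by rwa [← coeff_zero_eq_constantCoeff_apply])
  exact X_pow_dvd_iff.1 (pow_dvd_pow_of_dvd this m) n h

theorem sum_coeff_pow_eq {n N : ℕ} (h : n < N) :
    ∑ m ∈ Finset.range N, (m.factorial : ℂ)⁻¹ * coeff n (E ^ m) =
      ∑ m ∈ Finset.range (n + 1), (m.factorial : ℂ)⁻¹ * coeff n (E ^ m) := by
  symm
  refine Finset.sum_subset (Finset.range_subset_range.2 h) fun m _ hm => ?_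
  rw [Finset.mem_range, not_lt] at hm
  rw [coeff_pow_eq_zero hE hm, mul_zero]

/-- The logarithmic derivative of the exponential of a power series, coefficientwise. -/
theorem natCast_mul_sum_coeff_pow (n : ℕ) :
    (n : ℂ) * ∑ m ∈ Finset.range (n + 1), (m.factorial : ℂ)⁻¹ * coeff n (E ^ m) =
      ∑ a ∈ Finset.HasAntidiagonal.antidiagonal n, (a.1 : ℂ) * coeff a.1 E *
        ∑ m ∈ Finset.range (a.2 + 1), (m.factorial : ℂ)⁻¹ * coeff a.2 (E ^ m) := by
  have hθ : ∀ (f : PowerSeries ℂ) (k : ℕ), coeff k (X * derivative ℂ f) = (k : ℂ) * coeff k f := by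
    intro f k
    rcases k with _ | k
    · simp
    · rw [coeff_succ_X_mul, coeff_derivative]
      push_cast
      ring
  have key : ∀ m : ℕ, C ((m + 1).factorial : ℂ)⁻¹ * (X * derivative ℂ (E ^ (m + 1))) =
      X * derivative ℂ E * (C (m.factorial : ℂ)⁻¹ * E ^ m) := by
    intro m
    have h1 : C ((m + 1).factorial : ℂ)⁻¹ * ((m + 1 : ℕ) : PowerSeries ℂ) =
        C (m.factorial : ℂ)⁻¹ := by
      rw [← map_natCast C, ← map_mul, Nat.factorial_succ]
      congr 1
      have : (m : ℂ) + 1 ≠ 0 := Nat.cast_add_one_ne_zero m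
      push_cast
      field_simp
    rw [Derivation.leibniz_pow, ← h1]
    simp only [Nat.add_sub_cancel, nsmul_eq_mul, smul_eq_mul]
    ring
  have h2 := congrArg (coeff n) (Finset.sum_congr rfl fun m (_ : m ∈ Finset.range (n + 1)) => key m)
  rw [← Finset.mul_sum, coeff_mul, map_sum] at h2
  simp only [coeff_C_mul, map_sum, hθ] at h2
  rw [← sum_coeff_pow_eq hE (Nat.lt_succ_self (n + 1) |>.trans' (Nat.lt_succ_self n)),
    Finset.sum_range_succ', mul_add, Finset.mul_sum]
  have h3 : (n : ℂ) * ((Nat.factorial 0 : ℂ)⁻¹ * coeff n (E ^ 0)) = 0 := by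
    rcases n with _ | n <;> simp [coeff_one]
  rw [h3, add_zero]
  refine Eq.trans (Finset.sum_congr rfl fun m _ => by ring) (h2.trans ?_)
  refine Finset.sum_congr rfl fun a ha => ?_
  rw [sum_coeff_pow_eq hE (by have := Finset.HasAntidiagonal.mem_antidiagonal.1 ha; omega : a.2 < n + 1)]

/-- The equation θg = (θE) g with θ = X d/dX determines g from g 0, because n ≠ 0 is invertible and
the summand with index 0 drops out. -/
theorem coeff_eq_of_logDerivative {g : ℕ → ℂ} (hg : ∀ n : ℕ, (n : ℂ) * g n =
      ∑ a ∈ Finset.HasAntidiagonal.antidiagonal n, (a.1 : ℂ) * coeff a.1 E * g a.2) (n : ℕ) :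
    g n = g 0 * ∑ m ∈ Finset.range (n + 1), (m.factorial : ℂ)⁻¹ * coeff n (E ^ m) := by
  induction n using Nat.strong_induction_on with
  | _ n ih =>
    rcases n with _ | n
    · simp
    · have hn : ((n + 1 : ℕ) : ℂ) ≠ 0 := Nat.cast_ne_zero.2 (Nat.succ_ne_zero n)
      apply mul_left_cancel₀ hn
      rw [hg, mul_left_comm, natCast_mul_sum_coeff_pow hE, Finset.mul_sum]
      refine Finset.sum_congr rfl fun a ha => ?_
      rcases Nat.eq_zero_or_pos a.1 with h | h
      · simp [h]
      · rw [ih a.2 (by have := Finset.HasAntidiagonal.mem_antidiagonal.1 ha; omega)]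
        ring

end Exponential

end PowerSeries

/-! ### The logarithmic derivative and the recursion for the S_k -/

namespace Pearcey

namespace CubicRoot

variable {R : Type*} [CommRing R] [Algebra ℂ R]
  {δ₁ δ₂ : Derivation ℂ R R} {x₁ x₂ s w v h : R} (H : CubicRoot δ₁ δ₂ x₁ x₂ s w v h)

include H

/-- The logarithmic derivative of the formal WKB solution. -/
theorem exists_logDerivative : ∃ S : PowerSeries R,
    PowerSeries.twist δ₁ s (moment s v h 0) = S * moment s v h 0 ∧
    PowerSeries.coeff 0 S = s ∧
    (∀ f : PowerSeries R, f * moment s v h 0 = 0 → f = 0) := by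
  have hu : IsUnit (moment s v h 0) := by
    rw [PowerSeries.isUnit_iff_constantCoeff, ← PowerSeries.coeff_zero_eq_constantCoeff_apply,
      coeff_zero_moment_zero]
    -- The leading coefficient h is a unit since h²w = 1. This replaces cancellation in a domain, as
    -- U may be disconnected.
    exact IsUnit.of_mul_eq_one (h * w) (by linear_combination H.hh)
  obtain ⟨g, hg⟩ := hu.exists_right_inv
  refine ⟨PowerSeries.twist δ₁ s (moment s v h 0) * g, ?_, ?_, ?_⟩
  · linear_combination (-PowerSeries.twist δ₁ s (moment s v h 0)) * hg
  · have h0 := congrArg PowerSeries.constantCoeff hg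
    rw [map_mul, map_one] at h0
    rw [PowerSeries.twist, PowerSeries.coeff_zero_eq_constantCoeff_apply, map_mul, map_add,
      map_mul, map_mul, PowerSeries.constantCoeff_X, zero_mul, add_zero,
      PowerSeries.constantCoeff_C, mul_assoc, h0, mul_one]
  · intro f hf
    linear_combination g * hf - f * hg

variable {S : PowerSeries R}
  (hS : PowerSeries.twist δ₁ s (moment s v h 0) = S * moment s v h 0)
  (hS0 : PowerSeries.coeff 0 S = s)
  (hc : ∀ f : PowerSeries R, f * moment s v h 0 = 0 → f = 0)

include hS

/-- By the third Pearcey equation ∂₂ acts as a second derivative in x₁. The multiplier is the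
generating series of the T_k, with coefficients as in `coefT`. -/
theorem twist₂_eq_mul : PowerSeries.twist δ₂ (s ^ 2) (moment s v h 0) =
    (S ^ 2 + PowerSeries.X * PowerSeries.mapDerivation δ₁ S) * moment s v h 0 := by
  rw [← H.twist₁_twist₁, hS, PowerSeries.twist_mul, hS]
  ring

include hc in
/-- The Riccati equation for the logarithmic derivative of the formal WKB solution. -/
theorem riccati : 4 * (S ^ 3 + 3 * (PowerSeries.X * (S * PowerSeries.mapDerivation δ₁ S)) +
    PowerSeries.X ^ 2 * PowerSeries.mapDerivation δ₁ (PowerSeries.mapDerivation δ₁ S)) +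
    2 * PowerSeries.C x₂ * S + PowerSeries.C x₁ = 0 := by
  apply hc
  have h1 := H.equation_d₁_d₂
  rw [H.twist₂_eq_mul hS, PowerSeries.twist_mul, hS, map_add, Derivation.leibniz,
    PowerSeries.mapDerivation_X, Derivation.leibniz_pow] at h1
  simp only [nsmul_eq_mul, smul_eq_mul, mul_zero, Nat.cast_ofNat, add_zero, Nat.reduceSub,
    pow_one] at h1
  linear_combination h1

include hS0 hc in
theorem coeff_logDerivative_one :
    PowerSeries.coeff 1 S = -(algebraMap ℂ R (1 / 2)) * (δ₁ w * v) := by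
  have h1 := congrArg (PowerSeries.coeff 1) (H.riccati hS hc)
  have e : 4 * (S ^ 3 + 3 * (PowerSeries.X * (S * PowerSeries.mapDerivation δ₁ S)) +
    PowerSeries.X ^ 2 * PowerSeries.mapDerivation δ₁ (PowerSeries.mapDerivation δ₁ S)) +
    2 * PowerSeries.C x₂ * S + PowerSeries.C x₁ =
    PowerSeries.C 4 * (S * (S * S)) + PowerSeries.C 12 * (PowerSeries.X ^ 1 * (S *
      PowerSeries.mapDerivation δ₁ S)) + PowerSeries.X ^ 2 * (4 *
      PowerSeries.mapDerivation δ₁ (PowerSeries.mapDerivation δ₁ S)) +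
    PowerSeries.C (2 * x₂) * S + PowerSeries.C x₁ := by
    rw [map_mul, map_ofNat, map_ofNat, map_ofNat]
    ring
  rw [e] at h1
  simp only [map_add, map_zero, PowerSeries.coeff_C, PowerSeries.coeff_mul, PowerSeries.coeff_mapDerivation,
    Finset.Nat.antidiagonal_succ, Finset.Nat.antidiagonal_zero, Finset.sum_cons,
    Finset.map_singleton, Finset.sum_singleton, hS0] at h1
  norm_num [hS0] at h1
  have hw := H.hw
  have h12 : δ₁ w = 12 * s * δ₁ s := by rw [H.derivation_w, H.d₁x₂, add_zero]
  have hcc := two_mul_algebraMap_half (R := R)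
  rw [show (algebraMap ℂ R) (1 / 2) = (algebraMap ℂ R) (2⁻¹) by norm_num] at *
  linear_combination (algebraMap ℂ R 2⁻¹ * v) * h1 +
    (-(2 * PowerSeries.coeff 1 S * v * algebraMap ℂ R 2⁻¹)) * (-hw) + (algebraMap ℂ R 2⁻¹ * v) * h12 - PowerSeries.coeff 1 S * hcc - 2 * PowerSeries.coeff 1 S * algebraMap ℂ R 2⁻¹ * H.hwv

include hS0 hc in
-- Coefficient m + 2 of the Riccati equation: the unknown coefficient appears with factor 12s² + 2x₂
-- = 2w, and the remaining terms with factor 4, which gives -2/w.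
theorem coeff_logDerivative_add_two (m : ℕ) :
    PowerSeries.coeff (m + 2) S = -(2 * v) *
      ((∑ a : Fin (m + 2), ∑ b : Fin (m + 2), ∑ c : Fin (m + 2),
        if (a : ℕ) + b + c = m + 2 then
          PowerSeries.coeff a S * PowerSeries.coeff b S * PowerSeries.coeff c S else 0) +
      3 * (∑ a : Fin (m + 2), ∑ b : Fin (m + 2),
        if (a : ℕ) + b = m + 1 then
          PowerSeries.coeff a S * δ₁ (PowerSeries.coeff b S) else 0) +
      δ₁ (δ₁ (PowerSeries.coeff m S))) := by
  have h1 := congrArg (PowerSeries.coeff (m + 2)) (H.riccati hS hc)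
  have e : 4 * (S ^ 3 + 3 * (PowerSeries.X * (S * PowerSeries.mapDerivation δ₁ S)) +
    PowerSeries.X ^ 2 * PowerSeries.mapDerivation δ₁ (PowerSeries.mapDerivation δ₁ S)) +
    2 * PowerSeries.C x₂ * S + PowerSeries.C x₁ =
    PowerSeries.C 4 * S ^ 3 + PowerSeries.C 12 * (PowerSeries.X ^ 1 * (S *
      PowerSeries.mapDerivation δ₁ S)) + PowerSeries.C 4 * (PowerSeries.X ^ 2 *
      PowerSeries.mapDerivation δ₁ (PowerSeries.mapDerivation δ₁ S)) +
    PowerSeries.C (2 * x₂) * S + PowerSeries.C x₁ := by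
    rw [map_mul, map_ofNat, map_ofNat, map_ofNat]
    ring
  rw [e] at h1
  simp only [map_add, PowerSeries.coeff_C_mul, PowerSeries.coeff_pow_three, map_zero,
    PowerSeries.coeff_X_pow_mul', PowerSeries.coeff_C] at h1
  rw [if_pos (by omega), if_pos (by omega), if_neg (by omega),
    show m + 2 - 1 = m + 1 by omega, show m + 2 - 2 = m by omega,
    PowerSeries.coeff_mul_eq_sum_fin] at h1
  simp only [PowerSeries.coeff_mapDerivation, hS0] at h1
  have hw := H.hw
  have hcc := two_mul_algebraMap_half (R := R)
  generalize (∑ a : Fin (m + 2), ∑ b : Fin (m + 2), ∑ c : Fin (m + 2), if (a : ℕ) + b + c = m + 2 then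
    PowerSeries.coeff a S * PowerSeries.coeff b S * PowerSeries.coeff c S else 0) = T₃ at h1 ⊢
  generalize (∑ a : Fin (m + 2), ∑ b : Fin (m + 2), if (a : ℕ) + b = m + 1 then
    PowerSeries.coeff a S * δ₁ (PowerSeries.coeff b S) else 0) = T₂ at h1 ⊢
  linear_combination (algebraMap ℂ R (1 / 2) * v) * h1 +
    2 * algebraMap ℂ R (1 / 2) * v * PowerSeries.coeff (m + 2) S * hw -
    (w * v * PowerSeries.coeff (m + 2) S +
      2 * v * (T₃ + 3 * T₂ + δ₁ (δ₁ (PowerSeries.coeff m S)))) * hcc -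
    PowerSeries.coeff (m + 2) S * H.hwv

include hS0 in
-- The fourth equation divided by the solution. The leading terms 3x₁s + 2x₂s² cancel against the
-- derivative of exp(ηφ) in η, so only coefficients of index at least 1 survive.
theorem euler_logDerivative (n : ℕ) :
    (∑ a ∈ Finset.HasAntidiagonal.antidiagonal n,
      (3 * x₁ * PowerSeries.coeff (a.1 + 1) S + 2 * x₂ * PowerSeries.coeff (a.1 + 1)
        (S ^ 2 + PowerSeries.X * PowerSeries.mapDerivation δ₁ S)) *
          PowerSeries.coeff a.2 (moment s v h 0)) +
      (4 * (n : R) + 1) * PowerSeries.coeff n (moment s v h 0) = 0 := by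
  have h4 := H.equation_euler n
  have hT0 : PowerSeries.coeff 0 (S ^ 2 + PowerSeries.X * PowerSeries.mapDerivation δ₁ S) =
      s ^ 2 := by
    rw [map_add, PowerSeries.coeff_zero_X_mul, add_zero,
      PowerSeries.coeff_zero_eq_constantCoeff_apply, map_pow,
      ← PowerSeries.coeff_zero_eq_constantCoeff_apply, hS0]
  rw [H.twist₂_eq_mul hS, hS, PowerSeries.coeff_mul, PowerSeries.coeff_mul,
    Finset.Nat.sum_antidiagonal_succ, Finset.Nat.sum_antidiagonal_succ, hS0, hT0] at h4
  simp only [add_mul, Finset.sum_add_distrib]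
  simp only [mul_assoc, ← Finset.mul_sum]
  linear_combination h4

include hS0 in
-- The case n = 0. The value -1 cancels the constant in 4n + 1, leaving a pure
-- logarithmic-derivative recursion.
theorem euler_logDerivative_zero :
    3 * x₁ * PowerSeries.coeff 1 S + 2 * x₂ * PowerSeries.coeff 1
      (S ^ 2 + PowerSeries.X * PowerSeries.mapDerivation δ₁ S) = -1 := by
  have h0 := H.euler_logDerivative hS hS0 0
  rw [Finset.Nat.antidiagonal_zero, Finset.sum_singleton, coeff_zero_moment_zero] at h0
  simp only [Nat.cast_zero, mul_zero, zero_add, one_mul] at h0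
  linear_combination (h * w) * h0 - (3 * x₁ * PowerSeries.coeff 1 S + 2 * x₂ *
    PowerSeries.coeff 1 (S ^ 2 + PowerSeries.X * PowerSeries.mapDerivation δ₁ S) + 1) * H.hh

end CubicRoot

end Pearcey

/-! ### Identification of the WKB coefficients with the formal Gaussian integral -/

namespace Pearcey

open HoloAlg

variable {U : TopologicalSpace.Opens (Fin 2 → ℂ)}

theorem w_ne_zero {s h : (Fin 2 → ℂ) → ℂ} (hw : ∀ p ∈ U, h p ^ 2 * w s p = 1) {p : Fin 2 → ℂ}
    (hp : p ∈ U) : w s p ≠ 0 := right_ne_zero_of_mul_eq_one (hw p hp)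

/-- A holomorphic root of the cubic and a branch of `w^{-1/2}`, as elements of the ring of
holomorphic functions. -/
theorem exists_cubicRoot {s h : (Fin 2 → ℂ) → ℂ} (hs : AnalyticOnNhd ℂ s U)
    (hh : AnalyticOnNhd ℂ h U)
    (hcub : ∀ p ∈ U, 4 * s p ^ 3 + 2 * p 1 * s p + p 0 = 0)
    (hw : ∀ p ∈ U, h p ^ 2 * w s p = 1) :
    ∃ s' w' v' h' : HoloAlg U,
      CubicRoot (pd 0) (pd 1) (coord U 0) (coord U 1) s' w' v' h' ∧
      (∀ p ∈ U, extn s' p = s p) ∧ (∀ p ∈ U, extn w' p = w s p) ∧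
      (∀ p ∈ U, extn v' p = (w s p)⁻¹) ∧ (∀ p ∈ U, extn h' p = h p) := by
  have hwa : AnalyticOnNhd ℂ (w s) U :=
    ((analyticOnNhd_const (v := (6 : ℂ))).mul (hs.pow 2)).add (analyticOnNhd_apply 1 _)
  have hva : AnalyticOnNhd ℂ (fun p => (w s p)⁻¹) U := hwa.inv fun p hp => w_ne_zero hw hp
  refine ⟨of s hs, of _ hwa, of _ hva, of h hh, ?_, fun p hp => ext_of _ hs hp,
    fun p hp => ext_of _ hwa hp, fun p hp => ext_of _ hva hp, fun p hp => ext_of _ hh hp⟩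
  constructor
  · rw [pd_coord]; simp
  · rw [pd_coord]; simp
  · rw [pd_coord]; simp
  · rw [pd_coord]; simp
  · apply eq_of_eval
    rintro ⟨p, hp⟩
    simp only [map_add, map_mul, map_pow, map_ofNat, map_zero, coord, eval_of]
    exact hcub p hp
  · apply eq_of_eval
    rintro ⟨p, hp⟩
    simp only [map_add, map_mul, map_pow, map_ofNat, coord, eval_of, w]
  · apply eq_of_eval
    rintro ⟨p, hp⟩
    simp only [map_mul, map_one, eval_of]
    exact mul_inv_cancel₀ (w_ne_zero hw hp)
  · apply eq_of_eval
    rintro ⟨p, hp⟩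
    simp only [map_mul, map_pow, map_one, eval_of]
    exact hw p hp

theorem d₁_eq_extn {f : (Fin 2 → ℂ) → ℂ} {F : HoloAlg U} (h : ∀ p ∈ U, f p = extn F p)
    {p : Fin 2 → ℂ} (hp : p ∈ U) : d₁ f p = extn (pd 0 F) p := by
  rw [d₁, fderiv_congr h hp, ext_pd 0 F hp]

variable {s' w' v' h' : HoloAlg U}
  (H : CubicRoot (pd 0) (pd 1) (coord U 0) (coord U 1) s' w' v' h')
  {S : PowerSeries (HoloAlg U)}
  (hS : PowerSeries.twist (pd 0) s' (moment s' v' h' 0) = S * moment s' v' h' 0)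
  (hS0 : PowerSeries.coeff 0 S = s')
  (hc : ∀ f : PowerSeries (HoloAlg U), f * moment s' v' h' 0 = 0 → f = 0)
  {s : (Fin 2 → ℂ) → ℂ} (hs : ∀ p ∈ U, extn s' p = s p)
  (hw : ∀ p ∈ U, extn w' p = w s p) (hv : ∀ p ∈ U, extn v' p = (w s p)⁻¹)

include H hS hS0 hc hs hw hv

/-- Both sides have the same start and the same recursion. Equality is carried on all of the open
set U, so that derivatives agree as well. -/
theorem coefS_eq_extn (n : ℕ) : ∀ p ∈ U, coefS s n p = extn (PowerSeries.coeff n S) p := by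
  induction n using Nat.strong_induction_on with
  | _ n ih =>
    intro p hp
    match n, ih with
    | 0, _ => rw [coefS, hS0, hs p hp]
    | 1, _ =>
      rw [coefS, H.coeff_logDerivative_one hS hS0 hc]
      beta_reduce
      rw [d₁_eq_extn (fun q hq => (hw q hq).symm) hp,
        ← eval_eq_ext _ hp, ← eval_eq_ext _ hp, map_mul, map_mul, map_neg, AlgHom.commutes,
        eval_eq_ext v' hp, hv p hp]
      rfl
    | m + 2, ih =>
      rw [coefS, H.coeff_logDerivative_add_two hS hS0 hc, ← eval_eq_ext _ hp, map_mul, map_neg,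
        map_mul, eval_eq_ext v' hp, hv p hp, map_ofNat, ← div_eq_mul_inv]
      have h3 : ∀ a : Fin (m + 2), coefS s a p = eval ⟨p, hp⟩ (PowerSeries.coeff a S) := by
        intro a
        rw [eval_eq_ext _ hp]
        exact ih a (by omega) p hp
      have h2 : ∀ a : Fin (m + 2), d₁ (coefS s a) p =
          eval ⟨p, hp⟩ (pd 0 (PowerSeries.coeff a S)) := by
        intro a
        rw [eval_eq_ext _ hp]
        exact d₁_eq_extn (ih a (by omega)) hp
      have h1 : d₁ (d₁ (coefS s m)) p =
          eval ⟨p, hp⟩ (pd 0 (pd 0 (PowerSeries.coeff m S))) := by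
        rw [eval_eq_ext _ hp]
        exact d₁_eq_extn (fun q hq => d₁_eq_extn (ih m (by omega)) hq) hp
      simp only [h3, h2, h1, map_add, map_mul, map_sum, map_ofNat, apply_ite (eval ⟨p, hp⟩),
        map_zero]

theorem coefT_eq_extn (n : ℕ) : ∀ p ∈ U, coefT s n p = extn (PowerSeries.coeff n
    (S ^ 2 + PowerSeries.X * PowerSeries.mapDerivation (pd 0) S)) p := by
  intro p hp
  have key := coefS_eq_extn H hS hS0 hc hs hw hv
  rcases n with _ | m
  · rw [coefT, map_add, PowerSeries.coeff_zero_X_mul, add_zero,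
      PowerSeries.coeff_zero_eq_constantCoeff_apply, map_pow,
      ← PowerSeries.coeff_zero_eq_constantCoeff_apply, hS0, ← eval_eq_ext _ hp, map_pow,
      eval_eq_ext _ hp, hs p hp]
  · rw [coefT, map_add, PowerSeries.coeff_succ_X_mul, PowerSeries.coeff_mapDerivation, pow_two,
      PowerSeries.coeff_mul]
    beta_reduce
    rw [d₁_eq_extn (key m) hp, ← eval_eq_ext _ hp, ← eval_eq_ext _ hp,
      map_add, map_sum, add_comm]
    congr 1
    refine Finset.sum_congr rfl fun a _ => ?_
    rw [map_mul, eval_eq_ext _ hp, eval_eq_ext _ hp, key _ p hp, key _ p hp]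

/-- The coefficients of the WKB solution are those of the formal Gaussian integral. -/
theorem wkbCoeff_eq_extn {h : (Fin 2 → ℂ) → ℂ} (hh : ∀ p ∈ U, extn h' p = h p) (n : ℕ) :
    ∀ p ∈ U, wkbCoeff s h n p = extn (PowerSeries.coeff n (moment s' v' h' 0)) p := by
  intro p hp
  have hE : PowerSeries.coeff 0 (exponent s p) = 0 := by simp [exponent]
  have hΛ : ∀ k : ℕ, 3 * p 0 * coefS s (k + 1) p + 2 * p 1 * coefT s (k + 1) p =
      eval ⟨p, hp⟩ (3 * coord U 0 * PowerSeries.coeff (k + 1) S + 2 * coord U 1 *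
        PowerSeries.coeff (k + 1)
          (S ^ 2 + PowerSeries.X * PowerSeries.mapDerivation (pd 0) S)) := by
    intro k
    rw [coefS_eq_extn H hS hS0 hc hs hw hv (k + 1) p hp,
      coefT_eq_extn H hS hS0 hc hs hw hv (k + 1) p hp, ← eval_eq_ext _ hp, ← eval_eq_ext _ hp]
    simp only [map_add, map_mul, map_ofNat, coord, eval_of]
  have key := PowerSeries.coeff_eq_of_logDerivative hE
    (g := fun n => extn (PowerSeries.coeff n (moment s' v' h' 0)) p) ?_ n
  · rw [key, coeff_zero_moment_zero, hh p hp, wkbCoeff]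
  · intro n
    have h1 := congrArg (eval ⟨p, hp⟩) (H.euler_logDerivative hS hS0 n)
    have h0 := congrArg (eval ⟨p, hp⟩) (H.euler_logDerivative_zero hS hS0)
    simp only [map_add _ (Finset.sum _ _), map_sum, map_mul _ _ (PowerSeries.coeff _ _), ← hΛ] at h1
    rw [← hΛ 0, map_neg, map_one] at h0
    -- With Λ_k = 3x₁S_k + 2x₂T_k one has kΩ_k = -Λ_k/4 for k ≥ 1. At k = 0 the left side is zero
    -- whereas Λ₀ = -1, and the correction term supported at (0, n) compensates.
    have h2 : ∀ a ∈ Finset.HasAntidiagonal.antidiagonal n, (a.1 : ℂ) *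
        PowerSeries.coeff a.1 (exponent s p) * extn (PowerSeries.coeff a.2 (moment s' v' h' 0)) p =
        -(1 / 4) * ((3 * p 0 * coefS s (a.1 + 1) p + 2 * p 1 * coefT s (a.1 + 1) p) *
          eval ⟨p, hp⟩ (PowerSeries.coeff a.2 (moment s' v' h' 0))) - 
          if a = (0, n) then (1 / 4) * eval ⟨p, hp⟩ (PowerSeries.coeff n (moment s' v' h' 0))
          else 0 := by
      rintro ⟨i, j⟩ ha
      rw [Finset.HasAntidiagonal.mem_antidiagonal] at ha
      simp only at ha
      rw [eval_eq_ext _ hp, eval_eq_ext _ hp]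
      rcases i with _ | i
      · rw [zero_add] at ha
        subst ha
        rw [if_pos rfl, hE]
        linear_combination (1 / 4) * extn (PowerSeries.coeff j (moment s' v' h' 0)) p * h0
      · rw [if_neg (by simp), exponent, PowerSeries.coeff_mk, if_neg (Nat.succ_ne_zero i),
          primitive]
        have : ((i + 1 : ℕ) : ℂ) ≠ 0 := Nat.cast_ne_zero.2 (Nat.succ_ne_zero i)
        field_simp
        ring
    rw [Finset.sum_congr rfl h2, Finset.sum_sub_distrib, ← Finset.mul_sum, Finset.sum_ite_eq',
      if_pos (by simp)]
    rw [← eval_eq_ext _ hp]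
    simp only [map_mul, map_add, map_natCast, map_ofNat, map_one, map_zero] at h1
    linear_combination (1 / 4) * h1

end Pearcey

/-! ## Power series in two variables -/

/-- The homogeneous part of degree `n` of a power series in two variables, as a multilinear map. -/
noncomputable def biSeries (c : ℕ → ℕ → ℂ) : FormalMultilinearSeries ℂ (ℂ × ℂ) ℂ := fun n =>
  ∑ a ∈ Finset.HasAntidiagonal.antidiagonal n, c a.1 a.2 •
    (ContinuousMultilinearMap.mkPiAlgebraFin ℂ n ℂ).compContinuousLinearMap
      fun i => if (i : ℕ) < a.1 then ContinuousLinearMap.fst ℂ ℂ ℂ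
        else ContinuousLinearMap.snd ℂ ℂ ℂ

theorem biSeries_apply (c : ℕ → ℕ → ℂ) (n : ℕ) (z : ℂ × ℂ) :
    biSeries c n (fun _ => z) =
      ∑ a ∈ Finset.HasAntidiagonal.antidiagonal n, c a.1 a.2 * z.1 ^ a.1 * z.2 ^ a.2 := by
  rw [biSeries, sum_apply]
  refine Finset.sum_congr rfl fun a ha => ?_
  obtain ⟨l, k⟩ := a
  rw [Finset.HasAntidiagonal.mem_antidiagonal] at ha
  simp only at ha
  subst ha
  rw [smul_apply, ContinuousMultilinearMap.compContinuousLinearMap_apply,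
    ContinuousMultilinearMap.mkPiAlgebraFin_apply, List.prod_ofFn, Fin.prod_univ_add]
  simp [mul_assoc]

theorem norm_biSeries_le {c : ℕ → ℕ → ℂ} {C B : ℝ} (hB : 0 ≤ B)
    (hc : ∀ l k, ‖c l k‖ ≤ C * B ^ (l + k)) (n : ℕ) : ‖biSeries c n‖ ≤ C * (2 * B) ^ n := by
  have hC : 0 ≤ C := by
    have := (norm_nonneg _).trans (hc 0 0)
    simpa using this
  have h1 : ∀ a ∈ Finset.HasAntidiagonal.antidiagonal n, ‖c a.1 a.2 •
      (ContinuousMultilinearMap.mkPiAlgebraFin ℂ n ℂ).compContinuousLinearMap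
        fun i => if (i : ℕ) < a.1 then ContinuousLinearMap.fst ℂ ℂ ℂ
          else ContinuousLinearMap.snd ℂ ℂ ℂ‖ ≤ C * B ^ n := by
    intro a ha
    rw [norm_smul]
    have h2 : ‖(ContinuousMultilinearMap.mkPiAlgebraFin ℂ n ℂ).compContinuousLinearMap
        fun i => if (i : ℕ) < a.1 then ContinuousLinearMap.fst ℂ ℂ ℂ
          else ContinuousLinearMap.snd ℂ ℂ ℂ‖ ≤ 1 := by
      refine (ContinuousMultilinearMap.norm_compContinuousLinearMap_le _ _).trans ?_
      rw [ContinuousMultilinearMap.norm_mkPiAlgebraFin, one_mul]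
      refine Finset.prod_le_one (fun _ _ => norm_nonneg _) fun i _ => ?_
      split_ifs
      · exact ContinuousLinearMap.norm_fst_le ℂ ℂ ℂ
      · exact ContinuousLinearMap.norm_snd_le ℂ ℂ ℂ
    have h3 := hc a.1 a.2
    rw [Finset.HasAntidiagonal.mem_antidiagonal.1 ha] at h3
    calc _ ≤ (C * B ^ n) * 1 := mul_le_mul h3 h2 (norm_nonneg _) (by positivity)
      _ = _ := mul_one _
  calc ‖biSeries c n‖ ≤ ∑ a ∈ Finset.HasAntidiagonal.antidiagonal n, C * B ^ n :=
        (norm_sum_le _ _).trans (Finset.sum_le_sum h1)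
    _ = (n + 1 : ℕ) * (C * B ^ n) := by
        rw [Finset.sum_const, Finset.Nat.card_antidiagonal, nsmul_eq_mul]
    _ ≤ 2 ^ n * (C * B ^ n) := by
        have : ((n + 1 : ℕ) : ℝ) ≤ 2 ^ n := by exact_mod_cast Nat.lt_two_pow_self
        gcongr
    _ = C * (2 * B) ^ n := by rw [mul_pow]; ring

/-- A power series in two variables with geometrically bounded coefficients is analytic. -/
theorem analyticAt_tsum_antidiagonal {c : ℕ → ℕ → ℂ} {C B : ℝ} (hB : 0 < B)
    (hc : ∀ l k, ‖c l k‖ ≤ C * B ^ (l + k)) {z : ℂ × ℂ} (hz : 2 * B * ‖z‖ < 1) :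
    AnalyticAt ℂ (fun z : ℂ × ℂ => ∑' n, ∑ a ∈ Finset.HasAntidiagonal.antidiagonal n,
      c a.1 a.2 * z.1 ^ a.1 * z.2 ^ a.2) z := by
  have hr : (ENNReal.ofReal (2 * B)⁻¹) ≤ (biSeries c).radius := by
    refine (biSeries c).le_radius_of_bound C fun n => ?_
    rw [Real.coe_toNNReal _ (by positivity)]
    calc _ ≤ C * (2 * B) ^ n * (2 * B)⁻¹ ^ n := by
          gcongr
          exact norm_biSeries_le hB.le hc n
      _ = C := by rw [mul_assoc, ← mul_pow, mul_inv_cancel₀ (by positivity), one_pow, mul_one]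
  have hp : 0 < (biSeries c).radius :=
    lt_of_lt_of_le (ENNReal.ofReal_pos.2 (by positivity)) hr
  have h1 := ((biSeries c).hasFPowerSeriesOnBall hp).analyticAt_of_mem (y := z) (by
    rw [Metric.mem_eball, edist_zero_right]
    refine lt_of_lt_of_le ?_ hr
    rw [← ofReal_norm]
    refine (ENNReal.ofReal_lt_ofReal_iff (by positivity)).2 ?_
    rw [← one_div, lt_div_iff₀ (by positivity)]
    linarith)
  refine h1.congr (Filter.Eventually.of_forall fun y => ?_)
  simp only [FormalMultilinearSeries.sum, biSeries_apply]

namespace Pearcey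

/-! ## Growth of the WKB coefficients -/

theorem norm_gaussMoment_le (m : ℕ) : ‖gaussMoment m‖ ≤ m.factorial := by
  induction m with
  | zero => simp [gaussMoment]
  | succ m ih =>
    rw [gaussMoment, norm_mul, norm_neg, Nat.factorial_succ]
    have h1 : ‖(m : ℂ) + 1 / 2‖ ≤ ((m + 1 : ℕ) : ℝ) := by
      have : (m : ℂ) + 1 / 2 = ((m + 1 / 2 : ℝ) : ℂ) := by push_cast; ring
      rw [this, Complex.norm_real, Real.norm_of_nonneg (by positivity)]
      push_cast
      linarith
    push_cast at *
    gcongr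

theorem factorial_add_le (a b : ℕ) :
    (a + b).factorial ≤ 2 ^ (a + b) * (a.factorial * b.factorial) := by
  rw [← Nat.add_choose_mul_factorial_mul_factorial, mul_assoc]
  exact Nat.mul_le_mul_right _ (Nat.choose_le_two_pow _ _)

/-- The coefficient of `(s² v³)^l (v²)^k` in the normalized WKB solution. -/
noncomputable def saddleCoeff (l k : ℕ) : ℂ :=
  16 ^ l * gaussMoment (3 * l + 2 * k) * ((2 * l).factorial : ℂ)⁻¹ * (k.factorial : ℂ)⁻¹

/-- The moment is at most (3l + 2k)!, and two binomial estimates split off (2l)! k!, leaving (l +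
k)! and 4^(3l+2k). The constant is 1024 = 16 · 4³. -/
theorem norm_saddleCoeff_le (l k : ℕ) :
    ‖saddleCoeff l k‖ ≤ 1024 ^ (l + k) * (l + k).factorial := by
  have h1 : (3 * l + 2 * k).factorial ≤
      4 ^ (3 * l + 2 * k) * ((l + k).factorial * ((2 * l).factorial * k.factorial)) := by
    have e1 := factorial_add_le (l + k) (2 * l + k)
    have e2 := factorial_add_le (2 * l) k
    rw [show l + k + (2 * l + k) = 3 * l + 2 * k by ring] at e1
    calc _ ≤ _ := e1
      _ ≤ 2 ^ (3 * l + 2 * k) * ((l + k).factorial *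
          (2 ^ (3 * l + 2 * k) * ((2 * l).factorial * k.factorial))) := by
        gcongr
        exact e2.trans (Nat.mul_le_mul_right _ (Nat.pow_le_pow_right (by norm_num) (by omega)))
      _ = _ := by
        rw [show (4 : ℕ) = 2 * 2 by norm_num, mul_pow]
        ring
  have h2 : (((3 * l + 2 * k).factorial : ℕ) : ℝ) ≤
      4 ^ (3 * l + 2 * k) * ((l + k).factorial * ((2 * l).factorial * k.factorial)) := by
    exact_mod_cast h1
  rw [saddleCoeff, norm_mul, norm_mul, norm_mul, norm_inv, norm_inv, Complex.norm_natCast,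
    Complex.norm_natCast, norm_pow, Complex.norm_ofNat]
  calc (16 : ℝ) ^ l * ‖gaussMoment (3 * l + 2 * k)‖ * ((2 * l).factorial : ℝ)⁻¹ *
        (k.factorial : ℝ)⁻¹
      ≤ 16 ^ l * (4 ^ (3 * l + 2 * k) * ((l + k).factorial * ((2 * l).factorial * k.factorial))) *
        ((2 * l).factorial : ℝ)⁻¹ * (k.factorial : ℝ)⁻¹ := by
        gcongr
        exact (norm_gaussMoment_le _).trans h2
    _ = 1024 ^ l * 16 ^ k * (l + k).factorial := by
        have e1 : ((2 * l).factorial : ℝ) ≠ 0 := Nat.cast_ne_zero.2 (Nat.factorial_ne_zero _)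
        have e2 : (k.factorial : ℝ) ≠ 0 := Nat.cast_ne_zero.2 (Nat.factorial_ne_zero _)
        field_simp
        rw [show (1024 : ℝ) = 16 * 4 ^ 3 by norm_num, mul_pow, pow_add, pow_mul, pow_mul]
        norm_num
        ring
    _ ≤ 1024 ^ (l + k) * (l + k).factorial := by
        rw [pow_add]
        gcongr
        norm_num

/-- For i = 0 the constraint j + 2k = 2n makes j = 2l even with l + k = n, so the coefficient is a
form of degree n in s²v³ and v². This is the source of both the growth bound and the analyticity of
the Borel transform. -/
theorem sum_momentTerm_eq {R : Type*} [CommRing R] [Algebra ℂ R] (s v : R) (n : ℕ) :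
    ∑ a ∈ momentIndex 0 n, momentTerm s v n a =
      ∑ a ∈ Finset.HasAntidiagonal.antidiagonal n, algebraMap ℂ R (saddleCoeff a.1 a.2) *
        (s ^ 2 * v ^ 3) ^ a.1 * (v ^ 2) ^ a.2 := by
  symm
  refine Finset.sum_bij (fun a _ => (2 * a.1, a.2)) ?_ ?_ ?_ ?_
  · rintro ⟨l, k⟩ h
    rw [Finset.HasAntidiagonal.mem_antidiagonal] at h
    rw [mem_momentIndex]
    simp only at h ⊢
    omega
  · rintro ⟨a, b⟩ - ⟨c, d⟩ - h
    simpa using h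
  · rintro ⟨j, k⟩ h
    rw [mem_momentIndex] at h
    simp only at h
    refine ⟨(n - k, k), ?_, ?_⟩
    · rw [Finset.HasAntidiagonal.mem_antidiagonal]
      simp only
      omega
    · simp only [Prod.mk.injEq, and_true]
      omega
  · rintro ⟨l, k⟩ h
    rw [Finset.HasAntidiagonal.mem_antidiagonal] at h
    simp only at h
    subst h
    simp only [momentTerm, saddleCoeff, map_mul, map_pow, map_ofNat]
    rw [show l + k + 2 * l + k = 3 * l + 2 * k by ring, pow_mul (4 * s) 2 l, mul_pow 4 s 2,
      mul_pow (4 ^ 2), mul_pow (s ^ 2), ← pow_mul v 3, ← pow_mul v 2, pow_add v]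
    norm_num
    ring

/-- The growth of the WKB coefficients. -/
theorem norm_sum_saddleCoeff_le (z : ℂ × ℂ) (n : ℕ) :
    ‖∑ a ∈ Finset.HasAntidiagonal.antidiagonal n, saddleCoeff a.1 a.2 * z.1 ^ a.1 * z.2 ^ a.2‖ ≤
      (2048 * (‖z.1‖ + ‖z.2‖)) ^ n * n.factorial := by
  have h1 : ∀ a ∈ Finset.HasAntidiagonal.antidiagonal n,
      ‖saddleCoeff a.1 a.2 * z.1 ^ a.1 * z.2 ^ a.2‖ ≤
        (1024 * (‖z.1‖ + ‖z.2‖)) ^ n * n.factorial := by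
    intro a ha
    have e := norm_saddleCoeff_le a.1 a.2
    have ha' := Finset.HasAntidiagonal.mem_antidiagonal.1 ha
    rw [ha'] at e
    rw [norm_mul, norm_mul, norm_pow, norm_pow]
    calc _ ≤ 1024 ^ n * n.factorial * (‖z.1‖ + ‖z.2‖) ^ a.1 * (‖z.1‖ + ‖z.2‖) ^ a.2 := by
          gcongr
          · linarith [norm_nonneg z.2]
          · linarith [norm_nonneg z.1]
      _ = (1024 * (‖z.1‖ + ‖z.2‖)) ^ n * n.factorial := by
          rw [mul_assoc, ← pow_add, ha', mul_pow]
          ring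
  calc _ ≤ ∑ a ∈ Finset.HasAntidiagonal.antidiagonal n,
        (1024 * (‖z.1‖ + ‖z.2‖)) ^ n * (n.factorial : ℝ) :=
        (norm_sum_le _ _).trans (Finset.sum_le_sum h1)
    _ = (n + 1 : ℕ) * ((1024 * (‖z.1‖ + ‖z.2‖)) ^ n * n.factorial) := by
        rw [Finset.sum_const, Finset.Nat.card_antidiagonal, nsmul_eq_mul]
    _ ≤ 2 ^ n * ((1024 * (‖z.1‖ + ‖z.2‖)) ^ n * n.factorial) := by
        have : ((n + 1 : ℕ) : ℝ) ≤ 2 ^ n := by exact_mod_cast Nat.lt_two_pow_self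
        gcongr
    _ = _ := by
        rw [← mul_assoc, ← mul_pow]
        ring

/-! ## The Gamma factors -/

theorem natCast_sub_half_ne_zero (n e : ℕ) : (n : ℂ) + 1 / 2 - e ≠ 0 := by
  intro h
  have h2 : ((2 * n + 1 : ℤ) : ℂ) = ((2 * e : ℤ) : ℂ) := by
    push_cast
    linear_combination 2 * h
  have := Int.cast_injective h2
  omega

theorem gamma_ne_zero (n e : ℕ) : Complex.Gamma ((n : ℂ) + 1 / 2 - e) ≠ 0 := by
  refine Complex.Gamma_ne_zero fun m h => natCast_sub_half_ne_zero (n + m) e ?_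
  push_cast
  linear_combination h

theorem gamma_sub_succ (n e : ℕ) : Complex.Gamma ((n : ℂ) + 1 / 2 - e) =
    ((n : ℂ) + 1 / 2 - (e + 1 : ℕ)) * Complex.Gamma ((n : ℂ) + 1 / 2 - (e + 1 : ℕ)) := by
  rw [← Complex.Gamma_add_one _ (natCast_sub_half_ne_zero n (e + 1))]
  congr 1
  push_cast
  ring

/-- For e = 0 compare the recursions: n + 1 ≤ 2(n + 1/2). Each lowering of the argument costs |n -
1/2 - e| ≤ (e + 2) 2ⁿ. The base 2^(e+1) is crude, but only its value at e ≤ 1 enters the domain of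
convergence. -/
theorem exists_factorial_le_gamma (e : ℕ) : ∃ C : ℝ, 0 ≤ C ∧ ∀ n : ℕ,
    (n.factorial : ℝ) ≤ C * (2 ^ (e + 1)) ^ n * ‖Complex.Gamma ((n : ℂ) + 1 / 2 - e)‖ := by
  induction e with
  | zero =>
    have hpos : 0 < ‖Complex.Gamma (((0 : ℕ) : ℂ) + 1 / 2 - (0 : ℕ))‖ :=
      norm_pos_iff.2 (gamma_ne_zero 0 0)
    refine ⟨‖Complex.Gamma (((0 : ℕ) : ℂ) + 1 / 2 - (0 : ℕ))‖⁻¹, by positivity, fun n => ?_⟩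
    induction n with
    | zero =>
      rw [pow_zero, mul_one, inv_mul_cancel₀ hpos.ne']
      simp
    | succ n ih =>
      have h1 : Complex.Gamma (((n + 1 : ℕ) : ℂ) + 1 / 2 - (0 : ℕ)) =
          ((n : ℂ) + 1 / 2) * Complex.Gamma ((n : ℂ) + 1 / 2 - (0 : ℕ)) := by
        have h0 := natCast_sub_half_ne_zero n 0
        rw [Nat.cast_zero, sub_zero] at h0
        rw [Nat.cast_zero, sub_zero, sub_zero, ← Complex.Gamma_add_one _ h0]
        congr 1
        push_cast
        ring
      have h2 : ‖(n : ℂ) + 1 / 2‖ = n + 1 / 2 := by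
        have : (n : ℂ) + 1 / 2 = ((n + 1 / 2 : ℝ) : ℂ) := by push_cast; ring
        rw [this, Complex.norm_real, Real.norm_of_nonneg (by positivity)]
      rw [h1, norm_mul, h2, Nat.factorial_succ, pow_succ]
      push_cast at ih ⊢
      set G := ‖Complex.Gamma ((n : ℂ) + 1 / 2 - 0)‖
      calc ((n : ℝ) + 1) * n.factorial ≤ (2 * (n + 1 / 2)) * n.factorial := by
            gcongr
            linarith [(Nat.cast_nonneg n : (0 : ℝ) ≤ n)]
        _ ≤ (2 * (n + 1 / 2)) * (‖Complex.Gamma (0 + 1 / 2 - 0)‖⁻¹ * (2 ^ 1) ^ n * G) := by gcongr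
        _ = _ := by ring
  | succ e ih =>
    obtain ⟨C, hC, h⟩ := ih
    refine ⟨C * (e + 2), by positivity, fun n => (h n).trans ?_⟩
    rw [gamma_sub_succ n e, norm_mul]
    have h1 : ‖(n : ℂ) + 1 / 2 - (e + 1 : ℕ)‖ ≤ (e + 2) * 2 ^ n := by
      have h2 : (n : ℝ) + 1 ≤ 2 ^ n := by exact_mod_cast Nat.lt_two_pow_self
      have h3 : (1 : ℝ) ≤ 2 ^ n := one_le_pow₀ (by norm_num)
      calc _ ≤ ‖(n : ℂ) + 1 / 2‖ + ‖((e + 1 : ℕ) : ℂ)‖ := norm_sub_le _ _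
        _ ≤ ‖(n : ℂ)‖ + ‖(1 / 2 : ℂ)‖ + ‖((e + 1 : ℕ) : ℂ)‖ := by gcongr; exact norm_add_le _ _
        _ ≤ _ := by
          rw [Complex.norm_natCast, Complex.norm_natCast]
          have : ‖(1 / 2 : ℂ)‖ = 1 / 2 := by norm_num
          rw [this]
          push_cast
          nlinarith [(Nat.cast_nonneg e : (0 : ℝ) ≤ e)]
    calc _ ≤ C * (2 ^ (e + 1)) ^ n * (((e + 2) * 2 ^ n) * _) := by gcongr
      _ = _ := by rw [pow_succ 2 (e + 1), mul_pow]; ring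

end Pearcey

/-! ## Termwise differentiation -/

/-- A normally convergent series of holomorphic functions with holomorphic sum may be
differentiated term by term. -/
theorem hasSum_fderiv_apply {m : ℕ} {V : TopologicalSpace.Opens (Fin m → ℂ)}
    {T : ℕ → (Fin m → ℂ) → ℂ} {f : (Fin m → ℂ) → ℂ} (hT : ∀ n, AnalyticOnNhd ℂ (T n) V)
    (hf : AnalyticOnNhd ℂ f V) (hsum : ∀ q ∈ V, HasSum (fun n => T n q) (f q))
    {q : Fin m → ℂ} (hq : q ∈ V)
    (hb : ∃ u : ℕ → ℝ, Summable u ∧ ∀ᶠ q' in nhds q, ∀ n, ‖T n q'‖ ≤ u n) (e : Fin m → ℂ) :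
    HasSum (fun n => fderiv ℂ (T n) q e) (fderiv ℂ f q e) := by
  obtain ⟨u, hu, hub⟩ := hb
  have hl : ∀ t : ℂ, HasDerivAt (fun t : ℂ => q + t • e) e t := fun t => by
    simpa using ((hasDerivAt_id t).smul_const e).const_add q
  have hcont : Continuous fun t : ℂ => q + t • e := by fun_prop
  have hev : ∀ᶠ t in nhds (0 : ℂ), q + t • e ∈ V ∧ ∀ n, ‖T n (q + t • e)‖ ≤ u n := by
    have h0 : Filter.Tendsto (fun t : ℂ => q + t • e) (nhds 0) (nhds q) := by
      have := hcont.tendsto 0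
      simpa using this
    exact h0.eventually ((V.isOpen.eventually_mem hq).and hub)
  obtain ⟨W, hWsub, hWo, hW0⟩ := eventually_nhds_iff.1 hev
  have hline : ∀ g : (Fin m → ℂ) → ℂ, AnalyticOnNhd ℂ g V → ∀ t ∈ W,
      HasDerivAt (fun t : ℂ => g (q + t • e)) (fderiv ℂ g (q + t • e) e) t := fun g hg t ht =>
    ((hg _ (hWsub t ht).1).differentiableAt.hasFDerivAt).comp_hasDerivAt t (hl t)
  -- Restriction to the complex line q + t e reduces the claim to the one-variable Weierstrass
  -- theorem.
  have key := Complex.hasSum_deriv_of_summable_norm (F := fun n t => T n (q + t • e)) hu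
    (fun n t ht => (hline (T n) (hT n) t ht).differentiableAt.differentiableWithinAt) hWo
    (fun n t ht => (hWsub t ht).2 n) hW0
  have h1 : deriv (fun t : ℂ => ∑' n, T n (q + t • e)) 0 = fderiv ℂ f q e := by
    have : (fun t : ℂ => ∑' n, T n (q + t • e)) =ᶠ[nhds 0] fun t => f (q + t • e) := by
      filter_upwards [hWo.mem_nhds hW0] with t ht
      exact (hsum _ (hWsub t ht).1).tsum_eq
    rw [this.deriv_eq, (hline f hf 0 hW0).deriv]
    simp
  rw [h1] at key
  have h2 : (fun n => deriv (fun t : ℂ => T n (q + t • e)) 0) = fun n => fderiv ℂ (T n) q e := by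
    funext n
    rw [(hline (T n) (hT n) 0 hW0).deriv]
    simp
  rw [h2] at key
  exact key

/-! ### Factorial growth is stable under the formal operators -/

namespace Pearcey

open HoloAlg

section Gevrey

variable {U : TopologicalSpace.Opens (Fin 2 → ℂ)}

/-- The coefficients of the series `a` grow at most like `A ^ n n!` near `p`, for `A > α p`. -/
def Gevrey (α : (Fin 2 → ℂ) → ℝ) (a : PowerSeries (HoloAlg U)) : Prop :=
  ∀ p ∈ U, ∀ A > α p, ∃ C : ℝ, ∀ᶠ p' in nhds p, ∀ n : ℕ,
    ‖extn (PowerSeries.coeff n a) p'‖ ≤ C * A ^ n * n.factorial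

variable {α : (Fin 2 → ℂ) → ℝ} {a b : PowerSeries (HoloAlg U)}

theorem Gevrey.add (ha : Gevrey α a) (hb : Gevrey α b) : Gevrey α (a + b) := by
  intro p hp A hA
  obtain ⟨C, hC⟩ := ha p hp A hA
  obtain ⟨D, hD⟩ := hb p hp A hA
  refine ⟨C + D, ?_⟩
  filter_upwards [hC, hD, U.isOpen.mem_nhds hp] with p' h1 h2 hp' n
  rw [map_add, ext_add _ _ hp']
  calc _ ≤ _ := norm_add_le _ _
    _ ≤ _ := add_le_add (h1 n) (h2 n)
    _ = _ := by ring

theorem Gevrey.C_mul (ha : Gevrey α a) (c : HoloAlg U) : Gevrey α (PowerSeries.C c * a) := by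
  intro p hp A hA
  obtain ⟨C, hC⟩ := ha p hp A hA
  have hc : ∀ᶠ p' in nhds p, ‖extn c p'‖ < ‖extn c p‖ + 1 :=
    (analyticOnNhd_extn c p hp).continuousAt.norm.eventually_lt continuousAt_const (by simp)
  refine ⟨(‖extn c p‖ + 1) * C, ?_⟩
  filter_upwards [hC, hc, U.isOpen.mem_nhds hp] with p' h1 h2 hp' n
  rw [PowerSeries.coeff_C_mul, ext_mul _ _ hp', Pi.mul_apply, norm_mul]
  calc _ ≤ (‖extn c p‖ + 1) * (C * A ^ n * n.factorial) :=
        mul_le_mul h2.le (h1 n) (norm_nonneg _) (by positivity)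
    _ = _ := by ring

theorem Gevrey.X_mul (hα : ∀ p, 0 ≤ α p) (ha : Gevrey α a) : Gevrey α (PowerSeries.X * a) := by
  intro p hp A hA
  obtain ⟨C, hC⟩ := ha p hp A hA
  have hA0 : 0 < A := (hα p).trans_lt hA
  refine ⟨C / A, ?_⟩
  filter_upwards [hC, U.isOpen.mem_nhds hp] with p' h1 hp' n
  have hC0 : 0 ≤ C := by simpa using (norm_nonneg _).trans (h1 0)
  rcases n with _ | n
  · rw [PowerSeries.coeff_zero_X_mul, ← eval_eq_ext _ hp', map_zero, norm_zero]
    positivity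
  · rw [PowerSeries.coeff_succ_X_mul]
    refine (h1 n).trans ?_
    have : (n.factorial : ℝ) ≤ (n + 1).factorial := by
      exact_mod_cast Nat.factorial_le (Nat.le_succ n)
    calc _ ≤ C * A ^ n * (n + 1).factorial := by gcongr
      _ = _ := by rw [pow_succ]; field_simp

/-- Cauchy's estimate on a circle of radius R/2 in the i-th direction. It costs the constant 2/R,
independent of n, so the rate A is unchanged. -/
theorem Gevrey.mapDerivation (ha : Gevrey α a) (i : Fin 2) :
    Gevrey α (PowerSeries.mapDerivation (pd i) a) := by
  intro p hp A hA
  obtain ⟨C, hC⟩ := ha p hp A hA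
  obtain ⟨R, hR, hball⟩ := Metric.eventually_nhds_iff_ball.1
    ((U.isOpen.eventually_mem hp).and hC)
  refine ⟨C / (R / 2), ?_⟩
  filter_upwards [Metric.ball_mem_nhds p (half_pos hR)] with p' hp' n
  have hmem : ∀ z ∈ Metric.closedBall (0 : ℂ) (R / 2),
      p' + z • (Pi.single i 1 : Fin 2 → ℂ) ∈ Metric.ball p R := by
    intro z hz
    rw [Metric.mem_ball, dist_eq_norm]
    rw [Metric.mem_ball, dist_eq_norm] at hp'
    rw [Metric.mem_closedBall, dist_zero_right] at hz
    have h1 : ‖z • (Pi.single i 1 : Fin 2 → ℂ)‖ ≤ R / 2 := by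
      rw [norm_smul, Pi.norm_single, norm_one, mul_one]
      exact hz
    calc _ = ‖(p' - p) + z • (Pi.single i 1 : Fin 2 → ℂ)‖ := by congr 1; abel
      _ ≤ _ := norm_add_le _ _
      _ < R := by linarith
  have hpU : p' ∈ U := by
    have := (hball _ (hmem 0 (by simp; positivity))).1
    simpa using this
  have hd : ∀ z ∈ Metric.closedBall (0 : ℂ) (R / 2), HasDerivAt
      (fun z : ℂ => extn (PowerSeries.coeff n a) (p' + z • (Pi.single i 1 : Fin 2 → ℂ)))
      (fderiv ℂ (extn (PowerSeries.coeff n a)) (p' + z • (Pi.single i 1 : Fin 2 → ℂ))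
        (Pi.single i 1)) z := by
    intro z hz
    have hl : HasDerivAt (fun t : ℂ => p' + t • (Pi.single i 1 : Fin 2 → ℂ)) (Pi.single i 1) z := by
      simpa using ((hasDerivAt_id z).smul_const (Pi.single i 1 : Fin 2 → ℂ)).const_add p'
    exact ((analyticOnNhd_extn _ _
      (hball _ (hmem z hz)).1).differentiableAt.hasFDerivAt).comp_hasDerivAt z hl
  have key := Complex.norm_deriv_le_of_forall_mem_sphere_norm_le (half_pos hR)
    (DifferentiableOn.diffContOnCl fun z hz => (hd z (by
      rwa [closure_ball _ (half_pos hR).ne'] at hz)).differentiableAt.differentiableWithinAt)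
    fun z hz => (hball _ (hmem z (Metric.sphere_subset_closedBall hz))).2 n
  rw [(hd 0 (by simp; positivity)).deriv] at key
  rw [PowerSeries.coeff_mapDerivation, ext_pd _ _ hpU]
  simp only [zero_smul, add_zero] at key
  refine key.trans (le_of_eq ?_)
  ring

theorem Gevrey.twist (hα : ∀ p, 0 ≤ α p) (ha : Gevrey α a) (i : Fin 2) (σ : HoloAlg U) :
    Gevrey α (PowerSeries.twist (pd i) σ a) :=
  (ha.C_mul σ).add ((ha.mapDerivation i).X_mul hα)

end Gevrey

end Pearcey

/-! ### The Borel transform and termwise action of operators -/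

namespace Pearcey

open HoloAlg

/-- The projection `base` as a continuous linear map. -/
noncomputable def baseL : (Fin 3 → ℂ) →L[ℂ] (Fin 2 → ℂ) :=
  ContinuousLinearMap.pi fun i => ContinuousLinearMap.proj (Fin.castSucc i)

theorem baseL_apply (q : Fin 3 → ℂ) : baseL q = base q := by
  funext i
  fin_cases i <;> rfl

theorem baseL_single_castSucc (i : Fin 2) :
    baseL (Pi.single (Fin.castSucc i) 1) = Pi.single i 1 := by
  funext j
  fin_cases i <;> fin_cases j <;> simp [baseL]

theorem baseL_single_two : baseL (Pi.single 2 1) = 0 := by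
  funext j
  fin_cases j <;> simp [baseL]

theorem base_castSucc (q : Fin 3 → ℂ) (i : Fin 2) : base q i = q (Fin.castSucc i) := by
  fin_cases i <;> rfl

section Borel

variable {U : TopologicalSpace.Opens (Fin 2 → ℂ)}

theorem hasFDerivAt_extn_base (f : HoloAlg U) {q : Fin 3 → ℂ} (hq : base q ∈ U) :
    HasFDerivAt (fun q => extn f (base q)) ((fderiv ℂ (extn f) (base q)).comp baseL) q := by
  have h1 : HasFDerivAt (extn f) (fderiv ℂ (extn f) (base q)) (baseL q) := by
    rw [baseL_apply]
    exact (analyticOnNhd_extn f _ hq).differentiableAt.hasFDerivAt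
  have h2 := h1.comp q baseL.hasFDerivAt
  have h3 : (extn f ∘ baseL) = fun q => extn f (base q) := by
    funext q
    rw [Function.comp_apply, baseL_apply]
  rwa [h3] at h2

theorem analyticAt_extn_base (f : HoloAlg U) {q : Fin 3 → ℂ} (hq : base q ∈ U) :
    AnalyticAt ℂ (fun q => extn f (base q)) q := by
  have h1 : AnalyticAt ℂ (extn f) (baseL q) := by
    rw [baseL_apply]
    exact analyticOnNhd_extn f _ hq
  have h2 := h1.comp (baseL.analyticAt q)
  have h3 : (extn f ∘ baseL) = fun q => extn f (base q) := by
    funext q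
    rw [Function.comp_apply, baseL_apply]
  rwa [h3] at h2

/-- A branch `r` on `V` of the square root of `y + φ(x₁, x₂)`, on the domain where series with
coefficients of growth `α` have a convergent Borel transform. -/
structure BorelDomain (φ : HoloAlg U) (α : (Fin 2 → ℂ) → ℝ)
    (V : TopologicalSpace.Opens (Fin 3 → ℂ)) (r : (Fin 3 → ℂ) → ℂ) : Prop where
  base_mem : ∀ q ∈ V, base q ∈ U
  analytic : AnalyticOnNhd ℂ r V
  ne_zero : ∀ q ∈ V, r q ≠ 0
  sq_eq : ∀ q ∈ V, r q ^ 2 = q 2 + extn φ (base q)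
  nonneg : ∀ p, 0 ≤ α p
  lt_one : ∀ q ∈ V, 4 * α (base q) * ‖r q ^ 2‖ < 1

/-- The `n`-th term of the Borel transform of `η^e exp (-η φ) ∑ a_n η^{-n-1/2}`. -/
noncomputable def borelSummand (r : (Fin 3 → ℂ) → ℂ) (e : ℕ) (a : PowerSeries (HoloAlg U)) (n : ℕ)
    (q : Fin 3 → ℂ) : ℂ :=
  extn (PowerSeries.coeff n a) (base q) / Complex.Gamma ((n : ℂ) + 1 / 2 - e) *
    r q ^ (2 * (n : ℤ) - 1 - 2 * e)

variable {φ : HoloAlg U} {α : (Fin 2 → ℂ) → ℝ} {V : TopologicalSpace.Opens (Fin 3 → ℂ)}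
  {r : (Fin 3 → ℂ) → ℂ} (D : BorelDomain φ α V r)

include D

namespace BorelDomain

theorem fderiv_r {q : Fin 3 → ℂ} (hq : q ∈ V) (v : Fin 3 → ℂ) :
    2 * r q * fderiv ℂ r q v = v 2 + fderiv ℂ (extn φ) (base q) (baseL v) := by
  have h1 : HasFDerivAt r (fderiv ℂ r q) q :=
    (D.analytic q hq).differentiableAt.hasFDerivAt
  have h2 := h1.pow 2
  have h3 : HasFDerivAt (fun q : Fin 3 → ℂ => q 2 + extn φ (base q)) _ q :=
    ((ContinuousLinearMap.proj (R := ℂ) (φ := fun _ : Fin 3 => ℂ) 2).hasFDerivAt (x := q)).add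
      (hasFDerivAt_extn_base φ (D.base_mem q hq))
  have h4 : (fun q => r q ^ 2) =ᶠ[nhds q] fun q => q 2 + extn φ (base q) := by
    filter_upwards [V.isOpen.eventually_mem hq] with x hx using D.sq_eq x hx
  have h5 := congrArg (fun L => L v) (h2.unique (h3.congr_of_eventuallyEq h4))
  simpa using h5

theorem analyticOnNhd_borelSummand (e : ℕ) (a : PowerSeries (HoloAlg U)) (n : ℕ) :
    AnalyticOnNhd ℂ (borelSummand r e a n) V := fun q hq =>
  ((analyticAt_extn_base _ (D.base_mem q hq)).div_const).mul
    ((D.analytic q hq).zpow (D.ne_zero q hq))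

/-- Differentiating (y + φ)^c / Γ(c + 1) with c = n - 1/2 - e gives (y + φ)^(c-1) / Γ(c), times the
derivative of y + φ: the summand of level e + 1. -/
theorem fderiv_borelSummand (e : ℕ) (a : PowerSeries (HoloAlg U)) (n : ℕ) {q : Fin 3 → ℂ}
    (hq : q ∈ V) (v : Fin 3 → ℂ) :
    fderiv ℂ (borelSummand r e a n) q v =
      fderiv ℂ (extn (PowerSeries.coeff n a)) (base q) (baseL v) /
        Complex.Gamma ((n : ℂ) + 1 / 2 - e) * r q ^ (2 * (n : ℤ) - 1 - 2 * e) +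
      (v 2 + fderiv ℂ (extn φ) (base q) (baseL v)) * borelSummand r (e + 1) a n q := by
  have h1 := hasFDerivAt_extn_base (PowerSeries.coeff n a) (D.base_mem q hq)
  have hr := D.ne_zero q hq
  have h2 : HasFDerivAt (fun q => r q ^ (2 * (n : ℤ) - 1 - 2 * e)) _ q :=
    (hasDerivAt_zpow (2 * (n : ℤ) - 1 - 2 * e) (r q) (Or.inl hr)).comp_hasFDerivAt q
      (D.analytic q hq).differentiableAt.hasFDerivAt
  have h3 : HasFDerivAt (borelSummand r e a n) _ q :=
    (h1.mul_const (Complex.Gamma ((n : ℂ) + 1 / 2 - e))⁻¹).mul h2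
  rw [h3.fderiv]
  have h4 := D.fderiv_r hq v
  have h5 := gamma_sub_succ n e
  have h6 := gamma_ne_zero n (e + 1)
  have h7 := natCast_sub_half_ne_zero n (e + 1)
  have h8 : r q ^ (2 * (n : ℤ) - 1 - 2 * e - 1) = r q * r q ^ (2 * (n : ℤ) - 1 - 2 * (e + 1 : ℕ)) := by
    rw [← zpow_one_add₀ hr]
    congr 1
    push_cast
    ring
  have h9 : ((2 * (n : ℤ) - 1 - 2 * e : ℤ) : ℂ) = 2 * ((n : ℂ) + 1 / 2 - (e + 1 : ℕ)) := by
    push_cast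
    ring
  simp only [borelSummand, add_apply, smul_apply, smul_eq_mul, ContinuousLinearMap.comp_apply, h8,
    ← h4, h5, h9]
  generalize (n : ℂ) + 1 / 2 - (e + 1 : ℕ) = c at h6 h7 ⊢
  generalize Complex.Gamma c = G at h6 ⊢
  generalize r q ^ (2 * (n : ℤ) - 1 - 2 * (e + 1 : ℕ)) = R
  generalize r q ^ (2 * (n : ℤ) - 1 - 2 * e) = R'
  field_simp
  ring

/-- Geometric majorant with ratio 4A|r|²: A from the growth of a, and 4 bounding 2^(e+1). Levels 0
and 1 suffice because the operators have order at most two. -/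
theorem exists_summable_bound {a : PowerSeries (HoloAlg U)} (ha : Gevrey α a) {e : ℕ} (he : e ≤ 1)
    {q : Fin 3 → ℂ} (hq : q ∈ V) :
    ∃ u : ℕ → ℝ, Summable u ∧ ∀ᶠ q' in nhds q, ∀ n, ‖borelSummand r e a n q'‖ ≤ u n := by
  obtain ⟨K, hK, hΓ⟩ := exists_factorial_le_gamma e
  have hr := D.ne_zero q hq
  have hr2 : 0 < ‖r q ^ 2‖ := norm_pos_iff.2 (pow_ne_zero 2 hr)
  obtain ⟨A, hA1, hA2⟩ : ∃ A > α (base q), 4 * A * ‖r q ^ 2‖ < 1 := by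
    have h1 : α (base q) < 1 / (4 * ‖r q ^ 2‖) := by
      rw [lt_div_iff₀ (by positivity)]
      linarith [D.lt_one q hq]
    obtain ⟨A, h2, h3⟩ := exists_between h1
    refine ⟨A, h2, ?_⟩
    rw [lt_div_iff₀ (by positivity)] at h3
    linarith
  have hA0 : 0 ≤ A := (D.nonneg _).trans hA1.le
  obtain ⟨ρ, hρ1, hρ2⟩ := exists_between hA2
  obtain ⟨C, hC⟩ := ha (base q) (D.base_mem q hq) A hA1
  have hrc : ContinuousAt r q := (D.analytic q hq).continuousAt
  have e1 : ∀ᶠ q' in nhds q, 4 * A * ‖r q' ^ 2‖ < ρ :=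
    (continuousAt_const.mul (hrc.pow 2).norm).eventually_lt continuousAt_const hρ1
  have e2 : ∀ᶠ q' in nhds q, ‖r q' ^ (-1 - 2 * (e : ℤ))‖ < ‖r q ^ (-1 - 2 * (e : ℤ))‖ + 1 :=
    (hrc.zpow₀ _ (Or.inl hr)).norm.eventually_lt continuousAt_const (by simp)
  have e3 : ∀ᶠ q' in nhds q, ∀ n : ℕ,
      ‖extn (PowerSeries.coeff n a) (base q')‖ ≤ C * A ^ n * n.factorial := by
    have h1 : Filter.Tendsto base (nhds q) (nhds (base q)) := by
      have := baseL.continuous.tendsto q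
      simpa only [baseL_apply] using this.congr baseL_apply
    exact h1.eventually hC
  have hρ0 : 0 ≤ ρ := le_trans (by positivity) hρ1.le
  refine ⟨fun n => C * K * (‖r q ^ (-1 - 2 * (e : ℤ))‖ + 1) * ρ ^ n,
    (summable_geometric_of_lt_one hρ0 hρ2).mul_left _, ?_⟩
  filter_upwards [e1, e2, e3, V.isOpen.eventually_mem hq] with q' h1 h2 h3 hq' n
  have hC0 : 0 ≤ C := by simpa using (norm_nonneg _).trans (h3 0)
  have hG : 0 < ‖Complex.Gamma ((n : ℂ) + 1 / 2 - e)‖ := norm_pos_iff.2 (gamma_ne_zero n e)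
  have h4 : r q' ^ (2 * (n : ℤ) - 1 - 2 * e) = (r q' ^ 2) ^ n * r q' ^ (-1 - 2 * (e : ℤ)) := by
    rw [← pow_mul, ← zpow_natCast, ← zpow_add₀ (D.ne_zero q' hq')]
    congr 1
    push_cast
    ring
  have h5 : (n.factorial : ℝ) / ‖Complex.Gamma ((n : ℂ) + 1 / 2 - e)‖ ≤ K * 4 ^ n := by
    rw [div_le_iff₀ hG]
    refine (hΓ n).trans ?_
    have : ((2 : ℝ) ^ (e + 1)) ≤ 4 := by
      calc (2 : ℝ) ^ (e + 1) ≤ 2 ^ 2 := pow_le_pow_right₀ (by norm_num) (by omega)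
        _ = 4 := by norm_num
    gcongr
  rw [borelSummand, h4, norm_mul, norm_div, norm_mul, norm_pow]
  calc _ ≤ C * A ^ n * n.factorial / ‖Complex.Gamma ((n : ℂ) + 1 / 2 - e)‖ *
        (‖r q' ^ 2‖ ^ n * (‖r q ^ (-1 - 2 * (e : ℤ))‖ + 1)) := by
        gcongr
        exact h3 n
    _ = C * A ^ n * (n.factorial / ‖Complex.Gamma ((n : ℂ) + 1 / 2 - e)‖) *
        (‖r q' ^ 2‖ ^ n * (‖r q ^ (-1 - 2 * (e : ℤ))‖ + 1)) := by ring
    _ ≤ C * A ^ n * (K * 4 ^ n) * (‖r q' ^ 2‖ ^ n * (‖r q ^ (-1 - 2 * (e : ℤ))‖ + 1)) := by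
        gcongr
    _ = C * K * (‖r q ^ (-1 - 2 * (e : ℤ))‖ + 1) * (4 * A * ‖r q' ^ 2‖) ^ n := by
        rw [mul_pow, mul_pow]
        ring
    _ ≤ _ := by gcongr

end BorelDomain

omit D

section summand

variable (e : ℕ) (a b : PowerSeries (HoloAlg U)) (n : ℕ) {q : Fin 3 → ℂ} (hq : base q ∈ U)

include hq

theorem borelSummand_add :
    borelSummand r e (a + b) n q = borelSummand r e a n q + borelSummand r e b n q := by
  simp only [borelSummand, map_add]
  rw [ext_add _ _ hq, Pi.add_apply, add_div, add_mul]

theorem borelSummand_smul (c : ℂ) :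
    borelSummand r e (c • a) n q = c * borelSummand r e a n q := by
  simp only [borelSummand, PowerSeries.coeff_smul]
  rw [ext_smul _ _ hq, Pi.smul_apply, smul_eq_mul]
  ring

theorem borelSummand_C_mul (c : HoloAlg U) :
    borelSummand r e (PowerSeries.C c * a) n q = extn c (base q) * borelSummand r e a n q := by
  simp only [borelSummand, PowerSeries.coeff_C_mul]
  rw [ext_mul _ _ hq, Pi.mul_apply]
  ring

/-- Here X stands for η⁻¹, so X and one more factor η cancel: raising n and e together leaves each
summand unchanged, and the new zeroth term is zero. -/
theorem hasSum_borelSummand_X_mul {c : ℂ} (h : HasSum (fun n => borelSummand r e a n q) c) :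
    HasSum (fun n => borelSummand r (e + 1) (PowerSeries.X * a) n q) c := by
  rw [← hasSum_nat_add_iff' 1]
  have h0 : borelSummand r (e + 1) (PowerSeries.X * a) 0 q = 0 := by
    have : extn (0 : HoloAlg U) (base q) = 0 := by
      rw [← eval_eq_ext _ hq, map_zero]
    simp [borelSummand, this]
  have h1 : (fun n => borelSummand r (e + 1) (PowerSeries.X * a) (n + 1) q) =
      fun n => borelSummand r e a n q := by
    funext n
    rw [borelSummand, PowerSeries.coeff_succ_X_mul, borelSummand]
    have e1 : ((n + 1 : ℕ) : ℂ) + 1 / 2 - (e + 1 : ℕ) = n + 1 / 2 - e := by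
      push_cast
      ring
    have e2 : 2 * ((n + 1 : ℕ) : ℤ) - 1 - 2 * (e + 1 : ℕ) = 2 * n - 1 - 2 * e := by
      push_cast
      ring
    rw [e1, e2]
  rw [h1]
  simpa [h0] using h

end summand

/-- `f` is the Borel transform of `η^e exp (-η φ) ∑ a_n η^{-n-1/2}`. -/
def IsBorelSum (r : (Fin 3 → ℂ) → ℂ) (e : ℕ) (a : PowerSeries (HoloAlg U)) (f : Holo V) : Prop :=
  ∀ q ∈ V, HasSum (fun n => borelSummand r e a n q) (f.1 q)

variable {e : ℕ} {a b : PowerSeries (HoloAlg U)} {f g : Holo V}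

namespace IsBorelSum

/-- The bridge from formal to actual equations: a power series identity becomes the vanishing of a
holomorphic function. -/
theorem eq_zero (hf : IsBorelSum r e a f) (h : a = 0) : f = 0 := by
  subst h
  ext q
  by_cases hq : q ∈ V
  · have h0 : (fun n => borelSummand r e (0 : PowerSeries (HoloAlg U)) n q) = fun _ => 0 := by
      funext n
      have : extn (0 : HoloAlg U) (base q) = 0 := by
        by_cases h : base q ∈ U
        · rw [← eval_eq_ext _ h, map_zero]
        · exact Function.extend_apply' _ _ _ fun ⟨p, hp⟩ => h (hp ▸ p.2)
      simp [borelSummand, this]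
    have := hf q hq
    rw [h0] at this
    exact this.unique hasSum_zero
  · exact f.2.2 q hq

theorem add (hU : ∀ q ∈ V, base q ∈ U) (hf : IsBorelSum r e a f) (hg : IsBorelSum r e b g) :
    IsBorelSum r e (a + b) (f + g) := fun q hq => by
  simp only [borelSummand_add e a b _ (hU q hq)]
  exact (hf q hq).add (hg q hq)

theorem smul (hU : ∀ q ∈ V, base q ∈ U) (hf : IsBorelSum r e a f) (c : ℂ) :
    IsBorelSum r e (c • a) (c • f) := fun q hq => by
  simp only [borelSummand_smul e a _ (hU q hq)]
  exact (hf q hq).mul_left c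

theorem mulCoord (hU : ∀ q ∈ V, base q ∈ U) (hf : IsBorelSum r e a f) (i : Fin 2) :
    IsBorelSum r e (PowerSeries.C (coord U i) * a) (Holo.mulCoord V i.castSucc f) :=
  fun q hq => by
    have h : extn (coord U i) (base q) = q i.castSucc := by
      rw [coord, ext_of _ _ (hU q hq), base_castSucc]
    simp only [borelSummand_C_mul e a _ (hU q hq), h]
    exact (hf q hq).mul_left (q i.castSucc)

theorem X_mul (hU : ∀ q ∈ V, base q ∈ U) (hf : IsBorelSum r e a f) :
    IsBorelSum r (e + 1) (PowerSeries.X * a) f := fun q hq =>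
  hasSum_borelSummand_X_mul e a (hU q hq) (hf q hq)

/-- ∂_y is the Borel transform of multiplication by η: the level rises and the coefficients stay. In
the next lemma ∂_i becomes η times the twisted derivation. -/
theorem partialDeriv_y (D : BorelDomain φ α V r) (ha : Gevrey α a) (he : e ≤ 1)
    (hf : IsBorelSum r e a f) : IsBorelSum r (e + 1) a (Holo.partialDeriv V 2 f) := by
  intro q hq
  rw [Holo.partialDeriv_apply V 2 f hq]
  have h := hasSum_fderiv_apply (D.analyticOnNhd_borelSummand e a) f.2.1 hf hq
    (D.exists_summable_bound ha he hq) (Pi.single 2 1)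
  have h2 : (fun n => fderiv ℂ (borelSummand r e a n) q (Pi.single 2 1)) =
      fun n => borelSummand r (e + 1) a n q := by
    funext n
    rw [D.fderiv_borelSummand e a n hq, baseL_single_two]
    simp
  rwa [h2] at h

theorem partialDeriv (D : BorelDomain φ α V r) (ha : Gevrey α a) (he : e ≤ 1)
    (hf : IsBorelSum r e a f) (i : Fin 2) :
    IsBorelSum r (e + 1) (PowerSeries.twist (pd i) (pd i φ) a)
      (Holo.partialDeriv V i.castSucc f) := by
  intro q hq
  rw [Holo.partialDeriv_apply V _ f hq]
  have hU := D.base_mem q hq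
  have h := hasSum_fderiv_apply (D.analyticOnNhd_borelSummand e a) f.2.1 hf hq
    (D.exists_summable_bound ha he hq) (Pi.single i.castSucc 1)
  have hi : (Pi.single i.castSucc 1 : Fin 3 → ℂ) 2 = 0 := by
    fin_cases i <;> simp
  have h2 : (fun n => fderiv ℂ (borelSummand r e a n) q (Pi.single i.castSucc 1)) =
      fun n => borelSummand r e (PowerSeries.mapDerivation (pd i) a) n q +
        extn (pd i φ) (base q) * borelSummand r (e + 1) a n q := by
    funext n
    rw [D.fderiv_borelSummand e a n hq, baseL_single_castSucc, ext_pd i φ hU, hi, zero_add]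
    simp only [borelSummand, PowerSeries.coeff_mapDerivation]
    rw [ext_pd i _ hU]
  rw [h2] at h
  -- The two parts of the derivative have different levels. The part of level e + 1 sums by
  -- `partialDeriv_y`; subtracting it isolates the other part, which a factor X then lifts to level
  -- e + 1.
  have h3 := (partialDeriv_y D ha he hf q hq).mul_left (extn (pd i φ) (base q))
  have h4 := h.sub h3
  simp only [add_sub_cancel_right] at h4
  have h5 := (hasSum_borelSummand_X_mul e _ hU h4).add h3
  rw [sub_add_cancel] at h5
  have h6 : (fun n => borelSummand r (e + 1) (PowerSeries.twist (pd i) (pd i φ) a) n q) =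
      fun n => borelSummand r (e + 1) (PowerSeries.X * PowerSeries.mapDerivation (pd i) a) n q +
        extn (pd i φ) (base q) * borelSummand r (e + 1) a n q := by
    funext n
    rw [PowerSeries.twist, borelSummand_add _ _ _ _ hU, borelSummand_C_mul _ _ _ hU, add_comm]
  rw [h6]
  exact h5

end IsBorelSum

end Borel

end Pearcey

/-! ### The Borel sum is a solution -/

namespace Pearcey

open HoloAlg

section Solution

theorem four_mul_algebraMap_quarter {R : Type*} [CommRing R] [Algebra ℂ R] :
    4 * algebraMap ℂ R (1 / 4) = 1 := by
  rw [← map_ofNat (algebraMap ℂ R) 4, ← map_mul]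
  norm_num

theorem ofNat_end_apply {M : Type*} [AddCommGroup M] [Module ℂ M] (n : ℕ) [n.AtLeastTwo] (m : M) :
    (ofNat(n) : Module.End ℂ M) m = (ofNat(n) : ℂ) • m := by
  rw [Module.End.ofNat_apply, ← Nat.cast_smul_eq_nsmul ℂ]
  rfl

theorem act_x {n : ℕ} (V : TopologicalSpace.Opens (Fin n → ℂ)) (i : Fin n) :
    Holo.act V (WeylAlgebra.x i) = Holo.mulCoord V i := WeylAlgebra.lift_x _ _ _ _ _ i

theorem act_d {n : ℕ} (V : TopologicalSpace.Opens (Fin n → ℂ)) (i : Fin n) :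
    Holo.act V (WeylAlgebra.d i) = Holo.partialDeriv V i := WeylAlgebra.lift_d _ _ _ _ _ i

variable {U : TopologicalSpace.Opens (Fin 2 → ℂ)} {s w v h φ : HoloAlg U}
  (H : CubicRoot (pd 0) (pd 1) (coord U 0) (coord U 1) s w v h)
  (hφ : 4 * φ = 3 * coord U 0 * s + 2 * coord U 1 * s ^ 2)

include H hφ

/-- φ is the critical value of F, so its x₁-derivative is ∂F/∂x₁ = t at t = s. In the computation
the cubic gives 3x₁ + 4x₂s = -2sw, which ∂₁s = -1/(2w) turns into s. -/
theorem pd_zero_phase : pd 0 φ = s := by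
  have h1 := congrArg (pd 0) hφ
  have hx := H.cubic
  have hw := H.hw
  have hv := H.hwv
  have h2 := two_mul_algebraMap_half (R := HoloAlg U)
  have h4 : (4 : HoloAlg U) * (pd 0 φ - s) = 0 := by
    simp only [map_add, Derivation.leibniz, Derivation.leibniz_pow, CubicRoot.derivation_ofNat,
      smul_eq_mul, nsmul_eq_mul, mul_zero, Nat.reduceSub, Nat.cast_ofNat, H.d₁x₁, H.d₁x₂, H.d₁s]
      at h1
    subst hw
    linear_combination h1 - 3 * (algebraMap ℂ (HoloAlg U) (1 / 2)) * v * hx +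
      s * hv * 2 * (algebraMap ℂ (HoloAlg U) (1 / 2)) + s * h2
  linear_combination algebraMap ℂ (HoloAlg U) (1 / 4) * h4 -
    (pd 0 φ - s) * four_mul_algebraMap_quarter (R := HoloAlg U)

theorem pd_one_phase : pd 1 φ = s ^ 2 := by
  have h1 := congrArg (pd 1) hφ
  have hx := H.cubic
  have hw := H.hw
  have hv := H.hwv
  have h4 : (4 : HoloAlg U) * (pd 1 φ - s ^ 2) = 0 := by
    simp only [map_add, Derivation.leibniz, Derivation.leibniz_pow, CubicRoot.derivation_ofNat,
      smul_eq_mul, nsmul_eq_mul, mul_zero, Nat.reduceSub, Nat.cast_ofNat, H.d₂x₁, H.d₂x₂, H.d₂s]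
      at h1
    subst hw
    linear_combination h1 - 3 * v * s * hx + 2 * s ^ 2 * hv
  linear_combination algebraMap ℂ (HoloAlg U) (1 / 4) * h4 -
    (pd 1 φ - s ^ 2) * four_mul_algebraMap_quarter (R := HoloAlg U)

variable {α : (Fin 2 → ℂ) → ℝ} {V : TopologicalSpace.Opens (Fin 3 → ℂ)} {r : (Fin 3 → ℂ) → ℂ}
  (D : BorelDomain φ α V r) (hG : Gevrey α (moment s v h 0)) {f : Holo V}
  (hf : IsBorelSum r 0 (moment s v h 0) f)

include D hG hf

theorem isBorelSum_partialDeriv_zero :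
    IsBorelSum r 1 (PowerSeries.twist (pd 0) s (moment s v h 0)) (Holo.partialDeriv V 0 f) := by
  have := hf.partialDeriv D hG zero_le_one 0
  rw [pd_zero_phase H hφ] at this
  exact this

theorem isBorelSum_partialDeriv_one :
    IsBorelSum r 1 (PowerSeries.twist (pd 1) (s ^ 2) (moment s v h 0))
      (Holo.partialDeriv V 1 f) := by
  have := hf.partialDeriv D hG zero_le_one 1
  rw [pd_one_phase H hφ] at this
  exact this

/-- Multiplication by y does not preserve the form of a Borel sum, so y is split as (y + φ) - φ. The
operator 4(y + φ)∂_y + 3 multiplies the n-th summand by 4(n - 1/2) + 3 = 4n + 1, the factor in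
`equation_euler`; the series X A is then summed in two ways. -/
theorem act_opB_three_apply {q : Fin 3 → ℂ} (hq : q ∈ V) :
    3 * q 0 * (Holo.partialDeriv V 0 f).1 q + 2 * q 1 * (Holo.partialDeriv V 1 f).1 q +
      4 * q 2 * (Holo.partialDeriv V 2 f).1 q + 3 * f.1 q = 0 := by
  have hU := D.base_mem q hq
  have h0 := isBorelSum_partialDeriv_zero H hφ D hG hf q hq
  have h1 := isBorelSum_partialDeriv_one H hφ D hG hf q hq
  have h2 := hf.partialDeriv_y D hG zero_le_one q hq
  have hx0 : extn (coord U 0) (base q) = q 0 := by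
    rw [coord, ext_of _ _ hU]
    rfl
  have hx1 : extn (coord U 1) (base q) = q 1 := by
    rw [coord, ext_of _ _ hU]
    rfl
  set M := moment s v h 0 with hM
  set T₁ := PowerSeries.twist (pd 0) s M with hT₁
  set T₂ := PowerSeries.twist (pd 1) (s ^ 2) M with hT₂
  set A : PowerSeries (HoloAlg U) :=
    PowerSeries.mk fun n => -(4 * (n : HoloAlg U) + 1) * PowerSeries.coeff n M with hA
  have key : PowerSeries.C (3 * coord U 0) * T₁ + PowerSeries.C (2 * coord U 1) * T₂ +
      PowerSeries.C (-(4 * φ)) * M = PowerSeries.X * A := by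
    ext n
    rcases n with _ | n
    · simp only [map_add, PowerSeries.coeff_C_mul, PowerSeries.coeff_zero_X_mul, hT₁, hT₂,
        PowerSeries.twist]
      linear_combination -hφ * PowerSeries.coeff 0 M
    · rw [PowerSeries.coeff_succ_X_mul, hA, PowerSeries.coeff_mk, map_add, map_add,
        PowerSeries.coeff_C_mul, PowerSeries.coeff_C_mul, PowerSeries.coeff_C_mul]
      linear_combination H.equation_euler n - hφ * PowerSeries.coeff (n + 1) M
  have e1 : HasSum (fun n => borelSummand r 1 (PowerSeries.X * A) n q)
      (3 * q 0 * (Holo.partialDeriv V 0 f).1 q + 2 * q 1 * (Holo.partialDeriv V 1 f).1 q -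
        4 * extn φ (base q) * (Holo.partialDeriv V 2 f).1 q) := by
    have := ((h0.mul_left (3 * q 0)).add (h1.mul_left (2 * q 1))).add
      (h2.mul_left (-(4 * extn φ (base q))))
    rw [← key]
    simp only [borelSummand_add _ _ _ _ hU, borelSummand_C_mul _ _ _ hU]
    have c0 : extn (3 * coord U 0) (base q) = 3 * q 0 := by
      rw [← hx0, ← eval_eq_ext _ hU, ← eval_eq_ext _ hU, map_mul, map_ofNat]
    have c1 : extn (2 * coord U 1) (base q) = 2 * q 1 := by
      rw [← hx1, ← eval_eq_ext _ hU, ← eval_eq_ext _ hU, map_mul, map_ofNat]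
    have c2 : extn (-(4 * φ)) (base q) = -(4 * extn φ (base q)) := by
      rw [← eval_eq_ext _ hU, ← eval_eq_ext _ hU, map_neg, map_mul, map_ofNat]
    rw [c0, c1, c2, sub_eq_add_neg, ← neg_mul (4 * extn φ (base q))]
    exact this
  have e2 : HasSum (fun n => borelSummand r 1 (PowerSeries.X * A) n q)
      (-(4 * (q 2 + extn φ (base q)) * (Holo.partialDeriv V 2 f).1 q + 3 * f.1 q)) := by
    refine hasSum_borelSummand_X_mul 0 A hU ?_
    have := ((h2.mul_left (4 * (q 2 + extn φ (base q)))).add ((hf q hq).mul_left 3)).neg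
    refine (congrArg (fun g => HasSum g _) (funext fun n => ?_)).mpr this
    have hr := D.ne_zero q hq
    have h6 := gamma_ne_zero n 1
    have h7 := natCast_sub_half_ne_zero n 1
    rw [← D.sq_eq q hq]
    simp only [borelSummand]
    rw [gamma_sub_succ n 0, hA, PowerSeries.coeff_mk]
    have e1 : 2 * (n : ℤ) - 1 - 2 * (0 : ℕ) = 2 * (n : ℤ) - 1 - 2 * ((0 + 1 : ℕ) : ℤ) + 2 := by
      push_cast
      ring
    have e3 : extn (-(4 * (n : HoloAlg U) + 1) * PowerSeries.coeff n M) (base q) =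
        -(4 * n + 1) * extn (PowerSeries.coeff n M) (base q) := by
      rw [← eval_eq_ext _ hU, ← eval_eq_ext _ hU]
      simp only [map_mul, map_neg, map_add, map_ofNat, map_natCast, map_one]
    rw [e1, zpow_add₀ hr, e3]
    simp only [zero_add, Nat.cast_one] at h6 h7 ⊢
    have e4 : (4 * (n : ℂ) + 1) = 4 * ((n : ℂ) + 1 / 2 - 1) + 3 := by ring
    rw [e4]
    generalize (n : ℂ) + 1 / 2 - 1 = c at h6 h7 ⊢
    generalize Complex.Gamma c = G at h6 ⊢
    generalize r q ^ (2 * (n : ℤ) - 1 - 2 * 1) = R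
    rw [zpow_ofNat]
    field_simp
  linear_combination e1.unique e2

theorem act_opB_eq_zero (k : Fin 4) : Holo.act V (opB k) f = 0 := by
  have hU := D.base_mem
  have h0 := isBorelSum_partialDeriv_zero H hφ D hG hf
  have h1 := isBorelSum_partialDeriv_one H hφ D hG hf
  have h2 := hf.partialDeriv_y D hG zero_le_one
  have hG0 := hG.twist D.nonneg 0 s
  have hG1 := hG.twist D.nonneg 1 (s ^ 2)
  have h20 := h0.partialDeriv_y D hG0 le_rfl
  have h21 := h1.partialDeriv_y D hG1 le_rfl
  have h22 := h2.partialDeriv_y D hG le_rfl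
  have h00 := h0.partialDeriv D hG0 le_rfl 0
  have h01 := h1.partialDeriv D hG1 le_rfl 0
  have h11 := h1.partialDeriv D hG1 le_rfl 1
  rw [pd_zero_phase H hφ] at h00 h01
  rw [pd_one_phase H hφ] at h11
  fin_cases k
  -- All terms are brought to level 2, where the coefficient series is the left side of the formal
  -- equation.
  · have := (((h01.smul hU 4).add hU ((h20.mulCoord hU 1).smul hU 2)).add hU
      (h22.mulCoord hU 0)).eq_zero (by
        rw [← H.equation_d₁_d₂]
        simp only [Algebra.smul_def, map_ofNat]
        ring)
    simp only [opB_eq, Fin.zero_eta, Matrix.cons_val, map_add, map_mul, map_ofNat, act_x, act_d,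
      pow_two, LinearMap.add_apply, Module.End.mul_apply, ofNat_end_apply]
    exact this
  -- The first-order term ∂_y has level 1; a factor X lifts it to level 2 and yields the last term
  -- of `equation_d₂_d₂`.
  · have := (((((h11.smul hU 4).add hU (h20.mulCoord hU 0)).add hU
      ((h21.mulCoord hU 1).smul hU 2)).add hU (h2.X_mul hU))).eq_zero (by
        rw [← H.equation_d₂_d₂]
        simp only [Algebra.smul_def, map_ofNat]
        ring)
    simp only [opB_eq, Fin.mk_one, Matrix.cons_val, map_add, map_mul, map_ofNat, act_x, act_d,
      pow_two, LinearMap.add_apply, Module.End.mul_apply, ofNat_end_apply]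
    exact this
  · have := (h21.add hU (h00.smul hU (-1))).eq_zero (by
        rw [H.twist₁_twist₁, neg_one_smul, add_neg_cancel])
    simp only [opB_eq, Fin.reduceFinMk, Matrix.cons_val, map_sub, map_mul, act_d, pow_two]
    rw [LinearMap.sub_apply, sub_eq_add_neg, ← neg_one_smul ℂ]
    exact this
  · simp only [opB_eq, Fin.reduceFinMk, Matrix.cons_val, map_add, map_mul, map_ofNat, act_x, act_d]
    ext q
    by_cases hq : q ∈ V
    · have := act_opB_three_apply H hφ D hG hf hq
      simp only [LinearMap.add_apply, Module.End.mul_apply, ofNat_end_apply]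
      refine Eq.trans ?_ this
      simp only [mul_assoc]
      rfl
    · exact (Submodule.coe_mem _ : _ ∈ Holo V).2 q hq

theorem isHoloSolution_of_isBorelSum : IsHoloSolution idealB f := by
  intro P hP
  induction hP using Submodule.span_induction with
  | mem P hP =>
    obtain ⟨k, rfl⟩ := hP
    exact act_opB_eq_zero H hφ D hG hf k
  | zero => simp
  | add P Q _ _ hP hQ => rw [map_add, LinearMap.add_apply, hP, hQ, add_zero]
  | smul Q P _ hP => rw [smul_eq_mul, map_mul, Module.End.mul_apply, hP, map_zero]

end Solution

end Pearcey

/-! ### Convergence of the Borel transform near the graph -/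

namespace Pearcey

open HoloAlg

section Existence

variable {U : TopologicalSpace.Opens (Fin 2 → ℂ)} {s w v h φ : HoloAlg U}

/-- The growth of the coefficients of the formal Gaussian integral. -/
noncomputable def growth (s v : HoloAlg U) (p : Fin 2 → ℂ) : ℝ :=
  2048 * (‖extn (s ^ 2 * v ^ 3) p‖ + ‖extn (v ^ 2) p‖)

theorem growth_nonneg (s v : HoloAlg U) (p : Fin 2 → ℂ) : 0 ≤ growth s v p := by
  unfold growth
  positivity

theorem extn_coeff_moment (s v h : HoloAlg U) (n : ℕ) {p : Fin 2 → ℂ} (hp : p ∈ U) :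
    extn (PowerSeries.coeff n (moment s v h 0)) p =
      extn h p * ∑ a ∈ Finset.HasAntidiagonal.antidiagonal n, saddleCoeff a.1 a.2 *
        extn (s ^ 2 * v ^ 3) p ^ a.1 * extn (v ^ 2) p ^ a.2 := by
  rw [coeff_moment, sum_momentTerm_eq, ← eval_eq_ext _ hp, ← eval_eq_ext _ hp, ← eval_eq_ext _ hp,
    ← eval_eq_ext _ hp, map_mul, map_sum]
  congr 1

theorem continuousAt_growth (s v : HoloAlg U) {p : Fin 2 → ℂ} (hp : p ∈ U) :
    ContinuousAt (growth s v) p :=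
  continuousAt_const.mul ((analyticOnNhd_extn _ p hp).continuousAt.norm.add
    (analyticOnNhd_extn _ p hp).continuousAt.norm)

theorem gevrey_moment (s v h : HoloAlg U) : Gevrey (growth s v) (moment s v h 0) := by
  intro p hp A hA
  refine ⟨‖extn h p‖ + 1, ?_⟩
  have e1 : ∀ᶠ p' in nhds p, growth s v p' < A :=
    (continuousAt_growth s v hp).eventually_lt continuousAt_const hA
  have e2 : ∀ᶠ p' in nhds p, ‖extn h p'‖ < ‖extn h p‖ + 1 :=
    (analyticOnNhd_extn h p hp).continuousAt.norm.eventually_lt continuousAt_const (by simp)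
  filter_upwards [e1, e2, U.isOpen.eventually_mem hp] with p' h1 h2 h3 n
  rw [extn_coeff_moment s v h n h3, norm_mul, mul_assoc]
  refine mul_le_mul h2.le ?_ (norm_nonneg _) (by positivity)
  refine (norm_sum_saddleCoeff_le (extn (s ^ 2 * v ^ 3) p', extn (v ^ 2) p') n).trans ?_
  have := growth_nonneg s v p'
  unfold growth at this h1
  gcongr

variable {V : TopologicalSpace.Opens (Fin 3 → ℂ)} {r : (Fin 3 → ℂ) → ℂ}
  (D : BorelDomain φ (growth s v) V r)

include D

/-- By `extn_coeff_moment` the sum is h/r times a two-variable power series evaluated at (s²v³r²,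
v²r²). Division by Γ(l + k + 1/2) leaves coefficients bounded by a constant times 2048^(l+k), and
the domain keeps the point within the radius of convergence. -/
theorem analyticOnNhd_tsum_borelSummand (h : HoloAlg U) :
    AnalyticOnNhd ℂ (fun q => ∑' n, borelSummand r 0 (moment s v h 0) n q) V := by
  intro q hq
  obtain ⟨C, hC, hΓ⟩ := exists_factorial_le_gamma 0
  set c : ℕ → ℕ → ℂ := fun l k =>
    saddleCoeff l k / Complex.Gamma (((l + k : ℕ) : ℂ) + 1 / 2 - (0 : ℕ)) with hc
  have hcb : ∀ l k, ‖c l k‖ ≤ C * 2048 ^ (l + k) := by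
    intro l k
    have hG : 0 < ‖Complex.Gamma (((l + k : ℕ) : ℂ) + 1 / 2 - (0 : ℕ))‖ :=
      norm_pos_iff.2 (gamma_ne_zero _ _)
    rw [hc, norm_div, div_le_iff₀ hG]
    calc _ ≤ 1024 ^ (l + k) * ((l + k).factorial : ℝ) := norm_saddleCoeff_le l k
      _ ≤ 1024 ^ (l + k) * (C * (2 ^ (0 + 1)) ^ (l + k) * _) := by
        gcongr
        exact hΓ (l + k)
      _ = _ := by
        rw [show (2048 : ℝ) = 1024 * 2 by norm_num, mul_pow]
        ring
  have hU := D.base_mem q hq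
  have ha := analyticAt_extn_base (s ^ 2 * v ^ 3) hU
  have hb := analyticAt_extn_base (v ^ 2) hU
  have hr := D.analytic q hq
  have hr0 := D.ne_zero q hq
  have hz : 2 * 2048 * ‖(extn (s ^ 2 * v ^ 3) (base q) * r q ^ 2,
      extn (v ^ 2) (base q) * r q ^ 2)‖ < 1 := by
    have h1 := D.lt_one q hq
    unfold growth at h1
    rw [Prod.norm_mk, norm_mul, norm_mul, ← max_mul_of_nonneg _ _ (norm_nonneg (r q ^ 2))]
    have h2 : max ‖extn (s ^ 2 * v ^ 3) (base q)‖ ‖extn (v ^ 2) (base q)‖ * ‖r q ^ 2‖ ≤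
        (‖extn (s ^ 2 * v ^ 3) (base q)‖ + ‖extn (v ^ 2) (base q)‖) * ‖r q ^ 2‖ := by
      gcongr
      exact max_le_add_of_nonneg (norm_nonneg _) (norm_nonneg _)
    have h3 : 0 ≤ (‖extn (s ^ 2 * v ^ 3) (base q)‖ + ‖extn (v ^ 2) (base q)‖) * ‖r q ^ 2‖ := by
      positivity
    linarith
  have h1 := (analyticAt_tsum_antidiagonal (by norm_num) hcb hz).comp_of_eq
    ((ha.mul (hr.pow 2)).prod (hb.mul (hr.pow 2))) rfl
  have h2 := ((analyticAt_extn_base h hU).mul h1).div hr hr0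
  refine h2.congr ?_
  filter_upwards [V.isOpen.eventually_mem hq] with q' hq'
  have hU' := D.base_mem q' hq'
  have hr' := D.ne_zero q' hq'
  simp only [Pi.mul_apply, Pi.div_apply, Function.comp_apply, Pi.pow_apply]
  rw [mul_div_right_comm, ← tsum_mul_left]
  refine tsum_congr fun n => ?_
  rw [borelSummand, extn_coeff_moment s v h n hU', Finset.mul_sum, Finset.mul_sum, Finset.sum_div,
    Finset.sum_mul]
  refine Finset.sum_congr rfl fun a ha => ?_
  rw [Finset.HasAntidiagonal.mem_antidiagonal] at ha
  simp only [hc]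
  rw [ha]
  have h3 : r q' ^ (2 * (n : ℤ) - 1 - 2 * (0 : ℕ)) = (r q' ^ 2) ^ a.1 * (r q' ^ 2) ^ a.2 / r q' := by
    rw [← pow_add, ha, ← pow_mul, eq_div_iff hr', ← zpow_add_one₀ hr', ← zpow_natCast]
    congr 1
    push_cast
    ring
  rw [h3, mul_pow, mul_pow]
  ring

theorem exists_isBorelSum (h : HoloAlg U) : ∃ f : Holo V, IsBorelSum r 0 (moment s v h 0) f := by
  classical
  refine ⟨⟨fun q => if q ∈ V then ∑' n, borelSummand r 0 (moment s v h 0) n q else 0, ?_, ?_⟩, ?_⟩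
  · intro q hq
    refine (analyticOnNhd_tsum_borelSummand D h q hq).congr ?_
    filter_upwards [V.isOpen.eventually_mem hq] with q' hq'
    exact (if_pos hq').symm
  · intro q hq
    exact if_neg hq
  · intro q hq
    obtain ⟨u, hu, hb⟩ := D.exists_summable_bound (gevrey_moment s v h) zero_le_one hq
    have := (Summable.of_norm_bounded hu hb.self_of_nhds).hasSum
    simp only [if_pos hq]
    exact this

end Existence

section Domain

variable {U : TopologicalSpace.Opens (Fin 2 → ℂ)}

/-- The neighbourhood of the graph `y = -φ` on which the Borel transform converges. -/
def convergenceDomain (s v φ : HoloAlg U) : Set (Fin 3 → ℂ) :=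
  {q | base q ∈ U ∧ 4 * growth s v (base q) * ‖q 2 + extn φ (base q)‖ < 1}

theorem isOpen_convergenceDomain (s v φ : HoloAlg U) : IsOpen (convergenceDomain s v φ) := by
  rw [isOpen_iff_eventually]
  rintro q ⟨hU, hq⟩
  have hbase : ContinuousAt base q := by
    have : base = baseL := funext fun q => (baseL_apply q).symm
    rw [this]
    exact baseL.continuous.continuousAt
  have h1 : ContinuousAt (fun q => 4 * growth s v (base q) * ‖q 2 + extn φ (base q)‖) q :=
    (continuousAt_const.mul ((continuousAt_growth s v hU).comp hbase)).mul
      ((continuous_apply 2).continuousAt.add (analyticAt_extn_base φ hU).continuousAt).norm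
  filter_upwards [hbase.eventually (U.isOpen.eventually_mem hU),
    h1.eventually_lt continuousAt_const hq] with q' h2 h3 using ⟨h2, h3⟩

end Domain

theorem exists_borel_solution (U : Set (Fin 2 → ℂ)) (s h : (Fin 2 → ℂ) → ℂ) (hUo : IsOpen U)
    (hs : AnalyticOnNhd ℂ s U) (hh : AnalyticOnNhd ℂ h U)
    (hcub : ∀ p ∈ U, 4 * s p ^ 3 + 2 * p 1 * s p + p 0 = 0)
    (hw : ∀ p ∈ U, h p ^ 2 * Pearcey.w s p = 1) :
    ∃ N : Set (Fin 3 → ℂ), IsOpen N ∧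
      (∀ q ∈ N, Pearcey.base q ∈ U) ∧
      (∀ p ∈ U, ![p 0, p 1, -Pearcey.phase s p] ∈ N) ∧
      ∀ (V : TopologicalSpace.Opens (Fin 3 → ℂ)) (r : (Fin 3 → ℂ) → ℂ),
        (V : Set (Fin 3 → ℂ)) ⊆ N → AnalyticOnNhd ℂ r V →
        (∀ q ∈ V, r q ≠ 0 ∧ r q ^ 2 = q 2 + Pearcey.phase s (Pearcey.base q)) →
        ∃ u : Holo V,
          (∀ q ∈ V, HasSum (fun n : ℕ => Pearcey.borelTerm s h r n q) (u.1 q)) ∧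
          IsHoloSolution Pearcey.idealB u := by
  let U' : TopologicalSpace.Opens (Fin 2 → ℂ) := ⟨U, hUo⟩
  obtain ⟨s', w', v', h', H, es, ew, ev, eh⟩ := exists_cubicRoot (U := U') hs hh hcub hw
  obtain ⟨S, hS, hS0, hc⟩ := H.exists_logDerivative
  set φ : HoloAlg U' := algebraMap ℂ _ (1 / 4) *
    (3 * coord U' 0 * s' + 2 * coord U' 1 * s' ^ 2) with hφdef
  have hφ : 4 * φ = 3 * coord U' 0 * s' + 2 * coord U' 1 * s' ^ 2 := by
    rw [hφdef]
    linear_combination (3 * coord U' 0 * s' + 2 * coord U' 1 * s' ^ 2) *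
      four_mul_algebraMap_quarter (R := HoloAlg U')
  have eφ : ∀ p ∈ U, phase s p = extn φ p := by
    intro p hp
    have hp' : p ∈ U' := hp
    rw [phase, coefS, coefT, hφdef, ← eval_eq_ext _ hp']
    simp only [map_add, map_mul, map_pow, map_ofNat, coord, eval_of, AlgHom.commutes]
    rw [eval_eq_ext s' hp', es p hp']
    rfl
  refine ⟨convergenceDomain s' v' φ, isOpen_convergenceDomain s' v' φ, fun q hq => hq.1, ?_, ?_⟩
  · intro p hp
    have hb : base ![p 0, p 1, -phase s p] = p := by
      funext i
      fin_cases i <;> rfl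
    refine ⟨by rw [hb]; exact hp, ?_⟩
    rw [hb, ← eφ p hp]
    simp
  · intro V r hV hr hr2
    have D : BorelDomain φ (growth s' v') V r := by
      refine ⟨fun q hq => (hV hq).1, hr, fun q hq => (hr2 q hq).1, fun q hq => ?_,
        growth_nonneg s' v', fun q hq => ?_⟩
      · rw [(hr2 q hq).2, eφ _ (hV hq).1]
      · rw [(hr2 q hq).2, eφ _ (hV hq).1]
        exact (hV hq).2
    obtain ⟨u, hu⟩ := exists_isBorelSum D h'
    refine ⟨u, fun q hq => ?_, isHoloSolution_of_isBorelSum H hφ D (gevrey_moment s' v' h') hu⟩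
    have hq' : base q ∈ U' := (hV hq).1
    have e : (fun n : ℕ => borelTerm s h r n q) =
        fun n => borelSummand r 0 (moment s' v' h' 0) n q := by
      funext n
      rw [borelTerm, borelSummand, wkbCoeff_eq_extn H hS hS0 hc es ew ev eh n _ hq']
      simp
    rw [e]
    exact hu q hq

end Pearcey

/-! ### An explicit solution: the density 1/F'(t) in the variables (x₁, x₂, t) -/

namespace Pearcey

open HoloAlg

section QuarticPhase

variable {R : Type*} [CommRing R] [Algebra ℂ R]

/-- Coordinates `c = (x₁, x₂, t)` and the inverse `g` of the derivative in `t` of the phase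
`t⁴ + x₂ t² + x₁ t`, in a ring with derivations `∂/∂x₁`, `∂/∂x₂`, `∂/∂t`. -/
structure QuarticPhase (δ : Fin 3 → Derivation ℂ R R) (c : Fin 3 → R) (g : R) : Prop where
  comm : ∀ i j f, δ i (δ j f) = δ j (δ i f)
  coord : ∀ i j, δ i (c j) = if i = j then 1 else 0
  inv : (4 * c 2 ^ 3 + 2 * c 1 * c 2 + c 0) * g = 1

/-- The functions `x₁`, `x₂` and `y = -(t⁴ + x₂ t² + x₁ t)`. -/
def phaseCoord (c : Fin 3 → R) : Fin 3 → R :=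
  ![c 0, c 1, -(c 2 ^ 4 + c 1 * c 2 ^ 2 + c 0 * c 2)]

/-- The derivations dual to `phaseCoord`. -/
noncomputable def phaseDerivation (δ : Fin 3 → Derivation ℂ R R) (c : Fin 3 → R) (g : R) :
    Fin 3 → Derivation ℂ R R :=
  ![δ 0 - (c 2 * g) • δ 2, δ 1 - (c 2 ^ 2 * g) • δ 2, -(g • δ 2)]

variable {δ : Fin 3 → Derivation ℂ R R} {c : Fin 3 → R} {g : R} (H : QuarticPhase δ c g)

include H

namespace QuarticPhase

theorem derivation_g (i : Fin 3) : δ i g =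
    -g ^ 2 * ![1, 2 * c 2, 12 * c 2 ^ 2 + 2 * c 1] i := by
  have h1 := congrArg (δ i) H.inv
  simp only [map_add, Derivation.leibniz, Derivation.leibniz_pow, CubicRoot.derivation_ofNat,
    smul_eq_mul, nsmul_eq_mul, mul_zero, Nat.reduceSub, Nat.cast_ofNat, H.coord,
    Derivation.map_one_eq_zero] at h1
  fin_cases i
  · simp at h1 ⊢
    linear_combination g * h1 - δ 0 g * H.inv
  · simp at h1 ⊢
    linear_combination g * h1 - δ 1 g * H.inv
  · simp at h1 ⊢
    linear_combination g * h1 - δ 2 g * H.inv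

theorem phaseDerivation_comm (i j : Fin 3) (f : R) :
    phaseDerivation δ c g i (phaseDerivation δ c g j f) =
      phaseDerivation δ c g j (phaseDerivation δ c g i f) := by
  have e01 := H.comm 1 0 f
  have e02 := H.comm 2 0 f
  have e12 := H.comm 2 1 f
  fin_cases i <;> fin_cases j <;>
  · simp [phaseDerivation, H.derivation_g, H.coord, e01, e02, e12]
    try ring

theorem phaseDerivation_phaseCoord (i j : Fin 3) :
    phaseDerivation δ c g i (phaseCoord c j) = if i = j then 1 else 0 := by
  have h := H.inv
  fin_cases i <;> fin_cases j <;> simp [phaseDerivation, phaseCoord, H.coord]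
  · linear_combination c 2 * h
  · linear_combination c 2 ^ 2 * h
  · linear_combination h

theorem phaseDerivation_zero_g : phaseDerivation δ c g 0 g =
    -g ^ 2 + c 2 * (12 * c 2 ^ 2 + 2 * c 1) * g ^ 3 := by
  simp [phaseDerivation, H.derivation_g]
  ring

theorem phaseDerivation_one_g : phaseDerivation δ c g 1 g =
    -2 * c 2 * g ^ 2 + c 2 ^ 2 * (12 * c 2 ^ 2 + 2 * c 1) * g ^ 3 := by
  simp [phaseDerivation, H.derivation_g]
  ring

theorem phaseDerivation_two_g : phaseDerivation δ c g 2 g =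
    (12 * c 2 ^ 2 + 2 * c 1) * g ^ 3 := by
  simp [phaseDerivation, H.derivation_g]
  ring

/-- The action of the Weyl algebra by `phaseCoord` and `phaseDerivation`. -/
noncomputable def rep : WeylAlgebra 3 →ₐ[ℂ] Module.End ℂ R :=
  WeylAlgebra.lift (fun i => Algebra.lmul ℂ R (phaseCoord c i))
    (fun i => (phaseDerivation δ c g i).toLinearMap)
    (fun i j => by rw [← map_mul, mul_comm, map_mul])
    (fun i j => by
      ext f
      exact H.phaseDerivation_comm i j f)
    (fun i j => by
      ext f
      have h := H.phaseDerivation_phaseCoord i j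
      simp only [Module.End.mul_apply, LinearMap.add_apply]
      change phaseDerivation δ c g i (phaseCoord c j * f) =
        phaseCoord c j * phaseDerivation δ c g i f + _
      rw [Derivation.leibniz, h, smul_eq_mul, smul_eq_mul]
      split_ifs <;> simp)

theorem rep_x (i : Fin 3) (f : R) : H.rep (WeylAlgebra.x i) f = phaseCoord c i * f := by
  rw [rep, WeylAlgebra.lift_x]
  rfl

theorem rep_d (i : Fin 3) (f : R) : H.rep (WeylAlgebra.d i) f = phaseDerivation δ c g i f := by
  rw [rep, WeylAlgebra.lift_d]
  rfl

/-- With y = -F(t), the element g = 1/F' is -dt/dy, up to sign the density of the Pearcey integral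
as a Laplace integral in y. Using t instead of y as coordinate makes g rational, and each equation
reduces to a multiple of F' g = 1. -/
theorem rep_opB (k : Fin 4) : H.rep (opB k) g = 0 := by
  have h := H.inv
  fin_cases k
  · simp only [opB_eq, Fin.zero_eta, Matrix.cons_val, map_add, map_mul, map_ofNat,
      pow_two, LinearMap.add_apply, Module.End.mul_apply, ofNat_end_apply, H.rep_x, H.rep_d,
      H.phaseDerivation_one_g, H.phaseDerivation_zero_g, H.phaseDerivation_two_g]
    simp [phaseDerivation, phaseCoord, H.derivation_g, H.coord, Algebra.smul_def,
      CubicRoot.derivation_ofNat, map_ofNat (algebraMap ℂ R)]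
    linear_combination (3 * (12 * c 2 ^ 2 + 2 * c 1) ^ 2 * g ^ 4 - 24 * c 2 * g ^ 3) * h
  · simp only [opB_eq, Fin.mk_one, Matrix.cons_val, map_add, map_mul, map_ofNat,
      pow_two, LinearMap.add_apply, Module.End.mul_apply, ofNat_end_apply, H.rep_x, H.rep_d,
      H.phaseDerivation_one_g, H.phaseDerivation_zero_g, H.phaseDerivation_two_g]
    simp [phaseDerivation, phaseCoord, H.derivation_g, H.coord, Algebra.smul_def,
      CubicRoot.derivation_ofNat, map_ofNat (algebraMap ℂ R)]
    linear_combination -(3 * (12 * c 2 ^ 2 + 2 * c 1) * g ^ 3 + 24 * c 2 ^ 2 * g ^ 3 -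
      3 * c 2 * (12 * c 2 ^ 2 + 2 * c 1) ^ 2 * g ^ 4) * h
  · simp only [opB_eq, Fin.reduceFinMk, Matrix.cons_val, map_sub, map_mul,
      pow_two, LinearMap.sub_apply, Module.End.mul_apply, H.rep_d,
      H.phaseDerivation_one_g, H.phaseDerivation_zero_g]
    simp [phaseDerivation, H.derivation_g, H.coord, CubicRoot.derivation_ofNat]
    ring
  · simp only [opB_eq, Fin.reduceFinMk, Matrix.cons_val, map_add, map_mul, map_ofNat,
      pow_two, LinearMap.add_apply, Module.End.mul_apply, ofNat_end_apply, H.rep_x, H.rep_d,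
      H.phaseDerivation_one_g, H.phaseDerivation_zero_g, H.phaseDerivation_two_g]
    simp [phaseCoord, Algebra.smul_def, map_ofNat (algebraMap ℂ R)]
    linear_combination (-3 * g - c 2 * (12 * c 2 ^ 2 + 2 * c 1) * g ^ 2) * h

theorem rep_eq_zero {P : WeylAlgebra 3} (hP : P ∈ idealB) : H.rep P g = 0 := by
  induction hP using Submodule.span_induction with
  | mem P hP =>
    obtain ⟨k, rfl⟩ := hP
    exact H.rep_opB k
  | zero => simp
  | add P Q _ _ hP hQ => rw [map_add, LinearMap.add_apply, hP, hQ, add_zero]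
  | smul Q P _ hP => rw [smul_eq_mul, map_mul, Module.End.mul_apply, hP, map_zero]

theorem rep_polyX (p : MvPolynomial (Fin 3) ℂ) (f : R) :
    H.rep (WeylAlgebra.polyX p) f = MvPolynomial.aeval (phaseCoord c) p * f := by
  have h : H.rep.comp WeylAlgebra.polyX =
      (Algebra.lmul ℂ R).comp (MvPolynomial.aeval (phaseCoord c)) := by
    ext i f
    simp only [AlgHom.comp_apply, WeylAlgebra.polyX, WeylAlgebra.evalComm_X, MvPolynomial.aeval_X]
    exact H.rep_x i f
  exact congrArg (fun L => L f) (DFunLike.congr_fun h p)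

end QuarticPhase

end QuarticPhase

end Pearcey

/-! ### Independence of 1, ∂_y, ∂₁ by degrees in t -/

namespace Pearcey

section Independence

open Polynomial

theorem natDegree_add_eq_max {f g : ℂ[X]} (h : f.natDegree ≠ g.natDegree) :
    (f + g).natDegree = max f.natDegree g.natDegree := by
  rcases h.lt_or_gt with h | h
  · rw [natDegree_add_eq_right_of_natDegree_lt h, max_eq_right h.le]
  · rw [natDegree_add_eq_left_of_natDegree_lt h, max_eq_left h.le]

theorem eq_zero_of_add_eq_zero {f g h : ℂ[X]} (hf : f ≠ 0 → f.natDegree % 4 = 0)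
    (hg : g ≠ 0 → g.natDegree % 4 = 2) (hh : h ≠ 0 → h.natDegree % 4 = 3) (e : f + g + h = 0) :
    f = 0 ∧ g = 0 ∧ h = 0 := by
  have key : (f + g).natDegree = h.natDegree := by
    rw [eq_neg_of_add_eq_zero_left e, natDegree_neg]
  have h0 : h = 0 := by
    by_contra h0
    have h1 := hh h0
    rw [← key] at h1
    by_cases hf0 : f = 0
    · by_cases hg0 : g = 0
      · rw [hf0, hg0, add_zero, zero_add] at e
        exact h0 e
      · have := hg hg0
        rw [hf0, zero_add] at h1
        omega
    · have hf' := hf hf0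
      by_cases hg0 : g = 0
      · rw [hg0, add_zero] at h1
        omega
      · have := hg hg0
        rw [natDegree_add_eq_max (by omega)] at h1
        rcases max_choice f.natDegree g.natDegree with h | h <;> rw [h] at h1 <;> omega
  rw [h0, add_zero] at e
  have hfg : f.natDegree = g.natDegree := by rw [eq_neg_of_add_eq_zero_left e, natDegree_neg]
  by_cases hf0 : f = 0
  · exact ⟨hf0, by rwa [hf0, zero_add] at e, h0⟩
  · by_cases hg0 : g = 0
    · exact ⟨by rwa [hg0, add_zero] at e, hg0, h0⟩
    · have := hf hf0
      have := hg hg0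
      omega

/-- The polynomials `F'² - (4/3) F F''`, `F''` and `t F'' - F'` are independent over `ℂ[F]`, for
`F = t⁴ + b t² + a t` with `b ≠ 0`. -/
theorem quartic_independent {a b : ℂ} (hb : b ≠ 0) {p q r : ℂ[X]}
    (h : p.comp (-(X ^ 4 + C b * X ^ 2 + C a * X)) *
        (C (-(8 / 3) * b) * X ^ 4 - C (8 * a) * X ^ 3 + C (4 / 3 * b ^ 2) * X ^ 2 +
          C (4 / 3 * a * b) * X + C (a ^ 2)) +
      q.comp (-(X ^ 4 + C b * X ^ 2 + C a * X)) * (12 * X ^ 2 + C (2 * b)) +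
      r.comp (-(X ^ 4 + C b * X ^ 2 + C a * X)) * (8 * X ^ 3 - C a) = 0) :
    p = 0 ∧ q = 0 ∧ r = 0 := by
  set F : ℂ[X] := -(X ^ 4 + C b * X ^ 2 + C a * X) with hF
  have hF4 : F.natDegree = 4 := by
    rw [hF, natDegree_neg]
    compute_degree!
  have d4 : (C (-(8 / 3) * b) * X ^ 4 - C (8 * a) * X ^ 3 + C (4 / 3 * b ^ 2) * X ^ 2 +
      C (4 / 3 * a * b) * X + C (a ^ 2) : ℂ[X]).natDegree = 4 := by
    compute_degree!
  have d2 : (12 * X ^ 2 + C (2 * b) : ℂ[X]).natDegree = 2 := by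
    compute_degree!
  have d3 : (8 * X ^ 3 - C a : ℂ[X]).natDegree = 3 := by
    compute_degree!
  -- Composition with F multiplies degrees by 4, so the residue modulo 4 is that of the second
  -- factor. The three residues 0, 2, 3 differ and no cancellation is possible.
  have key : ∀ (f g : ℂ[X]), f.comp F * g ≠ 0 → (f.comp F * g).natDegree % 4 = g.natDegree % 4 := by
    intro f g h
    rw [natDegree_mul (left_ne_zero_of_mul h) (right_ne_zero_of_mul h), natDegree_comp, hF4]
    omega
  obtain ⟨h1, h2, h3⟩ := eq_zero_of_add_eq_zero (fun h => by rw [key _ _ h, d4])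
    (fun h => by rw [key _ _ h, d2]) (fun h => by rw [key _ _ h, d3]) h
  have hcomp : ∀ (f g : ℂ[X]), g.natDegree ≠ 0 → f.comp F * g = 0 → f = 0 := by
    intro f g hg h
    have h1 : f.comp F = 0 := by
      refine (mul_eq_zero.1 h).resolve_right fun h => hg ?_
      rw [h, natDegree_zero]
    rcases comp_eq_zero_iff.1 h1 with h2 | ⟨-, h2⟩
    · exact h2
    · rw [h2, natDegree_C] at hF4
      omega
  exact ⟨hcomp _ _ (by omega) h1, hcomp _ _ (by omega) h2, hcomp _ _ (by omega) h3⟩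

/-- F'² and F'' have degrees 6 and 2, which agree modulo 4. Subtracting (4/3) F F'' removes the top
term and leaves degree 4 with leading coefficient -(8/3) b, where b = x₂; hence
`quartic_independent` applies for b ≠ 0. -/
theorem polynomial_independent {p₀ p₁ p₂ : MvPolynomial (Fin 3) ℂ}
    (h : ∀ c : Fin 3 → ℂ, 4 * c 2 ^ 3 + 2 * c 1 * c 2 + c 0 ≠ 0 →
      MvPolynomial.eval (phaseCoord c) p₀ * (4 * c 2 ^ 3 + 2 * c 1 * c 2 + c 0) ^ 2 +
      MvPolynomial.eval (phaseCoord c) p₁ * (12 * c 2 ^ 2 + 2 * c 1) +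
      MvPolynomial.eval (phaseCoord c) p₂ * (8 * c 2 ^ 3 - c 0) = 0) :
    p₀ = 0 ∧ p₁ = 0 ∧ p₂ = 0 := by
  have key : ∀ a b : ℂ, b ≠ 0 → ∀ y : ℂ, MvPolynomial.eval ![a, b, y] p₀ = 0 ∧
      MvPolynomial.eval ![a, b, y] p₁ = 0 ∧ MvPolynomial.eval ![a, b, y] p₂ = 0 := by
    intro a b hb y
    let q : MvPolynomial (Fin 3) ℂ → ℂ[X] := fun p => MvPolynomial.aeval ![C a, C b, X] p
    have hq : ∀ p y, (q p).eval y = MvPolynomial.eval ![a, b, y] p := by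
      intro p y
      have : (Polynomial.aeval y).comp (MvPolynomial.aeval (R := ℂ) ![C a, C b, X]) =
          MvPolynomial.aeval ![a, b, y] := by
        ext i
        fin_cases i <;> simp
      have h2 := DFunLike.congr_fun this p
      simpa [q] using h2
    set F : ℂ[X] := X ^ 4 + C b * X ^ 2 + C a * X with hF
    set F' : ℂ[X] := 4 * X ^ 3 + C (2 * b) * X + C a with hF'
    have hF'0 : F' ≠ 0 := by
      intro h
      have : F'.natDegree = 3 := by
        rw [hF']
        compute_degree!
      rw [h] at this
      simp at this
    have h1 : (q p₀).comp (-F) * F' ^ 2 + (q p₁).comp (-F) * (12 * X ^ 2 + C (2 * b)) +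
        (q p₂).comp (-F) * (8 * X ^ 3 - C a) = 0 := by
      -- The hypothesis is available only where F'(t) ≠ 0; the factor F' makes the identity hold at
      -- every t.
      refine (mul_eq_zero.1 (?_ : F' * _ = 0)).resolve_left hF'0
      refine Polynomial.funext fun t => ?_
      by_cases ht : 4 * t ^ 3 + 2 * b * t + a = 0
      · simp [hF', ht]
      · have := h ![a, b, t] ht
        have e : phaseCoord ![a, b, t] = ![a, b, -(t ^ 4 + b * t ^ 2 + a * t)] := rfl
        rw [e] at this
        simp only [eval_mul, eval_add, eval_comp, hq, hF, hF', eval_neg, eval_pow, eval_X, eval_C,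
          eval_sub, eval_ofNat, eval_zero]
        rw [mul_eq_zero]
        right
        exact this
    -- Since y = -F, moving (4/3) F F'' p₀ into the coefficient of F'' changes p₁ into p₁ - (4/3) y
    -- p₀.
    obtain ⟨e0, e1, e2⟩ := quartic_independent (a := a) hb (p := q p₀)
      (q := q p₁ - C (4 / 3) * X * q p₀) (r := q p₂) (by
        rw [← h1, ← hF]
        have hC : ∀ n : ℕ, [n.AtLeastTwo] → (C (ofNat(n) : ℂ) : ℂ[X]) = ofNat(n) :=
          fun n _ => map_ofNat C n
        have e1 : (C (4 / 3) : ℂ[X]) * 3 = 4 := by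
          rw [← hC 3, ← hC 4, ← C_mul]
          norm_num
        have e2 : (C (8 / 3) : ℂ[X]) = 2 * C (4 / 3) := by
          rw [← hC 2, ← C_mul]
          norm_num
        simp only [sub_comp, mul_comp, C_comp, X_comp, hF', C_mul, C_pow, C_neg, e2, hC]
        generalize C (4 / 3) = k at e1
        rw [hF]
        linear_combination (q p₀).comp (-(X ^ 4 + C b * X ^ 2 + C a * X)) *
          (4 * X ^ 6 + 4 * C b * X ^ 4 + 4 * C a * X ^ 3 + C b ^ 2 * X ^ 2 + C a * C b * X) * e1)
    rw [e0, mul_zero, sub_zero] at e1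
    exact ⟨by rw [← hq, e0, eval_zero], by rw [← hq, e1, eval_zero], by rw [← hq, e2, eval_zero]⟩
  have key2 : ∀ p : MvPolynomial (Fin 3) ℂ,
      (∀ a b : ℂ, b ≠ 0 → ∀ y : ℂ, MvPolynomial.eval ![a, b, y] p = 0) → p = 0 := by
    intro p hp
    -- Multiplication by x₂ removes the restriction b ≠ 0.
    refine (mul_eq_zero.1 (?_ : MvPolynomial.X 1 * p = 0)).resolve_left (MvPolynomial.X_ne_zero 1)
    refine MvPolynomial.funext fun c => ?_
    have hc : c = ![c 0, c 1, c 2] := by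
      funext i
      fin_cases i <;> rfl
    by_cases h1 : c 1 = 0
    · simp [h1]
    · have := hp (c 0) (c 1) h1 (c 2)
      rw [← hc] at this
      simp [this]
  exact ⟨key2 _ fun a b hb y => (key a b hb y).1, key2 _ fun a b hb y => (key a b hb y).2.1,
    key2 _ fun a b hb y => (key a b hb y).2.2⟩

end Independence

section Lower

open HoloAlg

/-- The open set where the derivative in `t` of the phase `t⁴ + x₂ t² + x₁ t` is nonzero. -/
def regularDomain : TopologicalSpace.Opens (Fin 3 → ℂ) :=
  ⟨{c | 4 * c 2 ^ 3 + 2 * c 1 * c 2 + c 0 ≠ 0}, isOpen_ne_fun (by fun_prop) (by fun_prop)⟩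

theorem exists_quarticPhase :
    ∃ g : HoloAlg regularDomain, QuarticPhase (fun i => pd i) (coord regularDomain) g := by
  obtain ⟨g, hg⟩ := isUnit_of_ne_zero (f := 4 * coord regularDomain 2 ^ 3 +
    2 * coord regularDomain 1 * coord regularDomain 2 + coord regularDomain 0) (by
      intro p hp
      rw [← eval_eq_ext _ hp]
      simp only [map_add, map_mul, map_pow, map_ofNat, coord, eval_of]
      exact hp)
  exact ⟨g, pd_comm, pd_coord, hg⟩

/-- The operators `1`, `∂_y`, `∂₁` are independent over `ℂ[x]` modulo `idealB`. -/
theorem eq_zero_of_mem_idealB {p₀ p₁ p₂ : MvPolynomial (Fin 3) ℂ}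
    (h : WeylAlgebra.polyX p₀ + WeylAlgebra.polyX p₁ * WeylAlgebra.d 2 +
      WeylAlgebra.polyX p₂ * WeylAlgebra.d 0 ∈ idealB) : p₀ = 0 ∧ p₁ = 0 ∧ p₂ = 0 := by
  obtain ⟨g, H⟩ := exists_quarticPhase
  have h1 := H.rep_eq_zero h
  simp only [map_add, map_mul, LinearMap.add_apply, Module.End.mul_apply, H.rep_polyX, H.rep_d,
    H.phaseDerivation_zero_g, H.phaseDerivation_two_g] at h1
  refine polynomial_independent fun c hc => ?_
  have hc' : c ∈ regularDomain := hc
  have h2 := congrArg (eval ⟨c, hc'⟩) h1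
  have h3 := congrArg (eval ⟨c, hc'⟩) H.inv
  have hev : ∀ p : MvPolynomial (Fin 3) ℂ,
      eval ⟨c, hc'⟩ (MvPolynomial.aeval (phaseCoord (coord regularDomain)) p) =
        MvPolynomial.eval (phaseCoord c) p := by
    intro p
    have : (eval ⟨c, hc'⟩).comp (MvPolynomial.aeval (phaseCoord (coord regularDomain))) =
        MvPolynomial.aeval (phaseCoord c) := by
      ext i
      fin_cases i <;> simp [phaseCoord, coord, eval_of]
    exact DFunLike.congr_fun this p
  simp only [map_add, map_mul, map_pow, map_neg, map_ofNat, map_one, map_zero, hev, coord, eval_of]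
    at h2 h3
  generalize eval ⟨c, hc'⟩ g = G at h2 h3
  generalize MvPolynomial.eval (phaseCoord c) p₀ = q₀ at h2 ⊢
  generalize MvPolynomial.eval (phaseCoord c) p₁ = q₁ at h2 ⊢
  generalize MvPolynomial.eval (phaseCoord c) p₂ = q₂ at h2 ⊢
  have hf : 8 * c 2 ^ 3 - c 0 = c 2 * (12 * c 2 ^ 2 + 2 * c 1) -
      (4 * c 2 ^ 3 + 2 * c 1 * c 2 + c 0) := by ring
  rw [hf]
  generalize 4 * c 2 ^ 3 + 2 * c 1 * c 2 + c 0 = f at h3 ⊢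
  generalize 12 * c 2 ^ 2 + 2 * c 1 = w at h2 ⊢
  -- Clears denominators: g, ∂_y g = F''g³ and ∂₁g = -g² + tF''g³ become F'², F'' and tF'' - F'
  -- after multiplication by F'³.
  linear_combination f ^ 3 * h2 - (q₀ * f ^ 2 +
    (q₁ * w + q₂ * c 2 * w) * (f ^ 2 * G ^ 2 + f * G + 1) - q₂ * f * (f * G + 1)) * h3

end Lower

end Pearcey

/-! ### Cyclic modules up to torsion, and the rank -/

namespace WeylAlgebra

section Basic

variable {n : ℕ}

theorem polyX_X (i : Fin n) : polyX (MvPolynomial.X i) = x i := evalComm_X _ _ i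

theorem induction_generators {p : WeylAlgebra n → Prop} (h1 : p 1)
    (hC : ∀ (c : ℂ) (P), p P → p (algebraMap ℂ _ c * P))
    (hx : ∀ i P, p P → p (x i * P)) (hd : ∀ i P, p P → p (d i * P))
    (hadd : ∀ P Q, p P → p Q → p (P + Q)) (P : WeylAlgebra n) : p P := by
  let π : FreeAlgebra ℂ (Fin n ⊕ Fin n) →ₐ[ℂ] WeylAlgebra n := RingQuot.mkAlgHom ℂ (WeylRel n)
  have hmul : ∀ a, ∀ P, p P → p (π a * P) := by
    intro a
    induction a using FreeAlgebra.induction with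
    | grade0 c =>
      intro P hP
      rw [AlgHom.commutes]
      exact hC c P hP
    | grade1 i =>
      intro P hP
      rcases i with i | i
      · exact hx i P hP
      · exact hd i P hP
    | mul a b ha hb =>
      intro P hP
      rw [map_mul, mul_assoc]
      exact ha _ (hb _ hP)
    | add a b ha hb =>
      intro P hP
      rw [map_add, add_mul]
      exact hadd _ _ (ha _ hP) (hb _ hP)
  obtain ⟨a, rfl⟩ := RingQuot.mkAlgHom_surjective ℂ (WeylRel n) P
  have := hmul a 1 h1
  rwa [mul_one] at this

theorem d_mul_polyX (i : Fin n) (p : MvPolynomial (Fin n) ℂ) :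
    d i * polyX p = polyX p * d i + polyX (MvPolynomial.pderiv i p) := by
  induction p using MvPolynomial.induction_on with
  | C c =>
    rw [MvPolynomial.pderiv_C, map_zero, add_zero]
    have : (polyX (MvPolynomial.C c) : WeylAlgebra n) = algebraMap ℂ _ c := polyX.commutes c
    rw [this, Algebra.commutes]
  | add p q hp hq =>
    simp only [map_add, mul_add, add_mul, hp, hq]
    abel
  | mul_X p j hp =>
    rw [Derivation.leibniz, MvPolynomial.pderiv_X, map_add, map_mul, ← mul_assoc, hp, polyX_X,
      add_mul, mul_assoc, d_mul_x, smul_eq_mul, smul_eq_mul, map_mul, map_mul, polyX_X]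
    have : (polyX (Pi.single (M := fun _ => MvPolynomial (Fin n) ℂ) i 1 j) : WeylAlgebra n) =
        if i = j then 1 else 0 := by
      rcases eq_or_ne i j with h | h
      · subst h; simp
      · simp [h]
    have h2 : x j * polyX (MvPolynomial.pderiv i p) = polyX (MvPolynomial.pderiv i p) * x j := by
      rw [← polyX_X, ← map_mul, mul_comm, map_mul]
    rw [this, h2, mul_add, mul_assoc]
    abel

variable (I : Submodule (WeylAlgebra n) (WeylAlgebra n))

theorem polyX_smul (p : MvPolynomial (Fin n) ℂ) (m : CyclicModule I) : polyX p • m = p • m := rfl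

theorem x_smul (i : Fin n) (m : CyclicModule I) :
    x i • m = (MvPolynomial.X i : MvPolynomial (Fin n) ℂ) • m := by
  rw [← polyX_smul, polyX_X]

theorem algebraMap_smul (c : ℂ) (m : CyclicModule I) :
    algebraMap ℂ (WeylAlgebra n) c • m = (MvPolynomial.C c : MvPolynomial (Fin n) ℂ) • m := by
  rw [← polyX_smul]
  congr 1
  exact (polyX.commutes c).symm

theorem d_smul_smul (i : Fin n) (p : MvPolynomial (Fin n) ℂ) (m : CyclicModule I) :
    d i • p • m = p • d i • m + MvPolynomial.pderiv i p • m := by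
  rw [← polyX_smul, ← polyX_smul, ← polyX_smul, smul_smul, smul_smul, d_mul_polyX, add_smul]

theorem d_smul_d_smul (i j : Fin n) (m : CyclicModule I) : d i • d j • m = d j • d i • m := by
  rw [smul_smul, smul_smul, d_comm]

variable {I}

/-- The elements of `D / I` with a nonzero multiple in the `ℂ[x]`-submodule `S`. -/
def saturation (S : Submodule (MvPolynomial (Fin n) ℂ) (CyclicModule I)) :
    Submodule (MvPolynomial (Fin n) ℂ) (CyclicModule I) where
  carrier := {m | ∃ p : MvPolynomial (Fin n) ℂ, p ≠ 0 ∧ p • m ∈ S}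
  zero_mem' := ⟨1, one_ne_zero, by simp⟩
  add_mem' := by
    rintro a b ⟨p, hp, ha⟩ ⟨q, hq, hb⟩
    refine ⟨p * q, mul_ne_zero hp hq, ?_⟩
    rw [smul_add]
    refine S.add_mem ?_ ?_
    · rw [mul_comm, mul_smul]
      exact S.smul_mem _ ha
    · rw [mul_smul]
      exact S.smul_mem _ hb
  smul_mem' := by
    rintro r a ⟨p, hp, ha⟩
    refine ⟨p, hp, ?_⟩
    rw [smul_comm]
    exact S.smul_mem _ ha

variable {S : Submodule (MvPolynomial (Fin n) ℂ) (CyclicModule I)}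

theorem le_saturation : S ≤ saturation S := fun m hm => ⟨1, one_ne_zero, by simpa using hm⟩

theorem mem_saturation_of_smul_mem {p : MvPolynomial (Fin n) ℂ} (hp : p ≠ 0) {m : CyclicModule I}
    (h : p • m ∈ saturation S) : m ∈ saturation S := by
  obtain ⟨q, hq, h⟩ := h
  exact ⟨q * p, mul_ne_zero hq hp, by rwa [mul_smul]⟩

/-- By the Leibniz rule it suffices to test generators. For pm in the span, p(∂m) = ∂(pm) - (∂p)m
lies in the saturation, and p can be divided out. -/
theorem d_smul_mem_saturation_of_span {s : Set (CyclicModule I)}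
    (hd : ∀ i, ∀ m ∈ s, (d i : WeylAlgebra n) • m ∈ saturation (Submodule.span (MvPolynomial (Fin n) ℂ) s))
    (i : Fin n) {m : CyclicModule I}
    (hm : m ∈ saturation (Submodule.span (MvPolynomial (Fin n) ℂ) s)) :
    (d i : WeylAlgebra n) • m ∈ saturation (Submodule.span (MvPolynomial (Fin n) ℂ) s) := by
  have h1 : ∀ m ∈ Submodule.span (MvPolynomial (Fin n) ℂ) s,
      (d i : WeylAlgebra n) • m ∈ saturation (Submodule.span (MvPolynomial (Fin n) ℂ) s) := by
    intro m hm
    induction hm using Submodule.span_induction with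
    | mem m hm => exact hd i m hm
    | zero => rw [smul_zero]; exact Submodule.zero_mem _
    | add a b _ _ ha hb => rw [smul_add]; exact Submodule.add_mem _ ha hb
    | smul p m hm h =>
      rw [d_smul_smul]
      exact Submodule.add_mem _ (Submodule.smul_mem _ _ h)
        (le_saturation (Submodule.smul_mem _ _ hm))
  obtain ⟨p, hp, h⟩ := id hm
  refine mem_saturation_of_smul_mem hp ?_
  rw [eq_sub_of_add_eq (d_smul_smul I i p m).symm]
  exact Submodule.sub_mem _ (h1 _ h) (Submodule.smul_mem _ _ hm)

/-- If the `ℂ[x]`-span of `s` contains the generator and is stable under the derivations up to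
torsion, then `D / I` is spanned by `s` up to torsion. -/
theorem saturation_span_eq_top {s : Set (CyclicModule I)}
    (hd : ∀ i, ∀ m ∈ s, (d i : WeylAlgebra n) • m ∈ saturation (Submodule.span (MvPolynomial (Fin n) ℂ) s))
    (h1 : I.mkQ 1 ∈ s) : saturation (Submodule.span (MvPolynomial (Fin n) ℂ) s) = ⊤ := by
  rw [eq_top_iff]
  rintro m -
  obtain ⟨P, rfl⟩ := I.mkQ_surjective m
  induction P using induction_generators with
  | h1 => exact le_saturation (Submodule.subset_span h1)
  | hC c P hP =>
    rw [← smul_eq_mul, map_smul, algebraMap_smul]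
    exact Submodule.smul_mem _ _ hP
  | hx i P hP =>
    rw [← smul_eq_mul, map_smul, x_smul]
    exact Submodule.smul_mem _ _ hP
  | hd i P hP =>
    rw [← smul_eq_mul, map_smul]
    exact d_smul_mem_saturation_of_span hd i hP
  | hadd P Q hP hQ =>
    rw [map_add]
    exact Submodule.add_mem _ hP hQ

/-- The quotient by S is torsion, hence has rank 0, and rank is additive over a domain. -/
theorem rank_eq_rank_of_saturation_eq_top (h : saturation S = ⊤) :
    rank I = Module.rank (MvPolynomial (Fin n) ℂ) S := by
  have h1 : rank I = Module.rank (MvPolynomial (Fin n) ℂ) (CyclicModule I) :=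
    (TensorProduct.isBaseChange (MvPolynomial (Fin n) ℂ) (CyclicModule I)
      (FractionRing (MvPolynomial (Fin n) ℂ))).rank_eq
  have h2 : Module.rank (MvPolynomial (Fin n) ℂ) (CyclicModule I ⧸ S) = 0 := by
    rw [rank_eq_zero_iff]
    intro m
    obtain ⟨m, rfl⟩ := S.mkQ_surjective m
    obtain ⟨p, hp, hm⟩ : m ∈ saturation S := h ▸ Submodule.mem_top
    refine ⟨p, hp, ?_⟩
    rw [← map_smul]
    exact (Submodule.Quotient.mk_eq_zero S).2 hm
  rw [h1, ← rank_quotient_add_rank_of_isDomain S, h2, zero_add]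

end Basic

end WeylAlgebra

/-! ### The module of the Borel transformed system has rank 3 -/

namespace Pearcey

open WeylAlgebra

section Rank

/-- The generator of the module `D / I`. -/
noncomputable def generator : CyclicModule idealB := idealB.mkQ 1

theorem smul_generator (P : WeylAlgebra 3) : P • generator = idealB.mkQ P := by
  rw [generator, ← map_smul, smul_eq_mul, mul_one]

theorem opB_smul_generator (k : Fin 4) : opB k • generator = 0 := by
  rw [smul_generator]
  exact (Submodule.Quotient.mk_eq_zero _).2 (Submodule.subset_span ⟨k, rfl⟩)

theorem ofNat_weyl_smul (n : ℕ) [n.AtLeastTwo] (m : CyclicModule idealB) :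
    (ofNat(n) : WeylAlgebra 3) • m = (ofNat(n) : MvPolynomial (Fin 3) ℂ) • m :=
  (ofNat_smul_eq_nsmul _ n m).trans (ofNat_smul_eq_nsmul (MvPolynomial (Fin 3) ℂ) n m).symm

local notation "X₁" => (MvPolynomial.X 0 : MvPolynomial (Fin 3) ℂ)
local notation "X₂" => (MvPolynomial.X 1 : MvPolynomial (Fin 3) ℂ)
local notation "Y" => (MvPolynomial.X 2 : MvPolynomial (Fin 3) ℂ)
local notation "∂₁" => (WeylAlgebra.d 0 : WeylAlgebra 3)
local notation "∂₂" => (WeylAlgebra.d 1 : WeylAlgebra 3)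
local notation "∂y" => (WeylAlgebra.d 2 : WeylAlgebra 3)

theorem relation_d₁_d₂ : (4 : MvPolynomial (Fin 3) ℂ) • ∂₁ • ∂₂ • generator +
    (2 * X₂) • ∂₁ • ∂y • generator + X₁ • ∂y • ∂y • generator = 0 := by
  have h := opB_smul_generator 0
  simp only [opB_eq, Matrix.cons_val, pow_two, add_smul, mul_smul, ofNat_weyl_smul, x_smul] at h
  rw [d_smul_d_smul 2 0 (I := idealB)] at h
  simpa only [mul_smul] using h

theorem relation_d₂_d₂ : (4 : MvPolynomial (Fin 3) ℂ) • ∂₂ • ∂₂ • generator +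
    X₁ • ∂₁ • ∂y • generator + (2 * X₂) • ∂₂ • ∂y • generator + ∂y • generator = 0 := by
  have h := opB_smul_generator 1
  simp only [opB_eq, Matrix.cons_val, pow_two, add_smul, mul_smul, ofNat_weyl_smul, x_smul] at h
  rw [d_smul_d_smul 2 0 (I := idealB), d_smul_d_smul 2 1 (I := idealB)] at h
  simpa only [mul_smul] using h

theorem relation_d₁_d₁ : ∂₁ • ∂₁ • generator = ∂₂ • ∂y • generator := by
  have h := opB_smul_generator 2
  simp only [opB_eq, Matrix.cons_val, pow_two, sub_smul, mul_smul] at h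
  rw [d_smul_d_smul 1 2 (I := idealB)]
  exact (sub_eq_zero.1 h).symm

theorem relation_euler : (3 * X₁) • ∂₁ • generator + (2 * X₂) • ∂₂ • generator +
    (4 * Y) • ∂y • generator + (3 : MvPolynomial (Fin 3) ℂ) • generator = 0 := by
  have h := opB_smul_generator 3
  simp only [opB_eq, Matrix.cons_val, add_smul, mul_smul, ofNat_weyl_smul, x_smul] at h
  simpa only [mul_smul] using h

theorem pderiv_ofNat (i : Fin 3) (n : ℕ) [n.AtLeastTwo] :
    MvPolynomial.pderiv i (ofNat(n) : MvPolynomial (Fin 3) ℂ) = 0 :=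
  (MvPolynomial.pderiv i).map_natCast n

/-- Differentiating the Euler relation adds the weights 3, 2, 4 of x₁, x₂, y to the constant 3. -/
theorem relation_d_euler (i : Fin 3) : (3 * X₁) • d i • ∂₁ • generator +
    (2 * X₂) • d i • ∂₂ • generator + (4 * Y) • d i • ∂y • generator +
    (![6, 5, 7] i : MvPolynomial (Fin 3) ℂ) • d i • generator = 0 := by
  have h := congrArg (fun m => d i • m) relation_euler
  simp only [smul_add, d_smul_smul, smul_zero, Derivation.leibniz, MvPolynomial.pderiv_X,
    pderiv_ofNat, smul_eq_mul, mul_zero, add_zero, zero_smul] at h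
  rw [← h]
  fin_cases i
  · simp only [Fin.zero_eta, Matrix.cons_val]
    generalize ∂₁ • ∂₁ • generator = a₁
    generalize ∂₁ • ∂₂ • generator = a₂
    generalize ∂₁ • ∂y • generator = a₃
    generalize ∂₁ • generator = b₁
    generalize ∂₂ • generator = b₂
    generalize ∂y • generator = b₃
    simp
    module
  · simp only [Fin.mk_one, Matrix.cons_val]
    generalize ∂₂ • ∂₁ • generator = a₁
    generalize ∂₂ • ∂₂ • generator = a₂
    generalize ∂₂ • ∂y • generator = a₃
    generalize ∂₁ • generator = b₁
    generalize ∂₂ • generator = b₂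
    generalize ∂y • generator = b₃
    simp
    module
  · simp only [Fin.reduceFinMk, Matrix.cons_val]
    generalize ∂y • ∂₁ • generator = a₁
    generalize ∂y • ∂₂ • generator = a₂
    generalize ∂y • ∂y • generator = a₃
    generalize ∂₁ • generator = b₁
    generalize ∂₂ • generator = b₂
    generalize ∂y • generator = b₃
    simp
    module

/-- The elements `1`, `∂_y`, `∂₁` of the module. -/
noncomputable def basisFamily : Fin 3 → CyclicModule idealB :=
  ![generator, ∂y • generator, ∂₁ • generator]

theorem linearIndependent_basisFamily :
    LinearIndependent (MvPolynomial (Fin 3) ℂ) basisFamily := by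
  rw [Fintype.linearIndependent_iff]
  intro p hp
  rw [Fin.sum_univ_three] at hp
  have h : polyX (p 0) + polyX (p 1) * d 2 + polyX (p 2) * d 0 ∈ idealB := by
    rw [← Submodule.Quotient.mk_eq_zero]
    change idealB.mkQ _ = 0
    rw [← smul_generator, ← hp, add_smul, add_smul, mul_smul, mul_smul]
    rfl
  obtain ⟨h0, h1, h2⟩ := eq_zero_of_mem_idealB h
  intro i
  fin_cases i
  · exact h0
  · exact h1
  · exact h2

/-- This is the determinant of the linear system for ∂_y², ∂₁∂_y, ∂₂∂_y set up in the next proof. It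
equals twice the discriminant of t⁴ + x₂t² + x₁t + y; at x₁ = x₂ = 0 it is 512 y³. -/
theorem discriminant_ne_zero : (-(X₁ * X₂)) * ((-(8 * X₁ * X₂)) * (2 * X₂) -
    (16 * Y - 4 * X₂ ^ 2) * (3 * X₁)) - (8 * Y - 2 * X₂ ^ 2) * ((-(3 * X₁ ^ 2)) * (2 * X₂) -
    (16 * Y - 4 * X₂ ^ 2) * (4 * Y)) + (6 * X₁) * ((-(3 * X₁ ^ 2)) * (3 * X₁) -
    (-(8 * X₁ * X₂)) * (4 * Y)) ≠ 0 := by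
  intro h
  have := congrArg (MvPolynomial.eval ![0, 0, 1]) h
  simp at this

/-- Modulo torsion ∂₂ comes from the Euler relation. The second derivatives containing ∂_y come from
Cramer's rule, and ∂₁², ∂₁∂₂ from P₃ and P₁. -/
theorem d_smul_basisFamily_mem (i : Fin 3) : ∀ m ∈ Set.range basisFamily, d i • m ∈
    saturation (Submodule.span (MvPolynomial (Fin 3) ℂ) (Set.range basisFamily)) := by
  set N := saturation (Submodule.span (MvPolynomial (Fin 3) ℂ) (Set.range basisFamily)) with hN
  have hmem : ∀ j, basisFamily j ∈ N := fun j => le_saturation (Submodule.subset_span ⟨j, rfl⟩)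
  have h0 : generator ∈ N := hmem 0
  have hy : ∂y • generator ∈ N := hmem 1
  have h1 : ∂₁ • generator ∈ N := hmem 2
  have h2 : ∂₂ • generator ∈ N := by
    refine mem_saturation_of_smul_mem (p := 2 * X₂)
      (mul_ne_zero two_ne_zero (MvPolynomial.X_ne_zero 1)) ?_
    have e : (2 * X₂) • ∂₂ • generator = -((3 * X₁) • ∂₁ • generator +
        (4 * Y) • ∂y • generator + (3 : MvPolynomial (Fin 3) ℂ) • generator) := by
      rw [eq_neg_iff_add_eq_zero, ← relation_euler]
      abel
    rw [e]
    exact N.neg_mem (N.add_mem (N.add_mem (N.smul_mem _ h1) (N.smul_mem _ hy)) (N.smul_mem _ h0))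
  have r1 := relation_d₁_d₂
  have r2 := relation_d₂_d₂
  have r3 := relation_d_euler 0
  have r4 := relation_d_euler 1
  have r5 := relation_d_euler 2
  rw [d_smul_d_smul 1 0 (I := idealB)] at r4
  rw [relation_d₁_d₁] at r3
  rw [d_smul_d_smul 2 0 (I := idealB), d_smul_d_smul 2 1 (I := idealB)] at r5
  have key : ∀ a b c : CyclicModule idealB, ∂y • ∂y • generator = a → ∂₁ • ∂y • generator = b →
      ∂₂ • ∂y • generator = c → a ∈ N ∧ b ∈ N ∧ c ∈ N := by
    intro a b c ha hb hc
    rw [ha, hb] at r1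
    rw [hb, hc] at r2
    rw [hb, hc] at r3
    rw [hc] at r4
    rw [ha, hb, hc] at r5
    simp only [Matrix.cons_val] at r3 r4 r5
    clear ha hb hc hmem
    generalize ∂₁ • ∂₂ • generator = d at r1 r3 r4
    generalize ∂₂ • ∂₂ • generator = e at r2 r4
    generalize ∂₁ • generator = b₁ at *
    generalize ∂₂ • generator = b₂ at *
    generalize ∂y • generator = b₃ at *
    -- `A` eliminates ∂₁∂₂ and `B` eliminates ∂₁∂₂ and ∂₂² by means of P₁ and P₂; `C` is the
    -- y-derivative of the Euler relation. The right sides have order one and so lie in N.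
    have A : (-(X₁ * X₂)) • a + (8 * Y - 2 * X₂ ^ 2) • b + (6 * X₁) • c ∈ N := by
      have : (-(X₁ * X₂)) • a + (8 * Y - 2 * X₂ ^ 2) • b + (6 * X₁) • c =
          (-12 : MvPolynomial (Fin 3) ℂ) • b₁ := by
        linear_combination (norm := module) (2 : MvPolynomial (Fin 3) ℂ) • r3 - X₂ • r1
      rw [this]
      exact N.smul_mem _ h1
    have B : (-(3 * X₁ ^ 2)) • a + (-(8 * X₁ * X₂)) • b + (16 * Y - 4 * X₂ ^ 2) • c ∈ N := by
      have : (-(3 * X₁ ^ 2)) • a + (-(8 * X₁ * X₂)) • b + (16 * Y - 4 * X₂ ^ 2) • c =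
          (2 * X₂) • b₃ - (20 : MvPolynomial (Fin 3) ℂ) • b₂ := by
        linear_combination (norm := module) (4 : MvPolynomial (Fin 3) ℂ) • r4 - (3 * X₁) • r1 -
          (2 * X₂) • r2
      rw [this]
      exact N.sub_mem (N.smul_mem _ hy) (N.smul_mem _ h2)
    have C : (4 * Y) • a + (3 * X₁) • b + (2 * X₂) • c ∈ N := by
      have : (4 * Y) • a + (3 * X₁) • b + (2 * X₂) • c =
          (-7 : MvPolynomial (Fin 3) ℂ) • b₃ := by
        linear_combination (norm := module) r5
      rw [this]
      exact N.smul_mem _ hy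
    refine ⟨mem_saturation_of_smul_mem discriminant_ne_zero ?_,
      mem_saturation_of_smul_mem discriminant_ne_zero ?_,
      mem_saturation_of_smul_mem discriminant_ne_zero ?_⟩
    -- Cramer's rule: the multipliers of A, B, C are the cofactors of the column of the unknown.
    · convert N.add_mem (N.add_mem
        (N.smul_mem ((-(8 * X₁ * X₂)) * (2 * X₂) - (16 * Y - 4 * X₂ ^ 2) * (3 * X₁)) A)
        (N.smul_mem (-((8 * Y - 2 * X₂ ^ 2) * (2 * X₂) - (6 * X₁) * (3 * X₁))) B))
        (N.smul_mem ((8 * Y - 2 * X₂ ^ 2) * (16 * Y - 4 * X₂ ^ 2) -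
          (6 * X₁) * (-(8 * X₁ * X₂))) C) using 1
      module
    · convert N.add_mem (N.add_mem
        (N.smul_mem (-((-(3 * X₁ ^ 2)) * (2 * X₂) - (16 * Y - 4 * X₂ ^ 2) * (4 * Y))) A)
        (N.smul_mem ((-(X₁ * X₂)) * (2 * X₂) - (6 * X₁) * (4 * Y)) B))
        (N.smul_mem (-((-(X₁ * X₂)) * (16 * Y - 4 * X₂ ^ 2) -
          (6 * X₁) * (-(3 * X₁ ^ 2)))) C) using 1
      module
    · convert N.add_mem (N.add_mem
        (N.smul_mem ((-(3 * X₁ ^ 2)) * (3 * X₁) - (-(8 * X₁ * X₂)) * (4 * Y)) A)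
        (N.smul_mem (-((-(X₁ * X₂)) * (3 * X₁) - (8 * Y - 2 * X₂ ^ 2) * (4 * Y))) B))
        (N.smul_mem ((-(X₁ * X₂)) * (-(8 * X₁ * X₂)) -
          (8 * Y - 2 * X₂ ^ 2) * (-(3 * X₁ ^ 2))) C) using 1
      module
  obtain ⟨ha, hb, hc⟩ := key _ _ _ rfl rfl rfl
  have hd : ∂₁ • ∂₂ • generator ∈ N := by
    refine mem_saturation_of_smul_mem (p := (4 : MvPolynomial (Fin 3) ℂ)) (fun h => ?_) ?_
    · simpa only [map_ofNat, map_zero, OfNat.ofNat_ne_zero] using congrArg (MvPolynomial.eval 0) h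
    rw [add_assoc] at r1
    rw [eq_neg_of_add_eq_zero_left r1]
    exact N.neg_mem (N.add_mem (N.smul_mem _ hb) (N.smul_mem _ ha))
  rintro _ ⟨j, rfl⟩
  fin_cases i <;> fin_cases j
  · exact h1
  · exact hb
  · change ∂₁ • ∂₁ • generator ∈ N
    rwa [relation_d₁_d₁]
  · exact h2
  · exact hc
  · change ∂₂ • ∂₁ • generator ∈ N
    rwa [d_smul_d_smul]
  · exact hy
  · exact ha
  · change ∂y • ∂₁ • generator ∈ N
    rwa [d_smul_d_smul]

theorem rank_idealB : WeylAlgebra.rank idealB = 3 := by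
  rw [rank_eq_rank_of_saturation_eq_top (saturation_span_eq_top d_smul_basisFamily_mem ⟨0, rfl⟩),
    rank_span linearIndependent_basisFamily,
    Cardinal.mk_range_eq _ linearIndependent_basisFamily.injective]
  simp

end Rank

end Pearcey

/-! ### Krull dimension bounds -/

section Dimension

/-- The Krull dimension is at most `n` if this holds for the quotients by all prime ideals. -/
theorem ringKrullDim_quotient_le_of_isPrime {R : Type*} [CommRing R] {J : Ideal R} {n : WithBot ℕ∞}
    (h : ∀ Q : Ideal R, Q.IsPrime → J ≤ Q → ringKrullDim (R ⧸ Q) ≤ n) :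
    ringKrullDim (R ⧸ J) ≤ n := by
  rw [ringKrullDim_quotient]
  refine iSup_le fun p => ?_
  have hJ : J ≤ p.head.1.asIdeal := p.head.2
  refine le_trans ?_ (h p.head.1.asIdeal p.head.1.isPrime hJ)
  rw [ringKrullDim_quotient]
  -- A chain of primes above J is a chain above its own smallest member.
  let q : LTSeries (PrimeSpectrum.zeroLocus (p.head.1.asIdeal : Set R)) :=
    { length := p.length
      toFun := fun i => ⟨(p i).1, LTSeries.head_le p i⟩
      step := fun i => p.step i }
  exact le_iSup (fun q : LTSeries (PrimeSpectrum.zeroLocus (p.head.1.asIdeal : Set R)) =>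
    (q.length : WithBot ℕ∞)) q

theorem ringKrullDim_le_of_isIntegral {R S : Type*} [CommRing R] [CommRing S] [Algebra R S]
    [Algebra.IsIntegral R S] : ringKrullDim S ≤ ringKrullDim R :=
  Order.krullDim_le_of_strictMono (PrimeSpectrum.comap (algebraMap R S)) fun _ _ h =>
    Ideal.IsIntegral.comap_lt_comap h

/-- Noether normalization makes R integral over a polynomial ring whose number of variables is at
most the transcendence degree, hence at most the size of s. -/
theorem ringKrullDim_le_of_isAlgebraic {k R : Type*} [Field k] [CommRing R] [IsDomain R]
    [Algebra k R] [Algebra.FiniteType k R] (s : Set R) {n : ℕ} (hs : Cardinal.mk s ≤ n)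
    [Algebra.IsAlgebraic (Algebra.adjoin k s) R] : ringKrullDim R ≤ n := by
  obtain ⟨t, g, hg, hgi⟩ := exists_integral_inj_algHom_of_fg k R
  have h1 : (t : Cardinal.{0}) ≤ n := by
    have h2 := lift_trdeg_le_of_injective g hg
    rw [MvPolynomial.trdeg_of_isDomain] at h2
    have h3 := (Algebra.IsAlgebraic.trdeg_le_cardinalMk k s).trans hs
    simpa using h2.trans (Cardinal.lift_le.2 h3)
  have ht : t ≤ n := by exact_mod_cast h1
  algebraize [g.toRingHom]
  have h5 : ringKrullDim R ≤ ringKrullDim (MvPolynomial (Fin t) k) :=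
    ringKrullDim_le_of_isIntegral
  refine h5.trans ?_
  rw [MvPolynomial.ringKrullDim_of_isNoetherianRing, ringKrullDim_eq_zero_of_field]
  simpa using ht

end Dimension

/-! ### Total symbols and the lower bound for the characteristic variety -/

namespace WeylAlgebra

section Symbol

variable {n : ℕ}

theorem ofSymbol_add (f g : Symbol n) : ofSymbol (f + g) = ofSymbol f + ofSymbol g := by
  classical
  have h : ∀ (f : Symbol n) (s : Finset _), f.support ⊆ s → ofSymbol f =
      ∑ β ∈ s, polyX (f.coeff β) * polyD (MvPolynomial.monomial β 1) := by
    intro f s hs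
    refine Finset.sum_subset hs fun β _ hβ => ?_
    rw [MvPolynomial.notMem_support_iff.1 hβ, map_zero, zero_mul]
  rw [h f _ Finset.subset_union_left, h g _ (Finset.subset_union_right (s₁ := f.support)),
    h (f + g) _ MvPolynomial.support_add, ← Finset.sum_add_distrib]
  refine Finset.sum_congr rfl fun β _ => ?_
  rw [MvPolynomial.coeff_add, map_add, add_mul]

theorem ofSymbol_monomial (β : Fin n →₀ ℕ) (a : MvPolynomial (Fin n) ℂ) :
    ofSymbol (MvPolynomial.monomial β a) = polyX a * polyD (MvPolynomial.monomial β 1) := by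
  classical
  by_cases ha : a = 0
  · subst ha
    simp [ofSymbol]
  · rw [ofSymbol, MvPolynomial.support_monomial, if_neg ha, Finset.sum_singleton,
      MvPolynomial.coeff_monomial, if_pos rfl]

theorem polyD_X (i : Fin n) : polyD (MvPolynomial.X i) = d i := evalComm_X _ _ i

theorem ofSymbol_C (a : MvPolynomial (Fin n) ℂ) : ofSymbol (MvPolynomial.C a) = polyX a := by
  have := ofSymbol_monomial 0 a
  simpa using this

theorem ofSymbol_C_mul_X (a : MvPolynomial (Fin n) ℂ) (i : Fin n) :
    ofSymbol (MvPolynomial.C a * MvPolynomial.X i) = polyX a * d i := by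
  rw [MvPolynomial.C_mul_X_eq_monomial, ofSymbol_monomial, ← MvPolynomial.X, polyD_X]

theorem ofSymbol_C_mul_X_mul_X (a : MvPolynomial (Fin n) ℂ) (i j : Fin n) :
    ofSymbol (MvPolynomial.C a * (MvPolynomial.X i * MvPolynomial.X j)) =
      polyX a * (d i * d j) := by
  rw [← polyD_X, ← polyD_X, ← map_mul]
  simp only [MvPolynomial.X, MvPolynomial.monomial_mul, MvPolynomial.C_mul_monomial,
    mul_one, ofSymbol_monomial]

theorem mem_charIdeal {I : Submodule (WeylAlgebra n) (WeylAlgebra n)} {f g : Symbol n} {k : ℕ}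
    (hf : f.IsHomogeneous k) (hg : g = 0 ∨ g.totalDegree < k) (h : ofSymbol (f + g) ∈ I) :
    f ∈ charIdeal I := Ideal.subset_span ⟨k, hf, g, hg, h⟩

/-- If `I` contains no nonzero polynomial, its characteristic variety contains the zero section. -/
theorem charIdeal_le_ker_constantCoeff {I : Submodule (WeylAlgebra n) (WeylAlgebra n)}
    (hI : ∀ p : MvPolynomial (Fin n) ℂ, polyX p ∈ I → p = 0) :
    charIdeal I ≤ RingHom.ker (MvPolynomial.constantCoeff (σ := Fin n)
      (R := MvPolynomial (Fin n) ℂ)) := by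
  refine Ideal.span_le.2 ?_
  rintro f ⟨k, hf, g, hg, h⟩
  change MvPolynomial.constantCoeff f = 0
  rcases Nat.eq_zero_or_pos k with rfl | hk
  · rw [hg.resolve_right (Nat.not_lt_zero _), add_zero] at h
    have hf' : f = MvPolynomial.C (MvPolynomial.constantCoeff f) := by
      rw [MvPolynomial.constantCoeff_eq]
      exact MvPolynomial.totalDegree_eq_zero_iff_eq_C.1 (Nat.le_zero.1 hf.totalDegree_le)
    rw [hf', ofSymbol_C] at h
    exact hI _ h
  · rw [MvPolynomial.constantCoeff_eq]
    exact hf.coeff_eq_zero (by simpa using hk.ne)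

/-- Setting ξ = 0 maps the quotient onto ℂ[x], which has dimension n. -/
theorem le_ringKrullDim_of_forall_polyX {I : Submodule (WeylAlgebra n) (WeylAlgebra n)}
    (hI : ∀ p : MvPolynomial (Fin n) ℂ, polyX p ∈ I → p = 0) :
    (n : WithBot ℕ∞) ≤ ringKrullDim (Symbol n ⧸ charIdeal I) := by
  have h0 : ∀ f ∈ charIdeal I, MvPolynomial.constantCoeff (σ := Fin n)
      (R := MvPolynomial (Fin n) ℂ) f = 0 := fun f hf => charIdeal_le_ker_constantCoeff hI hf
  let F : (Symbol n ⧸ charIdeal I) →+* MvPolynomial (Fin n) ℂ :=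
    Ideal.Quotient.lift (charIdeal I) _ h0
  have hF : Function.Surjective F := Ideal.Quotient.lift_surjective_of_surjective _ h0
    fun p => ⟨MvPolynomial.C p, MvPolynomial.constantCoeff_C _ p⟩
  have h1 : ringKrullDim (MvPolynomial (Fin n) ℂ) ≤ ringKrullDim (Symbol n ⧸ charIdeal I) :=
    ringKrullDim_le_of_surjective F hF
  rwa [MvPolynomial.ringKrullDim_of_isNoetherianRing, ringKrullDim_eq_zero_of_field, zero_add,
    Nat.card_fin] at h1

end Symbol

end WeylAlgebra

/-! ### Holonomicity -/

namespace Pearcey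

open WeylAlgebra

section Holonomic

open MvPolynomial (C X)

theorem symbol_d₁_d₂_mem : (C 4 * (X 0 * X 1) + C (2 * X 1) * (X 2 * X 0) +
    C (X 0) * (X 2 * X 2) : Symbol 3) ∈ charIdeal idealB := by
  refine mem_charIdeal (k := 2) (g := 0) ?_ (Or.inl rfl) ?_
  · exact ((((MvPolynomial.isHomogeneous_X _ 0).mul (MvPolynomial.isHomogeneous_X _ 1)).C_mul _).add
      (((MvPolynomial.isHomogeneous_X _ 2).mul (MvPolynomial.isHomogeneous_X _ 0)).C_mul _)).add
      (((MvPolynomial.isHomogeneous_X _ 2).mul (MvPolynomial.isHomogeneous_X _ 2)).C_mul _)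
  · have : opB 0 ∈ idealB := Submodule.subset_span ⟨0, rfl⟩
    simp only [opB_eq, Matrix.cons_val] at this
    simp only [add_zero, ofSymbol_add, ofSymbol_C_mul_X_mul_X]
    simp only [map_mul, map_ofNat, polyX_X]
    simpa only [mul_assoc, pow_two] using this

theorem symbol_d₂_d₂_mem : (C 4 * (X 1 * X 1) + C (X 0) * (X 2 * X 0) +
    C (2 * X 1) * (X 2 * X 1) : Symbol 3) ∈ charIdeal idealB := by
  refine mem_charIdeal (k := 2) (g := C 1 * X 2) ?_ (Or.inr ?_) ?_
  · exact ((((MvPolynomial.isHomogeneous_X _ 1).mul (MvPolynomial.isHomogeneous_X _ 1)).C_mul _).add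
      (((MvPolynomial.isHomogeneous_X _ 2).mul (MvPolynomial.isHomogeneous_X _ 0)).C_mul _)).add
      (((MvPolynomial.isHomogeneous_X _ 2).mul (MvPolynomial.isHomogeneous_X _ 1)).C_mul _)
  · rw [map_one, one_mul, MvPolynomial.totalDegree_X]
    exact one_lt_two
  · have : opB 1 ∈ idealB := Submodule.subset_span ⟨1, rfl⟩
    simp only [opB_eq, Matrix.cons_val] at this
    simp only [ofSymbol_add, ofSymbol_C_mul_X_mul_X, ofSymbol_C_mul_X]
    simp only [map_mul, map_ofNat, polyX_X, map_one, one_mul]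
    simpa only [mul_assoc, pow_two] using this

theorem symbol_d₁_d₁_mem : (C 1 * (X 2 * X 1) + C (-1) * (X 0 * X 0) : Symbol 3) ∈
    charIdeal idealB := by
  refine mem_charIdeal (k := 2) (g := 0) ?_ (Or.inl rfl) ?_
  · exact (((MvPolynomial.isHomogeneous_X _ 2).mul (MvPolynomial.isHomogeneous_X _ 1)).C_mul _).add
      (((MvPolynomial.isHomogeneous_X _ 0).mul (MvPolynomial.isHomogeneous_X _ 0)).C_mul _)
  · have : opB 2 ∈ idealB := Submodule.subset_span ⟨2, rfl⟩
    simp only [opB_eq, Matrix.cons_val] at this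
    simp only [add_zero, ofSymbol_add, ofSymbol_C_mul_X_mul_X]
    simp only [map_neg, map_one]
    simpa only [one_mul, neg_mul, ← sub_eq_add_neg, pow_two] using this

theorem symbol_euler_mem : (C (3 * X 0) * X 0 + C (2 * X 1) * X 1 +
    C (4 * X 2) * X 2 : Symbol 3) ∈ charIdeal idealB := by
  refine mem_charIdeal (k := 1) (g := C 3) ?_ (Or.inr ?_) ?_
  · exact (((MvPolynomial.isHomogeneous_X _ 0).C_mul _).add ((MvPolynomial.isHomogeneous_X _ 1).C_mul _)).add
      ((MvPolynomial.isHomogeneous_X _ 2).C_mul _)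
  · rw [MvPolynomial.totalDegree_C]
    exact one_pos
  · have : opB 3 ∈ idealB := Submodule.subset_span ⟨3, rfl⟩
    simp only [opB_eq, Matrix.cons_val] at this
    simp only [ofSymbol_add, ofSymbol_C_mul_X, ofSymbol_C]
    simp only [map_mul, map_ofNat, polyX_X]
    exact this

theorem ringKrullDim_quotient_le_of_mem {Q : Ideal (Symbol 3)} (h0 : X 0 ∈ Q) (h1 : X 1 ∈ Q)
    (h2 : X 2 ∈ Q) : ringKrullDim (Symbol 3 ⧸ Q) ≤ 3 := by
  have hsurj : Function.Surjective ((Ideal.Quotient.mk Q).comp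
      (C : MvPolynomial (Fin 3) ℂ →+* Symbol 3)) := by
    intro z
    obtain ⟨f, rfl⟩ := Ideal.Quotient.mk_surjective z
    induction f using MvPolynomial.induction_on with
    | C c => exact ⟨c, rfl⟩
    | add p q hp hq =>
      obtain ⟨a, ha⟩ := hp
      obtain ⟨b, hb⟩ := hq
      exact ⟨a + b, by rw [map_add, map_add, ha, hb]⟩
    | mul_X p i _ =>
      refine ⟨0, ?_⟩
      rw [map_zero, eq_comm, Ideal.Quotient.eq_zero_iff_mem]
      refine Q.mul_mem_left _ ?_
      fin_cases i
      · exact h0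
      · exact h1
      · exact h2
  have : ringKrullDim (Symbol 3 ⧸ Q) ≤ ringKrullDim (MvPolynomial (Fin 3) ℂ) :=
    ringKrullDim_le_of_surjective _ hsurj
  rwa [MvPolynomial.ringKrullDim_of_isNoetherianRing, ringKrullDim_eq_zero_of_field, zero_add,
    Nat.card_fin] at this

/-- With ξ_y ≠ 0 in a domain, A is algebraic over ℂ[ξ_y, ξ₁, x₂]: the symbol of P₃ gives ξ₂ =
ξ₁²/ξ_y, then that of P₁ gives x₁ and that of P₄ gives y. -/
theorem ringKrullDim_le_of_surjective_of_ne_zero {A : Type} [CommRing A] [IsDomain A]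
    [Algebra ℂ A] (π : Symbol 3 →ₐ[ℂ] A) (hsurj : Function.Surjective π)
    (hπ : ∀ f ∈ charIdeal idealB, π f = 0) (hη : π (X 2) ≠ 0) : ringKrullDim A ≤ 3 := by
  have : Algebra.FiniteType ℂ (Symbol 3) :=
    Algebra.FiniteType.trans (S := MvPolynomial (Fin 3) ℂ) inferInstance inferInstance
  have : Algebra.FiniteType ℂ A := Algebra.FiniteType.of_surjective π hsurj
  let s : Set A := Set.range ![π (X 2), π (X 0), π (C (X 1))]
  have hs : Cardinal.mk s ≤ (3 : ℕ) := Cardinal.mk_range_le.trans (by simp)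
  let B := Subalgebra.algebraicClosure (Algebra.adjoin ℂ s) A
  have hmem : ∀ a ∈ s, a ∈ B := fun a ha =>
    isAlgebraic_algebraMap (⟨a, Algebra.subset_adjoin ha⟩ : Algebra.adjoin ℂ s)
  have b2 : π (X 2) ∈ B := hmem _ ⟨0, rfl⟩
  have b0 : π (X 0) ∈ B := hmem _ ⟨1, rfl⟩
  have bx1 : π (C (X 1)) ∈ B := hmem _ ⟨2, rfl⟩
  -- Division by ξ_y stays inside the algebraic closure, so no fraction field is needed.
  have hdiv : ∀ z, π (X 2) * z ∈ B → z ∈ B := fun z hz =>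
    IsAlgebraic.of_mul (mem_nonZeroDivisors_of_ne_zero hη) b2 hz
  have e1 := hπ _ symbol_d₁_d₂_mem
  have e3 := hπ _ symbol_d₁_d₁_mem
  have e4 := hπ _ symbol_euler_mem
  simp only [map_add, map_mul, map_ofNat, map_neg, map_one] at e1 e3 e4
  have b1 : π (X 1) ∈ B := by
    refine hdiv _ ?_
    rw [show π (X 2) * π (X 1) = π (X 0) * π (X 0) by linear_combination e3]
    exact B.mul_mem b0 b0
  have hn : ∀ n : ℕ, (n : A) ∈ B := fun n => B.natCast_mem n
  have bx0 : π (C (X 0)) ∈ B := by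
    refine hdiv _ (hdiv _ ?_)
    rw [show π (X 2) * (π (X 2) * π (C (X 0))) = -((4 : ℕ) * (π (X 0) * π (X 1)) +
      (2 : ℕ) * π (C (X 1)) * (π (X 2) * π (X 0))) by push_cast; linear_combination e1]
    exact B.neg_mem (B.add_mem (B.mul_mem (hn 4) (B.mul_mem b0 b1))
      (B.mul_mem (B.mul_mem (hn 2) bx1) (B.mul_mem b2 b0)))
  have bx2 : π (C (X 2)) ∈ B := by
    refine hdiv _ ?_
    have e : (4 : A) * (π (X 2) * π (C (X 2))) = -((3 : ℕ) * π (C (X 0)) * π (X 0) +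
        (2 : ℕ) * π (C (X 1)) * π (X 1)) := by
      push_cast
      linear_combination e4
    have h4 : (4 : A) * (π (X 2) * π (C (X 2))) ∈ B := by
      rw [e]
      exact B.neg_mem (B.add_mem (B.mul_mem (B.mul_mem (hn 3) bx0) b0)
        (B.mul_mem (B.mul_mem (hn 2) bx1) b1))
    have hq : algebraMap ℂ A (1 / 4) ∈ B :=
      B.algebraMap_mem (algebraMap ℂ (Algebra.adjoin ℂ s) (1 / 4))
    have e' : π (X 2) * π (C (X 2)) =
        algebraMap ℂ A (1 / 4) * ((4 : A) * (π (X 2) * π (C (X 2)))) := by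
      linear_combination -(π (X 2) * π (C (X 2))) * four_mul_algebraMap_quarter (R := A)
    rw [e']
    exact B.mul_mem hq h4
  have : Algebra.IsAlgebraic (Algebra.adjoin ℂ s) A := by
    refine ⟨fun z => ?_⟩
    obtain ⟨f, rfl⟩ := hsurj z
    change π f ∈ B
    induction f using MvPolynomial.induction_on with
    | C c =>
      induction c using MvPolynomial.induction_on with
      | C c =>
        have : π (C (C c)) = algebraMap ℂ A c := π.commutes c
        rw [this]
        exact B.algebraMap_mem (algebraMap ℂ (Algebra.adjoin ℂ s) c)
      | add p q hp hq => rw [map_add, map_add]; exact B.add_mem hp hq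
      | mul_X p i hp =>
        rw [map_mul, map_mul]
        refine B.mul_mem hp ?_
        fin_cases i
        · exact bx0
        · exact bx1
        · exact bx2
    | add p q hp hq => rw [map_add]; exact B.add_mem hp hq
    | mul_X p i hp =>
      rw [map_mul]
      refine B.mul_mem hp ?_
      fin_cases i
      · exact b0
      · exact b1
      · exact b2
  exact ringKrullDim_le_of_isAlgebraic (k := ℂ) s hs

theorem isHolonomic_idealB : IsHolonomic idealB := by
  refine Or.inr (le_antisymm ?_ (le_ringKrullDim_of_forall_polyX fun p hp => ?_))
  · refine ringKrullDim_quotient_le_of_isPrime fun Q hprime hQ => ?_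
    -- If ξ_y vanishes on the component, the symbols of P₃ and P₂ reduce to -ξ₁² and 4ξ₂², so the
    -- component lies in the zero section.
    by_cases h : X 2 ∈ Q
    · refine ringKrullDim_quotient_le_of_mem ?_ ?_ h
      · refine hprime.mem_of_pow_mem 2 ?_
        have h3 := hQ symbol_d₁_d₁_mem
        have : (X 0 ^ 2 : Symbol 3) = X 1 * X 2 -
            (C 1 * (X 2 * X 1) + C (-1) * (X 0 * X 0)) := by
          rw [map_neg, map_one]
          ring
        rw [this]
        exact Q.sub_mem (Q.mul_mem_left _ h) h3
      · refine hprime.mem_of_pow_mem 2 ?_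
        have h2 := hQ symbol_d₂_d₂_mem
        have : (X 1 ^ 2 : Symbol 3) = C (C (1 / 4)) * ((C 4 * (X 1 * X 1) + C (X 0) * (X 2 * X 0) +
            C (2 * X 1) * (X 2 * X 1)) - (C (X 0) * X 0 + C (2 * X 1) * X 1) * X 2) := by
          have h4 : (C (C (1 / 4)) * C 4 : Symbol 3) = 1 := by
            rw [← map_mul, ← map_ofNat (C : ℂ →+* MvPolynomial (Fin 3) ℂ) 4, ← map_mul]
            norm_num
          linear_combination -(X 1 ^ 2) * h4
        rw [this]
        exact Q.mul_mem_left _ (Q.sub_mem h2 (Q.mul_mem_left _ h))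
    · exact ringKrullDim_le_of_surjective_of_ne_zero (Ideal.Quotient.mkₐ ℂ Q)
        (Ideal.Quotient.mkₐ_surjective ℂ Q) (fun f hf => Ideal.Quotient.eq_zero_iff_mem.2 (hQ hf))
        fun h' => h (Ideal.Quotient.eq_zero_iff_mem.1 h')
  · exact (eq_zero_of_mem_idealB (p₀ := p) (p₁ := 0) (p₂ := 0) (by simpa using hp)).1

end Holonomic

end Pearcey
theorem theorem7 :
    -- `D_B / I_B` is holonomic of rank `3`
    WeylAlgebra.IsHolonomic Pearcey.idealB ∧
    WeylAlgebra.rank Pearcey.idealB = 3 ∧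
    -- for every holomorphic root `s` of the cubic and every branch `h` of `w^{-1/2}`, the Borel
    -- transform of the WKB solution converges near the graph `y = -∫ ω₋₁` and is a solution
    ∀ (U : Set (Fin 2 → ℂ)) (s h : (Fin 2 → ℂ) → ℂ), IsOpen U →
      AnalyticOnNhd ℂ s U → AnalyticOnNhd ℂ h U →
      (∀ p ∈ U, 4 * s p ^ 3 + 2 * p 1 * s p + p 0 = 0) →
      (∀ p ∈ U, h p ^ 2 * Pearcey.w s p = 1) →
      ∃ N : Set (Fin 3 → ℂ), IsOpen N ∧
        (∀ q ∈ N, Pearcey.base q ∈ U) ∧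
        (∀ p ∈ U, ![p 0, p 1, -Pearcey.phase s p] ∈ N) ∧
        ∀ (V : TopologicalSpace.Opens (Fin 3 → ℂ)) (r : (Fin 3 → ℂ) → ℂ),
          (V : Set (Fin 3 → ℂ)) ⊆ N → AnalyticOnNhd ℂ r V →
          (∀ q ∈ V, r q ≠ 0 ∧ r q ^ 2 = q 2 + Pearcey.phase s (Pearcey.base q)) →
          ∃ u : Holo V,
            (∀ q ∈ V, HasSum (fun n : ℕ => Pearcey.borelTerm s h r n q) (u.1 q)) ∧
            IsHoloSolution Pearcey.idealB u := by
  exact ⟨Pearcey.isHolonomic_idealB, Pearcey.rank_idealB, Pearcey.exists_borel_solution⟩
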